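/- **Model.** Let $L\ge 0$, $D,B_e,\gamma,M$ be real constants and $B_0=LD+2B_e$. The row latent space is a cube $Q=\prod_{c=1}^d[a_c,a_c+s]\subset\mathbb R^d$ ($d\ge1$, $s>0$) with the uniform probability measure and with the metric of some norm $\|\cdot\|$ on $\mathbb R^d$ (for example the sup norm or the Euclidean norm; a seminorm is allowed) for which $Q$ has diameter at most $D$. The column latent space $X_2$ is a compact metric space with a Borel probability measure $P_2$. The function $f:Q\times X_2\to\mathbb R$ satisfies $|f(x,y)-f(x',y')|\le L\max(\|x-x'\|,d_{X_2}(y,y'))$ and $|f|\le M$. For $u\in[m]$, $i\in[n]$ ($m,n\ge1$) let $x_1(u)$ be uniform on $Q$, let $x_2(i)$ have law $P_2$, let $\eta(u,i)$ have mean $0$, variance $\gamma^2$ and $|\eta(u,i)|\le B_e$ almost surely, and let entry $(u,i)$ be observed with probability $p\in[0,1]$, all of these being mutually independent. Put $A(u,i)=f(x_1(u),x_2(i))$ and $Z(u,i)=A(u,i)+\eta(u,i)$. **Estimator.** Let $\mathcal O^{uv}$ be the set of columns observed in both rows $u$ and $v$, let $m_{uv}=\frac1{|\mathcal O^{uv}|}\sum_{j\in\mathcal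 O^{uv}}(Z(u,j)-Z(v,j))$ and $s_{uv}^2=\frac1{|\mathcal O^{uv}|-1}\sum_{j\in\mathcal O^{uv}}(Z(u,j)-Z(v,j)-m_{uv})^2$. Let $\mathcal S_u^\beta(i)$ be the set of rows $v\ne u$ such that $(v,i)$ is observed and $|\mathcal O^{uv}|\ge\beta$, and let $\mathcal S_u^{\beta,k}(i)$ consist of the (at most) $k$ rows $v$ of $\mathcal S_u^\beta(i)$ with the smallest $s^2_{uv}$, where ties are broken by an arbitrary total order of the rows that is fixed in advance and may depend on $(u,i)$. The estimate $\hat A(u,i)$ is the average of $Z(v,i)+m_{uv}$ over $v\in\mathcal S_u^{\beta,k}(i)$, and $0$ if this set is empty. Let $MSE(\hat A)=\mathbb E\big[\frac1{mn}\sum_{u,i}(\hat A(u,i)-A(u,i))^2\big]$. Take $\beta=np^2/2$ and let $k$ be $\frac18(mp)^{1/3}$ rounded up or down to an integer (that is, $|k-\frac18(mp)^{1/3}|<1$). **Bound.** There are positive constants $c_1$ (numerical), $c_2$ (depending only on $B_0>0$) and $C$ (depending only on $L,D,B_e,\gamma,M$) such that, with $$F_1=C\max\{(mp)^{-4/(3d)},(np^2)^{-1/3},(mp)^{-1/3}\},\qquad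 F_2=3e^{-c_1(mp)^{1/3}}+6m\,e^{-c_2(np^2)^{1/3}},$$ whenever $p\ge\max\{m^{-1+\delta},n^{-1/2+\delta}\}$ for some $\delta>0$ and $m,n$ are large enough that $F_1\le\min\{\frac12,B_0\}$, $$MSE(\hat A)\le\tfrac{21}4F_1\ln\Big(\frac{2B_0}{F_1}\Big)+4B_0^2F_2 .$$ The constants do not depend on $m,n,p,\delta,d$, the cube, the norm, $X_2$, $P_2$, $f$ or the laws of the noise. **Consistency.** Fix $L,D,B_e,\gamma,M$, $\delta>0$ and $\delta'\in(0,1)$, and consider a sequence of such models (in which $m,n,p,d$, the cube, the norm, $X_2$, $P_2$, $f$ and the noise may all vary) with $m,n\to\infty$, $p\ge\max\{m^{-1+\delta},n^{-1/2+\delta}\}$, $d=o(\log m)$ and $\log m<(np^2)^{\delta'/3}$. Then $MSE(\hat A)\to0$. -/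

import Mathlib

open MeasureTheory ProbabilityTheory Filter Topology Asymptotics
open scoped ENNReal

universe u v

namespace BlindRegression

/-! ### The user-user nearest neighbour algorithm

It takes a mask `obs` (which entries are observed) and a matrix `Z`, and reads `Z` only at
observed entries. -/

section Algorithm

/-- The overlap `𝒪^{uv}`: the columns that are observed in row `u` and in row `v`. -/
def overlap {m n : ℕ} (obs : Fin m → Fin n → Bool) (u v : Fin m) : Finset (Fin n) :=
  Finset.univ.filter fun j => obs u j = true ∧ obs v j = true

/-- The sample mean `m_{uv}` of the differences of the rows `u` and `v` on their overlap. -/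
noncomputable def diffMean {m n : ℕ} (obs : Fin m → Fin n → Bool) (Z : Fin m → Fin n → ℝ)
    (u v : Fin m) : ℝ :=
  (∑ j ∈ overlap obs u v, (Z u j - Z v j)) / ((overlap obs u v).card : ℝ)

/-- The sample variance `s²_{uv}` of the differences of the rows `u` and `v` on their overlap. -/
noncomputable def diffVar {m n : ℕ} (obs : Fin m → Fin n → Bool) (Z : Fin m → Fin n → ℝ)
    (u v : Fin m) : ℝ :=
  (∑ j ∈ overlap obs u v, (Z u j - Z v j - diffMean obs Z u v) ^ 2) /
    (((overlap obs u v).card : ℝ) - 1)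

open Classical in
/-- The set `𝒮_u^β(i)` of the rows `v ≠ u` in which column `i` is observed and that overlap with
row `u` in at least `β` columns. -/
noncomputable def candidates {m n : ℕ} (β : ℝ) (obs : Fin m → Fin n → Bool)
    (u : Fin m) (i : Fin n) : Finset (Fin m) :=
  Finset.univ.filter fun v => v ≠ u ∧ obs v i = true ∧ β ≤ ((overlap obs u v).card : ℝ)

/-- Row `w` is preferred to row `v` as a neighbour of row `u`: its sample variance is smaller, or
the sample variances agree and `w` comes first in the order `σ` that breaks ties. -/
def Closer {m n : ℕ} (obs : Fin m → Fin n → Bool) (Z : Fin m → Fin n → ℝ)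
    (σ : Equiv.Perm (Fin m)) (u w v : Fin m) : Prop :=
  diffVar obs Z u w < diffVar obs Z u v ∨
    (diffVar obs Z u w = diffVar obs Z u v ∧ σ w < σ v)

open Classical in
/-- The (at most) `k` candidate rows with the smallest sample variance. -/
noncomputable def nearest {m n : ℕ} (β : ℝ) (k : ℕ) (obs : Fin m → Fin n → Bool)
    (Z : Fin m → Fin n → ℝ) (σ : Equiv.Perm (Fin m)) (u : Fin m) (i : Fin n) :
    Finset (Fin m) :=
  (candidates β obs u i).filter fun v =>
    ((candidates β obs u i).filter fun w => Closer obs Z σ u w v).card < k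

/-- The estimate of entry `(u, i)`: the average of `Z(v,i) + m_{uv}` over the nearest rows `v`. If
there are none, it is `0` (as `0 / 0 = 0`). -/
noncomputable def estimate {m n : ℕ} (β : ℝ) (k : ℕ) (obs : Fin m → Fin n → Bool)
    (Z : Fin m → Fin n → ℝ) (σ : Equiv.Perm (Fin m)) (u : Fin m) (i : Fin n) : ℝ :=
  (∑ v ∈ nearest β k obs Z σ u i, (Z v i + diffMean obs Z u v)) /
    ((nearest β k obs Z σ u i).card : ℝ)

end Algorithm

/-- The axis-parallel cube in `ℝ^d` with lowest corner `a` and side length `s`. -/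
def cube {d : ℕ} (a : Fin d → ℝ) (s : ℝ) : Set (Fin d → ℝ) :=
  Set.Icc a (fun c => a c + s)

/-- The latent variable model, with the uniform measure on a cube as row latent space and an
arbitrary compact metric space with a Borel probability measure as column latent space.
`L` is the Lipschitz constant of the latent function, `D` bounds the diameter of the cube, `Be`
bounds the noise, whose variance is `γ ^ 2`, and `M` bounds the latent function. -/
structure LatentModel (L D Be γ M : ℝ) where
  /-- number of rows -/
  m : ℕ
  /-- number of columns -/
  n : ℕ
  m_pos : 0 < m
  n_pos : 0 < n
  /-- probability that an entry is observed -/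
  p : ℝ
  p_mem : p ∈ Set.Icc (0 : ℝ) 1
  /-- dimension of the row latent space -/
  d : ℕ
  d_pos : 0 < d
  /-- lowest corner of the cube -/
  corner : Fin d → ℝ
  /-- side length of the cube -/
  side : ℝ
  side_pos : 0 < side
  /-- the (semi)norm on `ℝ^d` whose distance is the metric of the cube -/
  rowNorm : Seminorm ℝ (Fin d → ℝ)
  diam_le : ∀ x ∈ cube corner side, ∀ x' ∈ cube corner side, rowNorm (x - x') ≤ D
  /-- the column latent space -/
  X₂ : Type u
  [metricX₂ : MetricSpace X₂]
  [compactX₂ : CompactSpace X₂]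
  [measurableX₂ : MeasurableSpace X₂]
  [borelX₂ : BorelSpace X₂]
  /-- the law of the column features -/
  P₂ : Measure X₂
  [probP₂ : IsProbabilityMeasure P₂]
  /-- the latent function (only its values on the cube matter) -/
  f : (Fin d → ℝ) → X₂ → ℝ
  lipschitz : ∀ x ∈ cube corner side, ∀ x' ∈ cube corner side, ∀ y y' : X₂,
    |f x y - f x' y'| ≤ L * max (rowNorm (x - x')) (dist y y')
  bounded : ∀ x ∈ cube corner side, ∀ y : X₂, |f x y| ≤ M
  /-- the probability space -/
  Ω : Type v
  [measurableΩ : MeasurableSpace Ω]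
  μ : Measure Ω
  [probμ : IsProbabilityMeasure μ]
  /-- row features -/
  x₁ : Fin m → Ω → (Fin d → ℝ)
  /-- column features -/
  x₂ : Fin n → Ω → X₂
  /-- noise -/
  η : Fin m → Fin n → Ω → ℝ
  /-- the event that an entry is observed -/
  obs : Fin m → Fin n → Ω → Bool
  measurable_x₁ : ∀ u, Measurable (x₁ u)
  measurable_x₂ : ∀ i, Measurable (x₂ i)
  measurable_η : ∀ u i, Measurable (η u i)
  measurable_obs : ∀ u i, Measurable (obs u i)
  law_x₁ : ∀ u, μ.map (x₁ u) = ProbabilityTheory.cond volume (cube corner side)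
  law_x₂ : ∀ i, μ.map (x₂ i) = P₂
  noise_mean : ∀ u i, ∫ ω, η u i ω ∂μ = 0
  noise_var : ∀ u i, variance (η u i) μ = γ ^ 2
  noise_bound : ∀ u i, ∀ᵐ ω ∂μ, |η u i ω| ≤ Be
  law_obs : ∀ u i, μ {ω | obs u i ω = true} = ENNReal.ofReal p
  /-- all features, noise variables and observation events are mutually independent -/
  indep : iIndep
    (Sum.elim (fun u => MeasurableSpace.comap (x₁ u) inferInstance)
      (Sum.elim (fun i => MeasurableSpace.comap (x₂ i) inferInstance)
        (Sum.elim
          (fun e : Fin m × Fin n => MeasurableSpace.comap (η e.1 e.2) inferInstance)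
          (fun e : Fin m × Fin n => MeasurableSpace.comap (obs e.1 e.2) inferInstance)))) μ

attribute [instance] LatentModel.metricX₂ LatentModel.compactX₂ LatentModel.measurableX₂
  LatentModel.borelX₂ LatentModel.probP₂ LatentModel.measurableΩ LatentModel.probμ

namespace LatentModel

variable {L D Be γ M : ℝ}

/-- The unknown matrix `A(u,i) = f(x₁(u), x₂(i))`. -/
def A (𝓜 : LatentModel.{u, v} L D Be γ M) (ω : 𝓜.Ω) (u : Fin 𝓜.m) (i : Fin 𝓜.n) : ℝ :=
  𝓜.f (𝓜.x₁ u ω) (𝓜.x₂ i ω)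

/-- The noisy matrix `Z(u,i) = A(u,i) + η(u,i)`. -/
def Z (𝓜 : LatentModel.{u, v} L D Be γ M) (ω : 𝓜.Ω) (u : Fin 𝓜.m) (i : Fin 𝓜.n) : ℝ :=
  𝓜.A ω u i + 𝓜.η u i ω

/-- The mean squared error of the user-user `k`-nearest neighbour estimate with overlap parameter
`β`, where `σ u i` is the order of the rows that breaks ties for entry `(u, i)`. It is written as
the integral of a nonnegative function with values in `[0, ∞]`, so no integrability is needed. -/
noncomputable def mse (𝓜 : LatentModel.{u, v} L D Be γ M) (β : ℝ) (k : ℕ)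
    (σ : Fin 𝓜.m → Fin 𝓜.n → Equiv.Perm (Fin 𝓜.m)) : ℝ≥0∞ :=
  ∫⁻ ω, ENNReal.ofReal ((1 / ((𝓜.m : ℝ) * (𝓜.n : ℝ))) * ∑ u, ∑ i,
    (estimate β k (fun u' i' => 𝓜.obs u' i' ω) (𝓜.Z ω) (σ u i) u i - 𝓜.A ω u i) ^ 2) ∂𝓜.μ

end LatentModel

/-- The error term `F₁ = C max {(mp)^{-4/(3d)}, (np²)^{-1/3}, (mp)^{-1/3}}`. -/
noncomputable def F₁ (C : ℝ) (d m n : ℕ) (p : ℝ) : ℝ :=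
  C * max (max (((m : ℝ) * p) ^ (-(4 / (3 * (d : ℝ))))) (((n : ℝ) * p ^ 2) ^ (-(1 / 3 : ℝ))))
    (((m : ℝ) * p) ^ (-(1 / 3 : ℝ)))

/-- The error term `F₂ = 3 exp(-c₁ (mp)^{1/3}) + 6 m exp(-c₂ (np²)^{1/3})`. -/
noncomputable def F₂ (c₁ c₂ : ℝ) (m n : ℕ) (p : ℝ) : ℝ :=
  3 * Real.exp (-(c₁ * ((m : ℝ) * p) ^ (1 / 3 : ℝ))) +
    6 * (m : ℝ) * Real.exp (-(c₂ * ((n : ℝ) * p ^ 2) ^ (1 / 3 : ℝ)))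

end BlindRegression

namespace BlindRegression

/-! ### Selecting the rows with the smallest keys -/

section TopK

open Classical in
/-- The (at most) `k` elements of `c` with the smallest key, ties being broken by `σ`. -/
noncomputable def topk {m : ℕ} (c : Finset (Fin m)) (key : Fin m → ℝ) (σ : Equiv.Perm (Fin m))
    (k : ℕ) : Finset (Fin m) :=
  c.filter fun v => (c.filter fun w => key w < key v ∨ (key w = key v ∧ σ w < σ v)).card < k

variable {m : ℕ} {c : Finset (Fin m)} {key key' : Fin m → ℝ} {σ : Equiv.Perm (Fin m)} {k : ℕ}

theorem nearest_eq_topk {n : ℕ} (β : ℝ) (k : ℕ) (obs : Fin m → Fin n → Bool)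
    (Z : Fin m → Fin n → ℝ) (σ : Equiv.Perm (Fin m)) (u : Fin m) (i : Fin n) :
    nearest β k obs Z σ u i = topk (candidates β obs u i) (diffVar obs Z u) σ k := by
  unfold nearest topk Closer
  congr!

theorem topk_subset : topk c key σ k ⊆ c := by
  classical exact Finset.filter_subset _ _

theorem topk_congr (h : ∀ v ∈ c, key v = key' v) : topk c key σ k = topk c key' σ k := by
  classical
  unfold topk
  refine Finset.filter_congr fun v hv => ?_
  have : (c.filter fun w => key w < key v ∨ (key w = key v ∧ σ w < σ v))
      = (c.filter fun w => key' w < key' v ∨ (key' w = key' v ∧ σ w < σ v)) :=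
    Finset.filter_congr fun w hw => by rw [h v hv, h w hw]
  rw [this]

theorem card_topk : (topk c key σ k).card = min k c.card := by
  classical
  set rank : Fin m → ℕ := fun v =>
    (c.filter fun w => key w < key v ∨ (key w = key v ∧ σ w < σ v)).card with hrank
  have hlt : ∀ v ∈ c, rank v < c.card := fun v hv => by
    refine Finset.card_lt_card ⟨Finset.filter_subset _ _, fun h => ?_⟩
    have := (Finset.mem_filter.1 (h hv)).2
    simp at this
  have hmono : ∀ v ∈ c, ∀ w ∈ c, (key w < key v ∨ (key w = key v ∧ σ w < σ v)) →
      rank w < rank v := fun v hv w hw h => by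
    refine Finset.card_lt_card ⟨fun x hx => ?_, fun hs => ?_⟩
    · rw [Finset.mem_filter] at hx ⊢
      refine ⟨hx.1, ?_⟩
      rcases hx.2 with h1 | h1 <;> rcases h with h2 | h2
      · exact Or.inl (h1.trans h2)
      · exact Or.inl (h2.1 ▸ h1)
      · exact Or.inl (h1.1 ▸ h2)
      · exact Or.inr ⟨h1.1.trans h2.1, h1.2.trans h2.2⟩
    · have := (Finset.mem_filter.1 (hs (Finset.mem_filter.2 ⟨hw, h⟩))).2
      simp at this
  have hinj : Set.InjOn rank c := fun v hv w hw h => by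
    by_contra hne
    rcases lt_trichotomy (key v) (key w) with h1 | h1 | h1
    · exact absurd h (hmono w hw v hv (Or.inl h1)).ne
    · rcases lt_trichotomy (σ v) (σ w) with h2 | h2 | h2
      · exact absurd h (hmono w hw v hv (Or.inr ⟨h1, h2⟩)).ne
      · exact hne (σ.injective h2)
      · exact absurd h.symm (hmono v hv w hw (Or.inr ⟨h1.symm, h2⟩)).ne
    · exact absurd h.symm (hmono v hv w hw (Or.inl h1)).ne
  have himg : c.image rank = Finset.range c.card := by
    refine Finset.eq_of_subset_of_card_le (fun x hx => ?_) ?_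
    · obtain ⟨v, hv, rfl⟩ := Finset.mem_image.1 hx
      exact Finset.mem_range.2 (hlt v hv)
    · rw [Finset.card_image_of_injOn hinj, Finset.card_range]
  have h1 : topk c key σ k = c.filter fun v => rank v < k := rfl
  have h2 : (c.filter fun v => rank v < k).image rank = Finset.range (min k c.card) := by
    ext x
    simp only [Finset.mem_image, Finset.mem_filter, Finset.mem_range, lt_min_iff]
    constructor
    · rintro ⟨v, ⟨hv, hk⟩, rfl⟩
      exact ⟨hk, hlt v hv⟩
    · rintro ⟨hk, hx⟩
      rw [← Finset.mem_range, ← himg, Finset.mem_image] at hx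
      obtain ⟨v, hv, rfl⟩ := hx
      exact ⟨v, ⟨hv, hk⟩, rfl⟩
  rw [h1, ← Finset.card_image_of_injOn (hinj.mono (Finset.coe_subset.2 (Finset.filter_subset _ _))),
    h2, Finset.card_range]

theorem le_of_mem_topk_of_notMem {v w : Fin m} (hv : v ∈ topk c key σ k) (hw : w ∈ c)
    (hw' : w ∉ topk c key σ k) : key v ≤ key w := by
  classical
  by_contra! hlt
  refine hw' (Finset.mem_filter.2 ⟨hw, lt_of_le_of_lt (Finset.card_le_card fun x hx => ?_)
    (Finset.mem_filter.1 hv).2⟩)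
  rw [Finset.mem_filter] at hx ⊢
  refine ⟨hx.1, Or.inl ?_⟩
  rcases hx.2 with h | h
  · exact h.trans hlt
  · exact h.1 ▸ hlt

theorem sum_topk_le {T : Finset (Fin m)} (hT : T ⊆ c) (hcard : T.card = (topk c key σ k).card) :
    ∑ v ∈ topk c key σ k, key v ≤ ∑ v ∈ T, key v := by
  classical
  set S := topk c key σ k
  have h1 : (S \ T).card = (T \ S).card := by
    have := Finset.card_sdiff_add_card_inter S T
    have h2 := Finset.card_sdiff_add_card_inter T S
    rw [Finset.inter_comm] at h2
    omega
  have h2 : ∑ v ∈ S \ T, key v ≤ ∑ v ∈ T \ S, key v := by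
    rcases (T \ S).eq_empty_or_nonempty with h | h
    · have : S \ T = ∅ := by rw [← Finset.card_eq_zero, h1, h, Finset.card_empty]
      rw [this, h]
    · obtain ⟨w, hw, hmin⟩ := Finset.exists_min_image _ key h
      calc ∑ v ∈ S \ T, key v ≤ (S \ T).card • key w := by
            refine Finset.sum_le_card_nsmul _ _ _ fun v hv => ?_
            rw [Finset.mem_sdiff] at hv hw
            exact le_of_mem_topk_of_notMem hv.1 (hT hw.1) hw.2
        _ = (T \ S).card • key w := by rw [h1]
        _ ≤ _ := Finset.card_nsmul_le_sum _ _ _ hmin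
  have h3 := Finset.sum_inter_add_sum_sdiff S T key
  have h4 := Finset.sum_inter_add_sum_sdiff T S key
  rw [Finset.inter_comm] at h4
  linarith

theorem exists_le_of_mem_topk {G : Finset (Fin m)} (hG : G ⊆ c) (hk : k ≤ G.card) {v : Fin m}
    (hv : v ∈ topk c key σ k) : ∃ w ∈ G, key v ≤ key w := by
  classical
  by_contra! h
  refine absurd (Finset.mem_filter.1 hv).2 (not_lt.2 (hk.trans (Finset.card_le_card fun x hx => ?_)))
  exact Finset.mem_filter.2 ⟨hG hx, Or.inl (h x hx)⟩

theorem mem_topk_of_card_lt {v : Fin m} (hv : v ∈ c)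
    (h : ((c.erase v).filter fun w => key w ≤ key v).card < k) : v ∈ topk c key σ k := by
  classical
  refine Finset.mem_filter.2 ⟨hv, lt_of_le_of_lt (Finset.card_le_card fun x hx => ?_) h⟩
  rw [Finset.mem_filter] at hx
  rw [Finset.mem_filter, Finset.mem_erase]
  refine ⟨⟨?_, hx.1⟩, ?_⟩
  · rintro rfl
    simpa using hx.2
  · rcases hx.2 with h | h
    · exact h.le
    · exact h.1.le

theorem card_lt_of_mem_topk {v : Fin m} {e : ℝ} (hle : ∀ w ∈ c, key w ≤ key' w)
    (hle' : ∀ w ∈ c, key' w ≤ key w + e) (hv : v ∈ topk c key' σ k) :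
    ((c.erase v).filter fun w => key w < key v - e).card < k := by
  classical
  refine lt_of_le_of_lt (Finset.card_le_card fun x hx => ?_) (Finset.mem_filter.1 hv).2
  rw [Finset.mem_filter, Finset.mem_erase] at hx
  have h1 := hle v (topk_subset hv)
  have h2 := hle' x hx.1.2
  exact Finset.mem_filter.2 ⟨hx.1.2, Or.inl (by linarith [hx.2])⟩

theorem exists_threshold (T : Finset (Fin m)) (key : Fin m → ℝ) {k : ℕ} (hk : 0 < k) {x₀ : ℝ}
    (hx₀ : k ≤ (T.filter fun w => key w ≤ x₀).card) :
    ∃ κ : ℝ, ∀ x, k ≤ (T.filter fun w => key w ≤ x).card ↔ κ ≤ x := by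
  classical
  have key1 : ∀ x, k ≤ (T.filter fun w => key w ≤ x).card →
      ∃ w ∈ T, key w ≤ x ∧ k ≤ (T.filter fun w' => key w' ≤ key w).card := fun x hx => by
    have hne : (T.filter fun w => key w ≤ x).Nonempty := Finset.card_pos.1 (hk.trans_le hx)
    obtain ⟨w, hw, hmax⟩ := Finset.exists_max_image _ key hne
    rw [Finset.mem_filter] at hw
    refine ⟨w, hw.1, hw.2, hx.trans (Finset.card_le_card fun y hy => ?_)⟩
    exact Finset.mem_filter.2 ⟨(Finset.mem_filter.1 hy).1, hmax y hy⟩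
  obtain ⟨w, hw, -, hwk⟩ := key1 x₀ hx₀
  obtain ⟨v, hv, hmin⟩ := Finset.exists_min_image
    (T.filter fun w => k ≤ (T.filter fun w' => key w' ≤ key w).card) key
    ⟨w, Finset.mem_filter.2 ⟨hw, hwk⟩⟩
  rw [Finset.mem_filter] at hv
  refine ⟨key v, fun x => ⟨fun hx => ?_, fun hx => ?_⟩⟩
  · obtain ⟨w', hw', hle, hk'⟩ := key1 x hx
    exact (hmin w' (Finset.mem_filter.2 ⟨hw', hk'⟩)).trans hle
  · refine hv.2.trans (Finset.card_le_card fun y hy => ?_)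
    rw [Finset.mem_filter] at hy ⊢
    exact ⟨hy.1, hy.2.trans hx⟩

end TopK

/-! ### Families of sets that are closed under lowering active coordinates -/

section Hypercube

variable {α : Type*} [DecidableEq α]

theorem card_layer_mul_le (A : Finset α) (F B : Finset (Finset α))
    (h : ∀ H ∈ F, ∀ j ∈ H ∩ A, H.erase j ∈ B) (g : ℕ) (hg : g + 1 ≤ A.card) :
    (F.filter fun H => (H ∩ A).card = g + 1).card * (g + 1) ≤
      (B.filter fun H => (H ∩ A).card = g).card * (A.card - g) := by
  classical
  refine Finset.card_mul_le_card_mul (fun H H' => ∃ j ∈ H ∩ A, H' = H.erase j) ?_ ?_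
  · intro H hH
    rw [Finset.mem_filter] at hH
    rw [← hH.2]
    have hsub : (H ∩ A).image (fun j => H.erase j) ⊆
        (B.filter fun H => (H ∩ A).card = g).bipartiteAbove
          (fun H H' => ∃ j ∈ H ∩ A, H' = H.erase j) H := by
      intro H' hH'
      obtain ⟨j, hj, rfl⟩ := Finset.mem_image.1 hH'
      rw [Finset.mem_bipartiteAbove, Finset.mem_filter]
      refine ⟨⟨h H hH.1 j hj, ?_⟩, j, hj, rfl⟩
      rw [Finset.erase_inter, Finset.card_erase_of_mem hj, hH.2, Nat.add_sub_cancel]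
    refine le_trans (le_of_eq ?_) (Finset.card_le_card hsub)
    rw [Finset.card_image_of_injOn]
    intro j hj j' hj' hjj
    have hj1 : j ∈ H := (Finset.mem_inter.1 hj).1
    exact Finset.erase_injOn H hj1 (Finset.mem_inter.1 hj').1 hjj
  · intro H' hH'
    rw [Finset.mem_filter] at hH'
    have hsub : (F.filter fun H => (H ∩ A).card = g + 1).bipartiteBelow
          (fun H H' => ∃ j ∈ H ∩ A, H' = H.erase j) H' ⊆ (A \ H').image (fun j => insert j H') := by
      intro H hH
      rw [Finset.mem_bipartiteBelow] at hH
      obtain ⟨-, j, hj, rfl⟩ := hH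
      rw [Finset.mem_inter] at hj
      refine Finset.mem_image.2 ⟨j, Finset.mem_sdiff.2 ⟨hj.2, Finset.notMem_erase _ _⟩, ?_⟩
      exact Finset.insert_erase hj.1
    refine (Finset.card_le_card hsub).trans (Finset.card_image_le.trans (le_of_eq ?_))
    have := Finset.card_sdiff_add_card_inter A H'
    rw [Finset.inter_comm, hH'.2] at this
    omega

theorem card_sdiff_layers_le (A : Finset α) (F B : Finset (Finset α)) (hBF : B ⊆ F)
    (h : ∀ H ∈ F, ∀ j ∈ H ∩ A, H.erase j ∈ B) {ε : ℝ} {r g₀ : ℕ} (hε : 0 ≤ ε) (hε1 : ε ≤ 1)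
    (hεr : ε * r ≤ 1 / 2)
    (hg₀ : (1 - ε) * ((A.card : ℝ) - g₀) ≤ g₀ + 1) :
    ((r : ℝ) / 2) * (((F \ B).filter fun H => g₀ + r ≤ (H ∩ A).card).card : ℝ) ≤ B.card := by
  classical
  set a := A.card
  set bL : ℕ → ℝ := fun g => ((B.filter fun H => (H ∩ A).card = g).card : ℝ) with hbL
  set wL : ℕ → ℝ := fun g => (((F \ B).filter fun H => (H ∩ A).card = g).card : ℝ) with hwL
  have hw0 : ∀ g, 0 ≤ wL g := fun g => Nat.cast_nonneg _
  have hb0 : ∀ g, 0 ≤ bL g := fun g => Nat.cast_nonneg _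
  have hFg : ∀ g, ((F.filter fun H => (H ∩ A).card = g).card : ℝ) = bL g + wL g := fun g => by
    simp only [hbL, hwL]
    norm_cast
    rw [← Finset.card_union_of_disjoint, ← Finset.filter_union, Finset.union_sdiff_of_subset hBF]
    exact (Finset.disjoint_filter_filter Finset.disjoint_sdiff)
  have hstep : ∀ g, g₀ ≤ g → (1 - ε) * (bL (g + 1) + wL (g + 1)) ≤ bL g := fun g hg => by
    rcases Nat.lt_or_ge a (g + 1) with hga | hga
    · have : (F.filter fun H => (H ∩ A).card = g + 1) = ∅ := by
        refine Finset.filter_eq_empty_iff.2 fun H _ hH => ?_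
        have := Finset.card_le_card (Finset.inter_subset_right : H ∩ A ⊆ A)
        omega
      rw [← hFg, this]
      simpa using hb0 g
    · have h1 := card_layer_mul_le A F B h g hga
      have h2 : ((F.filter fun H => (H ∩ A).card = g + 1).card : ℝ) * (g + 1) ≤
          bL g * ((a : ℝ) - g) := by
        have : ((a - g : ℕ) : ℝ) = (a : ℝ) - g := by
          rw [Nat.cast_sub (by omega)]
        simp only [hbL]
        rw [← this]
        exact_mod_cast h1
      rw [hFg] at h2
      have hpos : (0 : ℝ) < (a : ℝ) - g := by
        have : ((g + 1 : ℕ) : ℝ) ≤ a := by exact_mod_cast hga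
        push_cast at this
        linarith
      have hgr : (g₀ : ℝ) ≤ g := by exact_mod_cast hg
      have h3 : (1 - ε) * ((a : ℝ) - g) ≤ g + 1 := by
        nlinarith
      have h4 : (1 - ε) * (bL (g + 1) + wL (g + 1)) * ((a : ℝ) - g) ≤ bL g * ((a : ℝ) - g) := by
        nlinarith [hb0 (g + 1), hw0 (g + 1)]
      exact le_of_mul_le_mul_right h4 hpos
  have hind : ∀ l h', g₀ ≤ h' → (1 - ε) ^ l * (bL (h' + l) + ∑ i ∈ Finset.range l, wL (h' + 1 + i))
      ≤ bL h' := by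
    intro l
    induction l with
    | zero => intro h' _; simp
    | succ l ih =>
      intro h' hh
      have h1 := ih (h' + 1) (by omega)
      have h2 := hstep h' hh
      rw [Finset.sum_range_succ']
      have e1 : h' + (l + 1) = h' + 1 + l := by ring
      have e2 : ∀ i, h' + 1 + (i + 1) = h' + 1 + 1 + i := fun i => by ring
      rw [e1, add_zero, Finset.sum_congr rfl fun i _ => by rw [e2 i]]
      have h3 : (1 - ε) ^ l ≤ 1 := pow_le_one₀ (by linarith) (by linarith)
      have h4 : (1 - ε) ^ l * wL (h' + 1) ≤ wL (h' + 1) :=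
        mul_le_of_le_one_left (hw0 _) h3
      calc (1 - ε) ^ (l + 1) * (bL (h' + 1 + l) +
            (∑ i ∈ Finset.range l, wL (h' + 1 + 1 + i) + wL (h' + 1)))
          = (1 - ε) * ((1 - ε) ^ l * (bL (h' + 1 + l) + ∑ i ∈ Finset.range l, wL (h' + 1 + 1 + i))
            + (1 - ε) ^ l * wL (h' + 1)) := by ring
        _ ≤ (1 - ε) * (bL (h' + 1) + wL (h' + 1)) :=
            mul_le_mul_of_nonneg_left (add_le_add h1 h4) (by linarith)
        _ ≤ _ := h2
  have hhalf : (1 / 2 : ℝ) ≤ (1 - ε) ^ r := by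
    have := one_add_mul_le_pow (a := -ε) (by linarith) r
    have e : (1 + -ε) = 1 - ε := by ring
    rw [e] at this
    nlinarith
  have hcol : ∀ h', g₀ ≤ h' → (1 / 2) * ∑ i ∈ Finset.range r, wL (h' + 1 + i) ≤ bL h' :=
    fun h' hh => by
      refine le_trans ?_ (hind r h' hh)
      have hs : 0 ≤ ∑ i ∈ Finset.range r, wL (h' + 1 + i) := Finset.sum_nonneg fun i _ => hw0 _
      have : 0 ≤ bL (h' + r) := hb0 _
      have h5 : (1 / 2) * ∑ i ∈ Finset.range r, wL (h' + 1 + i) ≤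
        (1 - ε) ^ r * ∑ i ∈ Finset.range r, wL (h' + 1 + i) := mul_le_mul_of_nonneg_right hhalf hs
      nlinarith
  have hsumW : (((F \ B).filter fun H => g₀ + r ≤ (H ∩ A).card).card : ℝ) =
      ∑ g ∈ Finset.Ico (g₀ + r) (a + 1), wL g := by
    rw [Finset.card_eq_sum_card_fiberwise (f := fun H => (H ∩ A).card)
      (t := Finset.Ico (g₀ + r) (a + 1))]
    · push_cast
      refine Finset.sum_congr rfl fun g hg => ?_
      rw [hwL, Finset.filter_filter]
      congr 2
      refine Finset.filter_congr fun H _ => ?_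
      rw [Finset.mem_Ico] at hg
      constructor
      · exact fun h => h.2
      · exact fun h => ⟨by omega, h⟩
    · intro H hH
      have h1 := (Finset.mem_filter.1 hH).2
      have := Finset.card_le_card (Finset.inter_subset_right : H ∩ A ⊆ A)
      simp only [Finset.coe_Ico, Set.mem_Ico]
      omega
  have hsumB : ∑ g ∈ Finset.Ico g₀ (a + 1), bL g ≤ B.card := by
    simp only [hbL]
    norm_cast
    rw [← Finset.card_biUnion]
    · refine Finset.card_le_card fun H hH => ?_
      rw [Finset.mem_biUnion] at hH
      obtain ⟨g, -, hg⟩ := hH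
      exact (Finset.mem_filter.1 hg).1
    · intro g _ g' _ hne
      refine Finset.disjoint_filter.2 fun H _ h1 h2 => hne (h1.symm.trans h2)
  rw [hsumW]
  refine le_trans ?_ hsumB
  calc (r : ℝ) / 2 * ∑ g ∈ Finset.Ico (g₀ + r) (a + 1), wL g
      = ∑ i ∈ Finset.range r, (1 / 2) * ∑ g ∈ Finset.Ico (g₀ + r) (a + 1), wL g := by
        rw [Finset.sum_const, Finset.card_range, nsmul_eq_mul]; ring
    _ ≤ ∑ i ∈ Finset.range r, (1 / 2) * ∑ h' ∈ Finset.Ico g₀ (a + 1), wL (h' + 1 + i) := by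
        refine Finset.sum_le_sum fun i hi => mul_le_mul_of_nonneg_left ?_ (by norm_num)
        have e1 : ∑ h' ∈ Finset.Ico g₀ (a + 1), wL (h' + 1 + i) =
            ∑ g ∈ Finset.Ico (g₀ + (1 + i)) (a + 1 + (1 + i)), wL g := by
          rw [← Finset.sum_Ico_add' wL g₀ (a + 1) (1 + i)]
          exact Finset.sum_congr rfl fun x _ => by rw [add_assoc]
        rw [e1]
        rw [Finset.mem_range] at hi
        exact Finset.sum_le_sum_of_subset_of_nonneg
          (Finset.Ico_subset_Ico (by omega) (by omega)) fun g _ _ => hw0 g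
    _ = ∑ h' ∈ Finset.Ico g₀ (a + 1), (1 / 2) * ∑ i ∈ Finset.range r, wL (h' + 1 + i) := by
        simp only [Finset.mul_sum]
        exact Finset.sum_comm
    _ ≤ _ := Finset.sum_le_sum fun h' hh => hcol h' (Finset.mem_Ico.1 hh).1

theorem card_low_layers_le [Fintype α] (A : Finset α) (hA : 0 < A.card) {z : ℝ} (hz : 0 ≤ z) :
    ((Finset.univ.filter fun H : Finset α => ((H ∩ A).card : ℝ) ≤ A.card / 2 - z).card : ℝ) ≤
      2 ^ Fintype.card α * Real.exp (-(2 * z ^ 2 / A.card)) := by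
  classical
  set a : ℝ := (A.card : ℝ) with ha
  have ha0 : 0 < a := by rw [ha]; exact_mod_cast hA
  set lam : ℝ := 4 * z / a with hlam
  have hl0 : 0 ≤ lam := by positivity
  have hprod := Finset.prod_add (fun j => if j ∈ A then Real.exp (-(lam / 2)) else 1)
    (fun j => if j ∈ A then Real.exp (lam / 2) else (1 : ℝ)) (Finset.univ : Finset α)
  have hterm : ∀ H : Finset α, (∏ j ∈ H, if j ∈ A then Real.exp (-(lam / 2)) else (1 : ℝ)) *
      (∏ j ∈ Finset.univ \ H, if j ∈ A then Real.exp (lam / 2) else (1 : ℝ)) =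
      Real.exp (lam * (a / 2 - (H ∩ A).card)) := fun H => by
    rw [← Finset.prod_filter, ← Finset.prod_filter, Finset.prod_const, Finset.prod_const,
      ← Real.exp_nat_mul, ← Real.exp_nat_mul, ← Real.exp_add]
    congr 1
    have e1 : H.filter (· ∈ A) = H ∩ A := by ext; simp
    have e2 : (Finset.univ \ H).filter (· ∈ A) = A \ H := by ext; simp [and_comm]
    have e3 : ((A \ H).card : ℝ) + (H ∩ A).card = a := by
      rw [ha, Finset.inter_comm]; exact_mod_cast Finset.card_sdiff_add_card_inter A H
    rw [e1, e2, ← e3]; ring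
  rw [Finset.powerset_univ] at hprod
  have hbound : ∏ j : α, ((if j ∈ A then Real.exp (-(lam / 2)) else 1) +
      (if j ∈ A then Real.exp (lam / 2) else (1 : ℝ))) ≤
      2 ^ Fintype.card α * Real.exp (a * (lam ^ 2 / 8)) := by
    calc ∏ j : α, ((if j ∈ A then Real.exp (-(lam / 2)) else 1) +
          (if j ∈ A then Real.exp (lam / 2) else (1 : ℝ)))
        ≤ ∏ j : α, (2 * if j ∈ A then Real.exp (lam ^ 2 / 8) else 1) := by
          refine Finset.prod_le_prod (fun j _ => by split_ifs <;> positivity) fun j _ => ?_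
          split_ifs
          · have := Real.cosh_le_exp_half_sq (lam / 2)
            rw [Real.cosh_eq] at this
            have e : (lam / 2) ^ 2 / 2 = lam ^ 2 / 8 := by ring
            rw [e] at this
            linarith
          · norm_num
      _ = _ := by
          rw [Finset.prod_mul_distrib, Finset.prod_const, Finset.card_univ, ← Finset.prod_filter,
            Finset.prod_const, ← Real.exp_nat_mul]
          simp [ha]
  have hsum : ((Finset.univ.filter fun H : Finset α => ((H ∩ A).card : ℝ) ≤ a / 2 - z).card : ℝ) *
      Real.exp (lam * z) ≤ ∑ H : Finset α, Real.exp (lam * (a / 2 - (H ∩ A).card)) := by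
    rw [← nsmul_eq_mul]
    refine (Finset.card_nsmul_le_sum _ (fun H => Real.exp (lam * (a / 2 - (H ∩ A).card))) _ ?_).trans
      (Finset.sum_le_sum_of_subset_of_nonneg (Finset.filter_subset _ _) fun _ _ _ =>
        (Real.exp_pos _).le)
    intro H hH
    rw [Finset.mem_filter] at hH
    exact Real.exp_le_exp.2 (mul_le_mul_of_nonneg_left (by linarith [hH.2]) hl0)
  rw [← Finset.sum_congr rfl fun H _ => hterm H, ← hprod] at hsum
  have h3 := hsum.trans hbound
  have e : Real.exp (-(2 * z ^ 2 / a)) = Real.exp (a * (lam ^ 2 / 8)) * (Real.exp (lam * z))⁻¹ := by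
    rw [← Real.exp_neg, ← Real.exp_add]
    congr 1
    rw [hlam]; field_simp; ring
  rw [e, ← mul_assoc, ← div_eq_mul_inv, le_div_iff₀ (Real.exp_pos _)]
  exact h3

end Hypercube

/-! ### Sums of squared deviations and anticoncentration on a discrete cube -/

section Deviation

variable {α : Type*}

/-- The mean of `z` over `O`. -/
noncomputable def avg (O : Finset α) (z : α → ℝ) : ℝ := (∑ j ∈ O, z j) / (O.card : ℝ)

/-- The sum of the squared deviations from the mean of `z` over `O`. -/
noncomputable def ssd (O : Finset α) (z : α → ℝ) : ℝ := ∑ j ∈ O, (z j - avg O z) ^ 2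

theorem ssd_nonneg (O : Finset α) (z : α → ℝ) : 0 ≤ ssd O z :=
  Finset.sum_nonneg fun _ _ => sq_nonneg _

theorem card_mul_avg {O : Finset α} (hO : O.Nonempty) (z : α → ℝ) :
    (O.card : ℝ) * avg O z = ∑ j ∈ O, z j := by
  have : (O.card : ℝ) ≠ 0 := by exact_mod_cast hO.card_pos.ne'
  rw [avg, mul_div_cancel₀ _ this]

theorem ssd_eq (O : Finset α) (z : α → ℝ) (c : ℝ) :
    ssd O z = ∑ j ∈ O, (z j - c) ^ 2 - (O.card : ℝ) * (avg O z - c) ^ 2 := by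
  rcases O.eq_empty_or_nonempty with rfl | hO
  · simp [ssd]
  have h := card_mul_avg hO z
  have e : ∀ j, (z j - avg O z) ^ 2 =
      (z j - c) ^ 2 - 2 * (avg O z - c) * z j + 2 * (avg O z - c) * c + (avg O z - c) ^ 2 :=
    fun j => by ring
  simp only [ssd, e, Finset.sum_add_distrib, Finset.sum_sub_distrib, ← Finset.mul_sum,
    Finset.sum_const, nsmul_eq_mul]
  rw [← h]; ring

theorem ssd_le (O : Finset α) (z : α → ℝ) (c : ℝ) : ssd O z ≤ ∑ j ∈ O, (z j - c) ^ 2 := by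
  rw [ssd_eq O z c]
  have := mul_nonneg (Nat.cast_nonneg (α := ℝ) O.card) (sq_nonneg (avg O z - c))
  linarith

theorem avg_sub_avg_le {O A : Finset α} {z z' : α → ℝ} {K d : ℝ} (hO : O.Nonempty) (hA : A ⊆ O)
    (hd : (A.card : ℝ) * K ≤ d * O.card) (h : ∀ j ∈ O, j ∉ A → z j = z' j)
    (hK : ∀ j ∈ A, |z j - z' j| ≤ K) : |avg O z - avg O z'| ≤ d := by
  classical
  have hpos : (0 : ℝ) < O.card := by exact_mod_cast hO.card_pos
  rw [avg, avg, ← sub_div, ← Finset.sum_sub_distrib, abs_div, abs_of_pos hpos, div_le_iff₀ hpos]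
  refine le_trans ?_ hd
  rw [← Finset.sum_subset hA fun j hj hjA => by rw [h j hj hjA, sub_self]]
  refine (Finset.abs_sum_le_sum_abs _ _).trans ?_
  rw [← nsmul_eq_mul]
  exact Finset.sum_le_card_nsmul _ _ _ hK

variable [Fintype α] [DecidableEq α]

theorem card_window_le {O A : Finset α} (hO : O.Nonempty) (hA : A ⊆ O) {hi lo : α → ℝ}
    {μ K δ d : ℝ} (hK0 : 0 ≤ K) (hgap : ∀ j ∈ A, (lo j - μ) ^ 2 + 2 * δ ≤ (hi j - μ) ^ 2)
    (hK : ∀ j ∈ A, |hi j - lo j| ≤ K) (hd : (A.card : ℝ) * K ≤ d * O.card)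
    (hdK : 6 * d * K ≤ δ) (hδ : 0 ≤ δ) {ε : ℝ} {r g₀ : ℕ} (hε : 0 ≤ ε) (hε1 : ε ≤ 1)
    (hr : 2 ≤ r) (hεr : ε * r ≤ 1 / 2)
    (hg₀ : (1 - ε) * ((A.card : ℝ) - g₀) ≤ g₀ + 1) (τ : ℝ) (L : ℕ) :
    ((Finset.univ.filter fun H : Finset α =>
        |avg O (fun j => if j ∈ H then hi j else lo j) - μ| ≤ d ∧
        τ ≤ ssd O (fun j => if j ∈ H then hi j else lo j) ∧
        ssd O (fun j => if j ∈ H then hi j else lo j) < τ + L * δ).card : ℝ) ≤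
      2 ^ L * (2 / r) * ((Finset.univ.filter fun H : Finset α =>
        ssd O (fun j => if j ∈ H then hi j else lo j) < τ).card : ℝ) +
      L * 2 ^ L * ((Finset.univ.filter fun H : Finset α => (H ∩ A).card < g₀ + r).card : ℝ) := by
  classical
  set z : Finset α → α → ℝ := fun H j => if j ∈ H then hi j else lo j with hz
  set T : ℝ := ((Finset.univ.filter fun H : Finset α => (H ∩ A).card < g₀ + r).card : ℝ) with hT
  set F : ℕ → Finset (Finset α) := fun l => Finset.univ.filter fun H : Finset α =>
    |avg O (z (H \ A)) - μ| ≤ 2 * d ∧ ssd O (z H) < τ + l * δ with hF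
  have hr0 : (0 : ℝ) < r := by exact_mod_cast (by omega : 0 < r)
  have hclose : ∀ H, |avg O (z H) - avg O (z (H \ A))| ≤ d := fun H => by
    refine avg_sub_avg_le hO hA hd (fun j _ hjA => ?_) fun j hj => ?_
    · simp [hz, hjA]
    · by_cases hjH : j ∈ H
      · simpa [hz, hjH, hj] using hK j hj
      · simpa [hz, hjH, hj] using hK0
  have hmono : ∀ l, F l ⊆ F (l + 1) := fun l H hH => by
    rw [hF, Finset.mem_filter] at hH ⊢
    refine ⟨hH.1, hH.2.1, hH.2.2.trans_le ?_⟩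
    push_cast
    linarith
  have hlower : ∀ l, ∀ H ∈ F (l + 1), ∀ j ∈ H ∩ A, H.erase j ∈ F l := fun l H hH j hj => by
    rw [Finset.mem_inter] at hj
    rw [hF, Finset.mem_filter] at hH ⊢
    have e1 : H.erase j \ A = H \ A := by
      ext x
      simp only [Finset.mem_sdiff, Finset.mem_erase]
      exact ⟨fun h => ⟨h.1.2, h.2⟩, fun h => ⟨⟨fun hx => h.2 (hx ▸ hj.2), h.1⟩, h.2⟩⟩
    refine ⟨Finset.mem_univ _, by rw [e1]; exact hH.2.1, ?_⟩
    set c := avg O (z H) with hc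
    have hcμ : |c - μ| ≤ 3 * d := by
      have h1 := hclose H
      have h2 := hH.2.1
      rw [abs_le] at *
      constructor <;> linarith [h1.1, h1.2, h2.1, h2.2]
    have hsum : ∑ x ∈ O, (z (H.erase j) x - c) ^ 2 =
        ssd O (z H) - (hi j - c) ^ 2 + (lo j - c) ^ 2 := by
      rw [ssd, ← hc, ← Finset.add_sum_erase O _ (hA hj.2),
        ← Finset.add_sum_erase O (fun x => (z H x - c) ^ 2) (hA hj.2)]
      have e2 : ∑ x ∈ O.erase j, (z (H.erase j) x - c) ^ 2 = ∑ x ∈ O.erase j, (z H x - c) ^ 2 := by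
        refine Finset.sum_congr rfl fun x hx => ?_
        have : x ≠ j := Finset.ne_of_mem_erase hx
        simp [hz, this]
      rw [e2]
      simp only [hz, hj.1, Finset.notMem_erase, if_true, if_false]
      ring
    have h3 := ssd_le O (z (H.erase j)) c
    rw [hsum] at h3
    have h4 : (lo j - c) ^ 2 + δ ≤ (hi j - c) ^ 2 := by
      have e3 : (hi j - c) ^ 2 - (lo j - c) ^ 2 =
        (hi j - μ) ^ 2 - (lo j - μ) ^ 2 - 2 * ((c - μ) * (hi j - lo j)) := by ring
      have h5 : (c - μ) * (hi j - lo j) ≤ 3 * d * K := by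
        refine (le_abs_self _).trans ?_
        rw [abs_mul]
        exact mul_le_mul hcμ (hK j hj.2) (abs_nonneg _) ((abs_nonneg _).trans hcμ)
      have := hgap j hj.2
      linarith
    have h6 := hH.2.2
    push_cast at h6
    linarith
  have hrec : ∀ l, ((F (l + 1)).card : ℝ) ≤ (1 + 2 / r) * (F l).card + T := fun l => by
    have h1 := card_sdiff_layers_le A (F (l + 1)) (F l) (hmono l) (hlower l) hε hε1 hεr hg₀
    have h2 : ((F (l + 1)).card : ℝ) = (F l).card + ((F (l + 1) \ F l).card : ℝ) := by
      have := Finset.card_sdiff_add_card_eq_card (hmono l)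
      rw [← this]; push_cast; ring
    have h3 : ((F (l + 1) \ F l).card : ℝ) ≤
        (((F (l + 1) \ F l).filter fun H => g₀ + r ≤ (H ∩ A).card).card : ℝ) + T := by
      rw [hT]
      norm_cast
      rw [← Finset.card_filter_add_card_filter_not (s := F (l + 1) \ F l)
        (fun H => g₀ + r ≤ (H ∩ A).card)]
      refine Nat.add_le_add_left (Finset.card_le_card fun H hH => ?_) _
      rw [Finset.mem_filter] at hH ⊢
      exact ⟨Finset.mem_univ _, not_le.1 hH.2⟩
    have h4 : (((F (l + 1) \ F l).filter fun H => g₀ + r ≤ (H ∩ A).card).card : ℝ) ≤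
        2 / r * (F l).card := by
      rw [div_mul_eq_mul_div, le_div_iff₀ hr0]
      linarith
    rw [h2]
    linarith
  have hT0 : 0 ≤ T := Nat.cast_nonneg _
  have hq1 : (2 : ℝ) / r ≤ 1 := by
    rw [div_le_one hr0]; exact_mod_cast hr
  have hq0 : (0 : ℝ) ≤ 2 / r := by positivity
  have hind : ∀ l : ℕ, ((F l).card : ℝ) ≤
      (1 + (2 ^ l - 1) * (2 / r)) * (F 0).card + l * 2 ^ l * T := fun l => by
    induction l with
    | zero => simp
    | succ l ih =>
      have h0 : (0 : ℝ) ≤ (F 0).card := Nat.cast_nonneg _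
      have h2l : (1 : ℝ) ≤ 2 ^ l := one_le_pow₀ (by norm_num)
      have hb : (1 + 2 / (r : ℝ)) * (1 + (2 ^ l - 1) * (2 / r)) ≤ 1 + (2 ^ (l + 1) - 1) * (2 / r) := by
        have : (2 / (r : ℝ)) * ((2 ^ l - 1) * (2 / r)) ≤ (2 ^ l - 1) * (2 / r) :=
          mul_le_of_le_one_left (mul_nonneg (by linarith) hq0) hq1
        rw [pow_succ]
        nlinarith
      have hc : (1 + 2 / (r : ℝ)) * (l * 2 ^ l * T) + T ≤ ((l + 1 : ℕ) : ℝ) * 2 ^ (l + 1) * T := by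
        have h5 : (1 + 2 / (r : ℝ)) * (l * 2 ^ l * T) ≤ 2 * (l * 2 ^ l * T) :=
          mul_le_mul_of_nonneg_right (by linarith) (by positivity)
        have h6 : T ≤ 2 * 2 ^ l * T := le_mul_of_one_le_left hT0 (by linarith)
        push_cast
        rw [pow_succ]
        nlinarith
      calc ((F (l + 1)).card : ℝ) ≤ (1 + 2 / r) * (F l).card + T := hrec l
        _ ≤ (1 + 2 / r) * ((1 + (2 ^ l - 1) * (2 / r)) * (F 0).card + l * 2 ^ l * T) + T := by
            gcongr
        _ = (1 + 2 / (r : ℝ)) * (1 + (2 ^ l - 1) * (2 / r)) * (F 0).card +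
            ((1 + 2 / (r : ℝ)) * (l * 2 ^ l * T) + T) := by ring
        _ ≤ _ := by
            refine add_le_add (mul_le_mul_of_nonneg_right hb h0) hc
  have hwin : ((Finset.univ.filter fun H : Finset α => |avg O (z H) - μ| ≤ d ∧
      τ ≤ ssd O (z H) ∧ ssd O (z H) < τ + L * δ).card : ℝ) + (F 0).card ≤ (F L).card := by
    norm_cast
    rw [← Finset.card_union_of_disjoint]
    · refine Finset.card_le_card fun H hH => ?_
      rw [Finset.mem_union] at hH
      rcases hH with hH | hH
      · rw [Finset.mem_filter] at hH
        rw [hF, Finset.mem_filter]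
        refine ⟨Finset.mem_univ _, ?_, hH.2.2.2⟩
        have h1 := hclose H
        have h2 := hH.2.1
        rw [abs_le] at *
        constructor <;> linarith [h1.1, h1.2, h2.1, h2.2]
      · rw [hF, Finset.mem_filter] at hH ⊢
        refine ⟨hH.1, hH.2.1, hH.2.2.trans_le ?_⟩
        have : 0 ≤ (L : ℝ) * δ := by positivity
        simpa using this
    · rw [hF]
      refine Finset.disjoint_filter.2 fun H _ h1 h2 => ?_
      have := h2.2
      simp only [Nat.cast_zero, zero_mul, add_zero] at this
      exact absurd this (not_lt.2 h1.2.1)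
  have hF0 : ((F 0).card : ℝ) ≤
      ((Finset.univ.filter fun H : Finset α => ssd O (z H) < τ).card : ℝ) := by
    norm_cast
    refine Finset.card_le_card fun H hH => ?_
    rw [hF, Finset.mem_filter] at hH
    rw [Finset.mem_filter]
    simpa using hH.2.2
  have hfin := hind L
  have h7 : (0 : ℝ) ≤ (F 0).card := Nat.cast_nonneg _
  have h8 : (2 ^ L - 1) * (2 / (r : ℝ)) * (F 0).card ≤ 2 ^ L * (2 / r) *
      ((Finset.univ.filter fun H : Finset α => ssd O (z H) < τ).card : ℝ) := by
    have h2l : (1 : ℝ) ≤ 2 ^ L := one_le_pow₀ (by norm_num)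
    refine mul_le_mul ?_ hF0 h7 (by positivity)
    exact mul_le_mul_of_nonneg_right (by linarith) hq0
  linarith

/-- Anticoncentration relative to the lower tail: among the vectors with entries `p j` or `q j`,
those whose sum of squared deviations lies in a window are few compared with those below the
window. -/
theorem card_swap_window_le {O A : Finset α} (hA : A ⊆ O) (hA0 : A.Nonempty) {p q : α → ℝ}
    {μ K δ d : ℝ} (hgap : ∀ j ∈ A, 2 * δ ≤ |(p j - μ) ^ 2 - (q j - μ) ^ 2|)
    (hK : ∀ j ∈ A, |p j - q j| ≤ K) (hd : (A.card : ℝ) * K ≤ d * O.card)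
    (hdK : 6 * d * K ≤ δ) (hδ : 0 ≤ δ) {ε : ℝ} {r : ℕ} (hε : 0 ≤ ε) (hε1 : ε ≤ 1)
    (hr : 2 ≤ r) (hεr : ε * r ≤ 1 / 2) (hra : (r : ℝ) ≤ A.card * ε / 8) (τ : ℝ) (L : ℕ) :
    ((Finset.univ.filter fun b : Finset α =>
        |avg O (fun j => if j ∈ b then q j else p j) - μ| ≤ d ∧
        τ ≤ ssd O (fun j => if j ∈ b then q j else p j) ∧
        ssd O (fun j => if j ∈ b then q j else p j) < τ + L * δ).card : ℝ) ≤
      2 ^ L * (2 / r) * ((Finset.univ.filter fun b : Finset α =>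
        ssd O (fun j => if j ∈ b then q j else p j) < τ).card : ℝ) +
      L * 2 ^ L * (2 ^ Fintype.card α * Real.exp (-(A.card * ε ^ 2 / 32))) := by
  classical
  have hO : O.Nonempty := hA0.mono hA
  have ha : 0 < A.card := hA0.card_pos
  have haR : (0 : ℝ) < A.card := by exact_mod_cast ha
  have hK0 : 0 ≤ K := by
    obtain ⟨j, hj⟩ := hA0
    exact (abs_nonneg _).trans (hK j hj)
  set E : Finset α := Finset.univ.filter fun j => (q j - μ) ^ 2 ≤ (p j - μ) ^ 2 with hE
  set hi : α → ℝ := fun j => if j ∈ E then p j else q j with hhi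
  set lo : α → ℝ := fun j => if j ∈ E then q j else p j with hlo
  set g₀ : ℕ := ⌈(A.card : ℝ) / 2 * (1 - ε / 2)⌉₊ with hg
  have hg1 : (A.card : ℝ) / 2 * (1 - ε / 2) ≤ g₀ := Nat.le_ceil _
  have hg2 : (g₀ : ℝ) < (A.card : ℝ) / 2 * (1 - ε / 2) + 1 :=
    Nat.ceil_lt_add_one (mul_nonneg (by positivity) (by linarith))
  have hcard : ∀ (P : (α → ℝ) → Prop)
      [DecidablePred fun b : Finset α => P (fun j => if j ∈ b then q j else p j)]
      [DecidablePred fun H : Finset α => P (fun j => if j ∈ H then hi j else lo j)],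
      (Finset.univ.filter fun b : Finset α => P (fun j => if j ∈ b then q j else p j)).card =
      (Finset.univ.filter fun H : Finset α => P (fun j => if j ∈ H then hi j else lo j)).card := by
    intro P _ _
    refine Finset.card_bij' (fun b _ => symmDiff b E) (fun H _ => symmDiff H E) ?_ ?_
      (fun b _ => symmDiff_symmDiff_cancel_right _ _) (fun b _ => symmDiff_symmDiff_cancel_right _ _)
    · intro b hb
      rw [Finset.mem_filter] at hb ⊢
      refine ⟨Finset.mem_univ _, ?_⟩
      convert hb.2 using 2 with j
      by_cases h1 : j ∈ b <;> by_cases h2 : j ∈ E <;>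
        simp [Finset.mem_symmDiff, h1, h2, hhi, hlo]
    · intro H hH
      rw [Finset.mem_filter] at hH ⊢
      refine ⟨Finset.mem_univ _, ?_⟩
      convert hH.2 using 2 with j
      by_cases h1 : j ∈ H <;> by_cases h2 : j ∈ E <;>
        simp [Finset.mem_symmDiff, h1, h2, hhi, hlo]
  have hmain := card_window_le hO hA (hi := hi) (lo := lo) (μ := μ) (δ := δ) hK0
    (fun j hj => ?_) (fun j hj => ?_) hd hdK hδ hε hε1 hr hεr (g₀ := g₀) ?_ τ L
  · rw [hcard fun z => |avg O z - μ| ≤ d ∧ τ ≤ ssd O z ∧ ssd O z < τ + L * δ,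
      hcard fun z => ssd O z < τ]
    refine hmain.trans (add_le_add_right (mul_le_mul_of_nonneg_left ?_ (by positivity)) _)
    have h1 := card_low_layers_le A ha (z := A.card * ε / 8) (by positivity)
    have e1 : 2 * ((A.card : ℝ) * ε / 8) ^ 2 / A.card = A.card * ε ^ 2 / 32 := by
      field_simp; ring
    rw [e1] at h1
    refine le_trans ?_ h1
    norm_cast
    refine Finset.card_le_card fun H hH => ?_
    rw [Finset.mem_filter] at hH ⊢
    refine ⟨Finset.mem_univ _, ?_⟩
    have h2 : ((H ∩ A).card : ℝ) + 1 ≤ g₀ + r := by exact_mod_cast hH.2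
    linarith
  · have := hgap j hj
    by_cases h2 : (q j - μ) ^ 2 ≤ (p j - μ) ^ 2
    · simp only [hhi, hlo, hE, Finset.mem_filter, Finset.mem_univ, true_and, h2, if_true]
      rw [abs_of_nonneg (by linarith)] at this
      linarith
    · simp only [hhi, hlo, hE, Finset.mem_filter, Finset.mem_univ, true_and, h2, if_false]
      rw [abs_of_nonpos (by linarith)] at this
      linarith
  · by_cases h2 : j ∈ E
    · simpa only [hhi, hlo, h2, if_true] using hK j hj
    · simp only [hhi, hlo, h2, if_false]
      rw [abs_sub_comm]
      exact hK j hj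
  · nlinarith [mul_nonneg haR.le (sq_nonneg ε)]

end Deviation

/-! ### Product measures: resampling and concentration -/

section ProductMeasure

/-- Mixing two independent samples coordinatewise. -/
theorem measurePreserving_pi_prod {ι : Type*} [Fintype ι] {α : Type v} [MeasurableSpace α]
    (μ : ι → Measure α) [∀ i, IsProbabilityMeasure (μ i)] {f : ι → α × α → α}
    (hf : ∀ i, MeasurePreserving (f i) ((μ i).prod (μ i)) (μ i)) :
    MeasurePreserving (fun c : (ι → α) × (ι → α) => fun i => f i (c.1 i, c.2 i))
      ((Measure.pi μ).prod (Measure.pi μ)) (Measure.pi μ) := by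
  have h1 := (measurePreserving_arrowProdEquivProdArrow α α ι μ μ).symm
  exact (measurePreserving_pi (fun i => (μ i).prod (μ i)) μ hf).comp h1

theorem measurePreserving_update {ι : Type*} [Fintype ι] [DecidableEq ι] {α : ι → Type*}
    [∀ i, MeasurableSpace (α i)] (μ : ∀ i, Measure (α i)) [∀ i, IsProbabilityMeasure (μ i)]
    (i : ι) : MeasurePreserving (fun c : (∀ i, α i) × α i => Function.update c.1 i c.2)
      ((Measure.pi μ).prod (μ i)) (Measure.pi μ) := by
  have hm : Measurable (fun c : (∀ i, α i) × α i => Function.update c.1 i c.2) := by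
    refine measurable_pi_iff.2 fun j => ?_
    by_cases h : j = i
    · subst h
      simpa using measurable_snd
    · simp only [Function.update_of_ne h]
      exact (measurable_pi_apply j).comp measurable_fst
  refine ⟨hm, (Measure.pi_eq fun s hs => ?_).symm⟩
  rw [Measure.map_apply hm (MeasurableSet.univ_pi hs)]
  have : (fun c : (∀ i, α i) × α i => Function.update c.1 i c.2) ⁻¹' Set.univ.pi s =
      (Set.univ.pi (Function.update s i Set.univ)) ×ˢ s i := by
    ext ⟨c, x⟩
    simp only [Set.mem_preimage, Set.mem_univ_pi, Set.mem_prod]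
    constructor
    · intro h
      refine ⟨fun j => ?_, by simpa using h i⟩
      by_cases hj : j = i
      · subst hj; simp
      · simpa [Function.update_of_ne hj] using h j
    · rintro ⟨h, hx⟩ j
      by_cases hj : j = i
      · subst hj; simpa using hx
      · simpa [Function.update_of_ne hj] using h j
  rw [this, Measure.prod_prod, Measure.pi_pi, ← Finset.mul_prod_erase _ _ (Finset.mem_univ i),
    ← Finset.mul_prod_erase _ (fun j => μ j (s j)) (Finset.mem_univ i)]
  simp only [Function.update_self, measure_univ, one_mul]
  rw [mul_comm]
  congr 1
  exact Finset.prod_congr rfl fun j hj => by rw [Function.update_of_ne (Finset.ne_of_mem_erase hj)]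

variable {ι : Type*} [Fintype ι] {α : ι → Type*} [∀ i, MeasurableSpace (α i)]
  (μ : ∀ i, Measure (α i)) [∀ i, IsProbabilityMeasure (μ i)]

theorem integral_comp_eval {i : ι} {g : α i → ℝ} (hg : Measurable g) :
    ∫ c, g (c i) ∂(Measure.pi μ) = ∫ x, g x ∂(μ i) := by
  rw [← (measurePreserving_eval μ i).map_eq, integral_map (measurable_pi_apply i).aemeasurable
    hg.aestronglyMeasurable]

theorem measure_sum_ge_le {Y : ∀ i, α i → ℝ} (hm : ∀ i, Measurable (Y i)) {K : ℝ} (hK : 0 < K)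
    (hb : ∀ i x, |Y i x| ≤ K) (h0 : ∀ i, ∫ x, Y i x ∂(μ i) = 0) {s : Finset ι} (hs : s.Nonempty)
    {t : ℝ} (ht : 0 ≤ t) :
    Measure.pi μ {c | t * s.card ≤ ∑ i ∈ s, Y i (c i)} ≤
      ENNReal.ofReal (Real.exp (-(t ^ 2 * s.card / (2 * K ^ 2)))) := by
  have hind : iIndepFun (fun i (c : ∀ i, α i) => Y i (c i)) (Measure.pi μ) :=
    iIndepFun_pi fun i => (hm i).aemeasurable
  have hsub : ∀ i ∈ s, HasSubgaussianMGF (fun c : ∀ i, α i => Y i (c i)) ((‖K - -K‖₊ / 2) ^ 2)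
      (Measure.pi μ) := fun i _ => by
    refine hasSubgaussianMGF_of_mem_Icc_of_integral_eq_zero
      ((hm i).comp (measurable_pi_apply i)).aemeasurable
      (Filter.Eventually.of_forall fun c => abs_le.1 (hb i (c i))) ?_
    rw [integral_comp_eval μ (hm i), h0 i]
  have h := HasSubgaussianMGF.measure_sum_ge_le_of_iIndepFun hind hsub
    (ε := t * s.card) (by positivity)
  rw [← ENNReal.ofReal_toReal (measure_ne_top (Measure.pi μ) {c | t * s.card ≤ ∑ i ∈ s, Y i (c i)})]
  refine ENNReal.ofReal_le_ofReal (h.trans (le_of_eq ?_))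
  have hc : (0 : ℝ) < s.card := by exact_mod_cast hs.card_pos
  have e : ((∑ i ∈ s, (‖K - -K‖₊ / 2) ^ 2 : NNReal) : ℝ) = s.card * K ^ 2 := by
    have : |K - -K| = 2 * K := by rw [abs_of_pos] <;> linarith
    push_cast
    rw [Real.norm_eq_abs, this]
    simp
  rw [e]
  congr 1
  field_simp

theorem measure_abs_sum_ge_le {Y : ∀ i, α i → ℝ} (hm : ∀ i, Measurable (Y i)) {K : ℝ} (hK : 0 < K)
    (hb : ∀ i x, |Y i x| ≤ K) (h0 : ∀ i, ∫ x, Y i x ∂(μ i) = 0) {s : Finset ι} (hs : s.Nonempty)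
    {t : ℝ} (ht : 0 ≤ t) :
    Measure.pi μ {c | t * s.card ≤ |∑ i ∈ s, Y i (c i)|} ≤
      ENNReal.ofReal (2 * Real.exp (-(t ^ 2 * s.card / (2 * K ^ 2)))) := by
  have h1 := measure_sum_ge_le μ hm hK hb h0 hs ht
  have h2 := measure_sum_ge_le μ (Y := fun i x => -Y i x) (fun i => (hm i).neg) hK
    (fun i x => by rw [abs_neg]; exact hb i x) (fun i => by rw [integral_neg, h0 i, neg_zero]) hs ht
  have hsub : {c : ∀ i, α i | t * s.card ≤ |∑ i ∈ s, Y i (c i)|} ⊆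
      {c | t * s.card ≤ ∑ i ∈ s, Y i (c i)} ∪ {c | t * s.card ≤ ∑ i ∈ s, -Y i (c i)} := by
    intro c hc
    rw [Set.mem_ofPred_eq, le_abs] at hc
    rcases hc with hc | hc
    · exact Or.inl hc
    · refine Or.inr ?_
      rw [Set.mem_ofPred_eq, Finset.sum_neg_distrib]
      exact hc
  refine (measure_mono hsub).trans ((measure_union_le _ _).trans ((add_le_add h1 h2).trans ?_))
  rw [← ENNReal.ofReal_add (Real.exp_pos _).le (Real.exp_pos _).le, ← two_mul]

theorem iIndepFun_indicator {E : ∀ i, Set (α i)} (hE : ∀ i, MeasurableSet (E i)) :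
    iIndepFun (fun i (c : ∀ i, α i) => (E i).indicator (1 : α i → ℝ) (c i)) (Measure.pi μ) :=
  iIndepFun_pi fun i => (measurable_one.indicator (hE i)).aemeasurable

theorem integral_sq_sum {g : ∀ i, α i → ℝ} (hg : ∀ i, Measurable (g i)) {K γ : ℝ}
    (hb : ∀ i x, |g i x| ≤ K) (h0 : ∀ i, ∫ x, g i x ∂(μ i) = 0)
    (h2 : ∀ i, ∫ x, g i x ^ 2 ∂(μ i) = γ ^ 2) (T : Finset ι) :
    Integrable (fun c : ∀ i, α i => (∑ i ∈ T, g i (c i)) ^ 2) (Measure.pi μ) ∧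
    ∫ c, (∑ i ∈ T, g i (c i)) ^ 2 ∂(Measure.pi μ) = T.card * γ ^ 2 := by
  have hmem : ∀ i, MemLp (fun c : ∀ i, α i => g i (c i)) 2 (Measure.pi μ) := fun i =>
    MemLp.of_bound ((hg i).comp (measurable_pi_apply i)).aestronglyMeasurable K
      (Filter.Eventually.of_forall fun c => by simpa using hb i (c i))
  have hind : iIndepFun (fun i (c : ∀ i, α i) => g i (c i)) (Measure.pi μ) :=
    iIndepFun_pi fun i => (hg i).aemeasurable
  have hv := IndepFun.variance_sum (s := T) (X := fun i (c : ∀ i, α i) => g i (c i))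
    (fun i _ => hmem i) (fun i _ j _ hij => hind.indepFun hij)
  have hsum : MemLp (∑ i ∈ T, fun c : ∀ i, α i => g i (c i)) 2 (Measure.pi μ) :=
    memLp_finsetSum' T fun i _ => hmem i
  have hvi : ∀ i, variance (fun c : ∀ i, α i => g i (c i)) (Measure.pi μ) = γ ^ 2 := fun i => by
    rw [variance_of_integral_eq_zero (hmem i).aestronglyMeasurable.aemeasurable]
    · rw [← h2 i]
      exact integral_comp_eval μ (g := fun x => g i x ^ 2) ((hg i).pow_const 2)
    · rw [integral_comp_eval μ (hg i), h0 i]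
  have h0s : ∫ c, (∑ i ∈ T, fun c : ∀ i, α i => g i (c i)) c ∂(Measure.pi μ) = 0 := by
    simp only [Finset.sum_apply]
    rw [integral_finsetSum _ fun i _ => (hmem i).integrable (by norm_num)]
    exact Finset.sum_eq_zero fun i _ => by rw [integral_comp_eval μ (hg i), h0 i]
  rw [variance_of_integral_eq_zero hsum.aestronglyMeasurable.aemeasurable h0s] at hv
  rw [Finset.sum_congr rfl fun i _ => hvi i, Finset.sum_const, nsmul_eq_mul] at hv
  rw [← hv]
  have hi := hsum.integrable_sq
  simp only [Finset.sum_apply] at hi ⊢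
  exact ⟨hi, trivial⟩

theorem measure_count_le {E : ∀ i, Set (α i)} (hE : ∀ i, MeasurableSet (E i)) (s : Finset ι)
    {q : ℝ} (hq : 0 < q) (hqs : q ≤ ∑ i ∈ s, (μ i).real (E i)) :
    Measure.pi μ {c | ∑ i ∈ s, (E i).indicator (1 : α i → ℝ) (c i) ≤ 3 / 4 * q} ≤
      ENNReal.ofReal (16 / q) := by
  set S : ℝ := ∑ i ∈ s, (μ i).real (E i) with hS
  have hSp : 0 < S := hq.trans_le hqs
  have hind := iIndepFun_indicator μ hE
  have hmeas : ∀ i, Measurable ((E i).indicator (1 : α i → ℝ)) := fun i =>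
    measurable_one.indicator (hE i)
  have h01 : ∀ i x, (E i).indicator (1 : α i → ℝ) x ∈ Set.Icc (0 : ℝ) 1 := fun i x => by
    by_cases h : x ∈ E i <;> simp [h]
  have hmem : ∀ i, MemLp (fun c : ∀ i, α i => (E i).indicator (1 : α i → ℝ) (c i)) 2
      (Measure.pi μ) := fun i =>
    MemLp.of_bound ((hmeas i).comp (measurable_pi_apply i)).aestronglyMeasurable 1
      (Filter.Eventually.of_forall fun c => by
        rw [Real.norm_eq_abs, abs_of_nonneg (h01 i (c i)).1]; exact (h01 i (c i)).2)
  have hint : ∀ i, ∫ c, (E i).indicator (1 : α i → ℝ) (c i) ∂(Measure.pi μ) = (μ i).real (E i) :=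
    fun i => by
      rw [integral_comp_eval μ (hmeas i)]
      exact integral_indicator_one (hE i)
  set X : (∀ i, α i) → ℝ := ∑ i ∈ s, fun c : ∀ i, α i => (E i).indicator (1 : α i → ℝ) (c i)
    with hX
  have hXm : MemLp X 2 (Measure.pi μ) := memLp_finsetSum' s fun i _ => hmem i
  have hXint : ∫ c, X c ∂(Measure.pi μ) = S := by
    simp only [hX, Finset.sum_apply]
    rw [integral_finsetSum _ fun i _ => (hmem i).integrable (by norm_num)]
    exact Finset.sum_congr rfl fun i _ => hint i
  have hvar : variance X (Measure.pi μ) ≤ S := by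
    rw [hX, IndepFun.variance_sum (fun i _ => hmem i) (fun i _ j _ hij => hind.indepFun hij)]
    refine Finset.sum_le_sum fun i _ => ?_
    refine (variance_le_expectation_sq (hmem i).aestronglyMeasurable).trans (le_of_eq ?_)
    rw [← hint i]
    refine integral_congr_ae (Filter.Eventually.of_forall fun c => ?_)
    by_cases h : c i ∈ E i <;> simp [h]
  have hch := meas_ge_le_variance_div_sq hXm (c := S / 4) (by positivity)
  refine le_trans (measure_mono fun c hc => ?_) (hch.trans (ENNReal.ofReal_le_ofReal ?_))
  · rw [Set.mem_ofPred_eq] at hc ⊢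
    rw [hXint]
    have e : X c = ∑ i ∈ s, (E i).indicator (1 : α i → ℝ) (c i) := by
      simp [hX, Finset.sum_apply]
    rw [e, le_abs]
    right
    linarith
  · calc variance X (Measure.pi μ) / (S / 4) ^ 2 ≤ S / (S / 4) ^ 2 := by gcongr
      _ = 16 / S := by field_simp; norm_num
      _ ≤ 16 / q := by gcongr

theorem measure_count_ge {E : ∀ i, Set (α i)} (hE : ∀ i, MeasurableSet (E i)) (s : Finset ι)
    {q K : ℝ} (hqs : ∑ i ∈ s, (μ i).real (E i) ≤ q) :
    Measure.pi μ {c | K ≤ ∑ i ∈ s, (E i).indicator (1 : α i → ℝ) (c i)} ≤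
      ENNReal.ofReal (Real.exp (2 * q - K)) := by
  have hind := iIndepFun_indicator μ hE
  have hmeas : ∀ i, Measurable ((E i).indicator (1 : α i → ℝ)) := fun i =>
    measurable_one.indicator (hE i)
  set Y : ι → (∀ i, α i) → ℝ := fun i c => (E i).indicator (1 : α i → ℝ) (c i) with hY
  have hYm : ∀ i, Measurable (Y i) := fun i => (hmeas i).comp (measurable_pi_apply i)
  have hY01 : ∀ i c, Y i c = 0 ∨ Y i c = 1 := fun i c => by
    by_cases h : c i ∈ E i <;> simp [hY, h]
  have hmgf : ∀ i, mgf (Y i) (Measure.pi μ) 1 ≤ Real.exp (2 * (μ i).real (E i)) := fun i => by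
    have hint : ∫ c, Y i c ∂(Measure.pi μ) = (μ i).real (E i) := by
      rw [hY, integral_comp_eval μ (hmeas i)]
      exact integral_indicator_one (hE i)
    have hYi : Integrable (Y i) (Measure.pi μ) :=
      Integrable.of_mem_Icc 0 1 (hYm i).aemeasurable (Filter.Eventually.of_forall fun c => by
        rcases hY01 i c with h | h <;> simp [h])
    calc mgf (Y i) (Measure.pi μ) 1 = ∫ c, (1 + (Real.exp 1 - 1) * Y i c) ∂(Measure.pi μ) := by
          refine integral_congr_ae (Filter.Eventually.of_forall fun c => ?_)
          rcases hY01 i c with h | h <;> simp [h]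
      _ = 1 + (Real.exp 1 - 1) * (μ i).real (E i) := by
          rw [integral_add (integrable_const _) (hYi.const_mul _), integral_const_mul, hint]
          simp
      _ ≤ 1 + 2 * (μ i).real (E i) := by
          have := Real.exp_one_lt_d9
          have h0 : 0 ≤ (μ i).real (E i) := measureReal_nonneg
          nlinarith
      _ ≤ _ := by
          have := Real.add_one_le_exp (2 * (μ i).real (E i))
          linarith
  have hbd : ∀ c, (∑ i ∈ s, Y i c) ∈ Set.Icc (0 : ℝ) s.card := fun c => by
    refine ⟨Finset.sum_nonneg fun i _ => by rcases hY01 i c with h | h <;> simp [h], ?_⟩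
    calc ∑ i ∈ s, Y i c ≤ ∑ i ∈ s, (1 : ℝ) :=
          Finset.sum_le_sum fun i _ => by rcases hY01 i c with h | h <;> simp [h]
      _ = s.card := by simp
  have hcher := measure_ge_le_exp_mul_mgf (μ := Measure.pi μ) (X := ∑ i ∈ s, Y i) (t := 1) K
    zero_le_one ?_
  · rw [hind.mgf_sum hYm] at hcher
    have h3 : ∏ i ∈ s, mgf (Y i) (Measure.pi μ) 1 ≤ Real.exp (2 * q) := by
      calc ∏ i ∈ s, mgf (Y i) (Measure.pi μ) 1 ≤ ∏ i ∈ s, Real.exp (2 * (μ i).real (E i)) :=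
            Finset.prod_le_prod (fun i _ => mgf_nonneg) fun i _ => hmgf i
        _ = Real.exp (2 * ∑ i ∈ s, (μ i).real (E i)) := by rw [← Real.exp_sum, Finset.mul_sum]
        _ ≤ _ := Real.exp_le_exp.2 (by linarith)
    have h4 : {c : ∀ i, α i | K ≤ ∑ i ∈ s, (E i).indicator (1 : α i → ℝ) (c i)} =
        {c | K ≤ (∑ i ∈ s, Y i) c} := by
      ext c; simp [hY, Finset.sum_apply]
    rw [h4, ← ENNReal.ofReal_toReal (measure_ne_top (Measure.pi μ) _)]
    refine ENNReal.ofReal_le_ofReal (hcher.trans ?_)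
    calc Real.exp (-1 * K) * ∏ i ∈ s, mgf (Y i) (Measure.pi μ) 1
        ≤ Real.exp (-1 * K) * Real.exp (2 * q) := by gcongr
      _ = _ := by rw [← Real.exp_add]; congr 1; ring
  · refine Integrable.of_mem_Icc 0 (Real.exp s.card) (by fun_prop)
      (Filter.Eventually.of_forall fun c => ⟨(Real.exp_pos _).le, Real.exp_le_exp.2 ?_⟩)
    rw [one_mul, Finset.sum_apply]
    exact (hbd c).2

end ProductMeasure

/-! ### The model with the row features and the mask held fixed -/

/-- The random matrix for given row features: column features in `Y` with law `P`, the function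
`F v` giving the noiseless row `v`, and noise `E (h v j)` with `h v j` of law `ν v j`. -/
structure ColumnModel (m n : ℕ) (Y : Type u) [MeasurableSpace Y] (Δ Be γ : ℝ) where
  P : Measure Y
  [probP : IsProbabilityMeasure P]
  ν : Fin m → Fin n → Measure ℝ
  [probν : ∀ v j, IsProbabilityMeasure (ν v j)]
  E : ℝ → ℝ
  measurable_E : Measurable E
  abs_E_le : ∀ x, |E x| ≤ Be
  integral_E : ∀ v j, ∫ x, E x ∂(ν v j) = 0
  integral_E_sq : ∀ v j, ∫ x, E x ^ 2 ∂(ν v j) = γ ^ 2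
  F : Fin m → Y → ℝ
  measurable_F : ∀ v, Measurable (F v)
  abs_F_sub_le : ∀ v w y, |F v y - F w y| ≤ Δ
  Δ_nonneg : 0 ≤ Δ

attribute [instance] ColumnModel.probP ColumnModel.probν

namespace ColumnModel

variable {m n : ℕ} {Y : Type u} [MeasurableSpace Y] {Δ Be γ : ℝ}
  (S : ColumnModel m n Y Δ Be γ)

/-- The law of a column: its feature and its noise variables. -/
noncomputable def κ (j : Fin n) : Measure (Y × (Fin m → ℝ)) :=
  S.P.prod (Measure.pi fun v => S.ν v j)

instance (j : Fin n) : IsProbabilityMeasure (S.κ j) := by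
  unfold κ; infer_instance

/-- The law of all columns. -/
noncomputable def law : Measure (Fin n → Y × (Fin m → ℝ)) := Measure.pi S.κ

instance : IsProbabilityMeasure S.law := by
  unfold law; infer_instance

/-- An entry of the noisy matrix. -/
def entry (v : Fin m) (c : Y × (Fin m → ℝ)) : ℝ := S.F v c.1 + S.E (c.2 v)

/-- The difference of two entries of a column. -/
def diff (u v : Fin m) (c : Y × (Fin m → ℝ)) : ℝ := S.entry u c - S.entry v c

/-- The expected difference of two rows. -/
noncomputable def meanDiff (u v : Fin m) : ℝ := ∫ y, (S.F u y - S.F v y) ∂S.P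

/-- The variance of the difference of two noiseless rows. -/
noncomputable def varDiff (u v : Fin m) : ℝ := ∫ y, (S.F u y - S.F v y - S.meanDiff u v) ^ 2 ∂S.P

theorem Be_nonneg (S : ColumnModel m n Y Δ Be γ) : 0 ≤ Be := (abs_nonneg _).trans (S.abs_E_le 0)

theorem measurable_entry (v : Fin m) : Measurable (S.entry v) :=
  ((S.measurable_F v).comp measurable_fst).add
    (S.measurable_E.comp ((measurable_pi_apply v).comp measurable_snd))

theorem measurable_diff (u v : Fin m) : Measurable (S.diff u v) :=
  (S.measurable_entry u).sub (S.measurable_entry v)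

theorem diff_eq (u v : Fin m) (c : Y × (Fin m → ℝ)) :
    S.diff u v c = (S.F u c.1 - S.F v c.1) + (S.E (c.2 u) - S.E (c.2 v)) := by
  unfold diff entry; ring

theorem abs_diff_le (u v : Fin m) (c : Y × (Fin m → ℝ)) : |S.diff u v c| ≤ Δ + 2 * Be := by
  rw [diff_eq]
  have h1 := S.abs_F_sub_le u v c.1
  have h2 := S.abs_E_le (c.2 u)
  have h3 := S.abs_E_le (c.2 v)
  rw [abs_le] at *
  constructor <;> linarith [h1.1, h1.2, h2.1, h2.2, h3.1, h3.2]

theorem abs_meanDiff_le (u v : Fin m) : |S.meanDiff u v| ≤ Δ := by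
  have := norm_integral_le_of_norm_le_const (μ := S.P) (f := fun y => S.F u y - S.F v y) (C := Δ)
    (Filter.Eventually.of_forall fun y => S.abs_F_sub_le u v y)
  simpa [meanDiff] using this

theorem abs_diff_sub_le (u v : Fin m) (c : Y × (Fin m → ℝ)) :
    |S.diff u v c - S.meanDiff u v| ≤ 2 * (Δ + 2 * Be) := by
  have h1 := S.abs_diff_le u v c
  have h2 := S.abs_meanDiff_le u v
  have h3 := S.Be_nonneg
  rw [abs_le] at *
  constructor <;> linarith [h1.1, h1.2, h2.1, h2.2]

theorem integrable_F_sub (u v : Fin m) : Integrable (fun y => S.F u y - S.F v y) S.P :=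
  Integrable.of_bound ((S.measurable_F u).sub (S.measurable_F v)).aestronglyMeasurable Δ
    (Filter.Eventually.of_forall fun y => S.abs_F_sub_le u v y)

theorem integrable_E (v : Fin m) (j : Fin n) : Integrable S.E (S.ν v j) :=
  Integrable.of_bound S.measurable_E.aestronglyMeasurable Be
    (Filter.Eventually.of_forall fun y => S.abs_E_le y)

theorem integrable_E_sq (v : Fin m) (j : Fin n) : Integrable (fun x => S.E x ^ 2) (S.ν v j) :=
  Integrable.of_bound (S.measurable_E.pow_const 2).aestronglyMeasurable (Be ^ 2)
    (Filter.Eventually.of_forall fun y => by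
      rw [Real.norm_eq_abs, abs_pow]; exact pow_le_pow_left₀ (abs_nonneg _) (S.abs_E_le y) 2)

theorem lintegral_add_E_sq (v : Fin m) (j : Fin n) (a b : ℝ) :
    ∫⁻ x, ENNReal.ofReal ((a + b * S.E x) ^ 2) ∂(S.ν v j) =
      ENNReal.ofReal (a ^ 2 + b ^ 2 * γ ^ 2) := by
  have e : ∀ x, (a + b * S.E x) ^ 2 = a ^ 2 + 2 * a * b * S.E x + b ^ 2 * S.E x ^ 2 :=
    fun x => by ring
  have i1 : Integrable (fun x => a ^ 2 + 2 * a * b * S.E x) (S.ν v j) :=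
    (integrable_const _).add ((S.integrable_E v j).const_mul _)
  have i2 : Integrable (fun x => b ^ 2 * S.E x ^ 2) (S.ν v j) :=
    (S.integrable_E_sq v j).const_mul _
  rw [← ofReal_integral_eq_lintegral_ofReal]
  · congr 1
    simp only [e]
    rw [integral_add i1 i2, integral_add (integrable_const _) ((S.integrable_E v j).const_mul _),
      integral_const_mul, integral_const_mul, S.integral_E, S.integral_E_sq]
    simp
  · simp only [e]
    exact i1.add i2
  · exact Filter.Eventually.of_forall fun x => sq_nonneg _

/-- Replacing the noise variable of one row in a column by an independent copy. -/
theorem lintegral_resample (v : Fin m) (j : Fin n) {Φ : Y × (Fin m → ℝ) → ℝ≥0∞}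
    (hΦ : Measurable Φ) :
    ∫⁻ c, Φ c ∂(S.κ j) = ∫⁻ c, ∫⁻ t, Φ (c.1, Function.update c.2 v t) ∂(S.ν v j) ∂(S.κ j) := by
  have hup := measurePreserving_update (fun v => S.ν v j) v
  have hm2 : Measurable fun p : (Y × (Fin m → ℝ)) × ℝ => Φ (p.1.1, Function.update p.1.2 v p.2) :=
    hΦ.comp ((measurable_fst.comp measurable_fst).prodMk
      (hup.measurable.comp ((measurable_snd.comp measurable_fst).prodMk measurable_snd)))
  have h1 : ∀ y, ∫⁻ h, Φ (y, h) ∂(Measure.pi fun v => S.ν v j) =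
      ∫⁻ h, ∫⁻ t, Φ (y, Function.update h v t) ∂(S.ν v j) ∂(Measure.pi fun v => S.ν v j) :=
    fun y => by
      have hy : Measurable fun h => Φ (y, h) := hΦ.comp (measurable_const.prodMk measurable_id)
      rw [← hup.lintegral_comp hy]
      exact lintegral_prod _ (hy.comp hup.measurable).aemeasurable
  unfold κ
  rw [lintegral_prod _ hΦ.aemeasurable, lintegral_prod _ ?_]
  · exact lintegral_congr h1
  · exact (Measurable.lintegral_prod_right' hm2).aemeasurable

theorem integral_diff_sub (u v : Fin m) (j : Fin n) :
    ∫ c, (S.diff u v c - S.meanDiff u v) ∂(S.κ j) = 0 := by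
  have hI : ∀ w, Integrable (fun c : Y × (Fin m → ℝ) => S.E (c.2 w)) (S.κ j) := fun w =>
    Integrable.of_bound (S.measurable_E.comp
      ((measurable_pi_apply w).comp measurable_snd)).aestronglyMeasurable Be
      (Filter.Eventually.of_forall fun y => S.abs_E_le _)
  have h0 : ∀ w, ∫ c : Y × (Fin m → ℝ), S.E (c.2 w) ∂(S.κ j) = 0 := fun w => by
    unfold κ
    rw [integral_fun_snd (fun h : Fin m → ℝ => S.E (h w)),
      integral_comp_eval (fun v => S.ν v j) S.measurable_E, S.integral_E]
    simp
  have h1 : Integrable (fun c : Y × (Fin m → ℝ) => S.F u c.1 - S.F v c.1) (S.κ j) :=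
    Integrable.of_bound (((S.measurable_F u).sub (S.measurable_F v)).comp
      measurable_fst).aestronglyMeasurable Δ
      (Filter.Eventually.of_forall fun c => S.abs_F_sub_le u v c.1)
  have h2 : ∫ c : Y × (Fin m → ℝ), (S.F u c.1 - S.F v c.1) ∂(S.κ j) = S.meanDiff u v := by
    unfold κ
    rw [integral_fun_fst (fun y => S.F u y - S.F v y)]
    simp [meanDiff]
  simp only [diff_eq]
  have h3 : Integrable (fun c : Y × (Fin m → ℝ) => S.E (c.2 u) - S.E (c.2 v)) (S.κ j) :=
    (hI u).sub (hI v)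
  have h4 : Integrable (fun c : Y × (Fin m → ℝ) => S.F u c.1 - S.F v c.1 +
    (S.E (c.2 u) - S.E (c.2 v))) (S.κ j) := h1.add h3
  rw [integral_sub h4 (integrable_const _), integral_add h1 h3, integral_sub (hI u) (hI v), h0, h0,
    h2]
  simp

theorem varDiff_nonneg (u v : Fin m) : 0 ≤ S.varDiff u v := integral_nonneg fun _ => sq_nonneg _

theorem integrable_F_sub_sq (u v : Fin m) (a : ℝ) :
    Integrable (fun y => (S.F u y - S.F v y - a) ^ 2) S.P := by
  refine Integrable.of_bound
    ((((S.measurable_F u).sub (S.measurable_F v)).sub_const a).pow_const 2).aestronglyMeasurable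
    ((Δ + |a|) ^ 2) (Filter.Eventually.of_forall fun y => ?_)
  rw [Real.norm_eq_abs, abs_pow]
  exact pow_le_pow_left₀ (abs_nonneg _)
    ((abs_sub _ _).trans (add_le_add_left (S.abs_F_sub_le u v y) _)) 2

theorem lintegral_F_sub_sq (u v : Fin m) :
    ∫⁻ y, ENNReal.ofReal ((S.F u y - S.F v y - S.meanDiff u v) ^ 2) ∂S.P =
      ENNReal.ofReal (S.varDiff u v) := by
  rw [varDiff, ofReal_integral_eq_lintegral_ofReal (S.integrable_F_sub_sq u v _)
    (Filter.Eventually.of_forall fun y => sq_nonneg _)]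

theorem varDiff_le {e : ℝ} (u v : Fin m) (h : ∀ y, |S.F u y - S.F v y| ≤ e) :
    S.varDiff u v ≤ e ^ 2 := by
  have h1 : S.varDiff u v ≤ ∫ y, (S.F u y - S.F v y - 0) ^ 2 ∂S.P := by
    have i1 := S.integrable_F_sub u v
    have i2 : Integrable (fun y => (S.F u y - S.F v y) ^ 2) S.P := by
      simpa using S.integrable_F_sub_sq u v 0
    have e : ∀ y, (S.F u y - S.F v y - S.meanDiff u v) ^ 2 =
        (S.F u y - S.F v y) ^ 2 - 2 * S.meanDiff u v * (S.F u y - S.F v y) + S.meanDiff u v ^ 2 :=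
      fun y => by ring
    simp only [varDiff, e, sub_zero]
    have i3 : Integrable (fun y => (S.F u y - S.F v y) ^ 2 -
      2 * S.meanDiff u v * (S.F u y - S.F v y)) S.P := i2.sub (i1.const_mul _)
    rw [integral_add i3 (integrable_const _), integral_sub i2 (i1.const_mul _), integral_const_mul]
    have : ∫ y, (S.F u y - S.F v y) ∂S.P = S.meanDiff u v := rfl
    rw [this]
    simp only [integral_const, probReal_univ, smul_eq_mul, one_mul]
    nlinarith [sq_nonneg (S.meanDiff u v)]
  refine h1.trans ?_
  calc ∫ y, (S.F u y - S.F v y - 0) ^ 2 ∂S.P ≤ ∫ y, e ^ 2 ∂S.P := by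
        refine integral_mono (S.integrable_F_sub_sq u v 0) (integrable_const _) fun y => ?_
        simp only [sub_zero]
        rw [← sq_abs]
        exact pow_le_pow_left₀ (abs_nonneg _) (h y) 2
    _ = e ^ 2 := by simp

theorem lintegral_diff_sub_sq {u v : Fin m} (huv : u ≠ v) (j : Fin n) :
    ∫⁻ c, ENNReal.ofReal ((S.diff u v c - S.meanDiff u v) ^ 2) ∂(S.κ j) =
      ENNReal.ofReal (S.varDiff u v + 2 * γ ^ 2) := by
  have hm : Measurable fun c => ENNReal.ofReal ((S.diff u v c - S.meanDiff u v) ^ 2) :=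
    (((S.measurable_diff u v).sub_const _).pow_const 2).ennreal_ofReal
  rw [S.lintegral_resample u j hm]
  have e1 : ∀ (c : Y × (Fin m → ℝ)) t,
      (S.diff u v (c.1, Function.update c.2 u t) - S.meanDiff u v) ^ 2 =
      ((S.F u c.1 - S.F v c.1 - S.E (c.2 v) - S.meanDiff u v) + 1 * S.E t) ^ 2 := fun c t => by
    rw [diff_eq]
    simp only [Function.update_self, Function.update_of_ne huv.symm]
    ring
  simp only [e1, S.lintegral_add_E_sq]
  have hm2 : Measurable fun c : Y × (Fin m → ℝ) => ENNReal.ofReal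
      ((S.F u c.1 - S.F v c.1 - S.E (c.2 v) - S.meanDiff u v) ^ 2 + 1 ^ 2 * γ ^ 2) :=
    ((((((S.measurable_F u).comp measurable_fst).sub ((S.measurable_F v).comp measurable_fst)).sub
      (S.measurable_E.comp ((measurable_pi_apply v).comp measurable_snd))).sub_const _).pow_const
      2).add_const _ |>.ennreal_ofReal
  rw [S.lintegral_resample v j hm2]
  have e2 : ∀ (c : Y × (Fin m → ℝ)) t, ENNReal.ofReal
      ((S.F u c.1 - S.F v c.1 - S.E t - S.meanDiff u v) ^ 2 + 1 ^ 2 * γ ^ 2) =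
      ENNReal.ofReal (((S.F u c.1 - S.F v c.1 - S.meanDiff u v) + (-1) * S.E t) ^ 2) +
        ENNReal.ofReal (γ ^ 2) := fun c t => by
    rw [← ENNReal.ofReal_add (sq_nonneg _) (sq_nonneg _)]
    congr 1; ring
  simp only [Function.update_self, e2]
  have e3 : ∀ c : Y × (Fin m → ℝ), ∫⁻ t, (ENNReal.ofReal
      (((S.F u c.1 - S.F v c.1 - S.meanDiff u v) + (-1) * S.E t) ^ 2) + ENNReal.ofReal (γ ^ 2))
      ∂(S.ν v j) = ENNReal.ofReal ((S.F u c.1 - S.F v c.1 - S.meanDiff u v) ^ 2) +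
        ENNReal.ofReal (2 * γ ^ 2) := fun c => by
    rw [lintegral_add_right _ measurable_const, S.lintegral_add_E_sq, lintegral_const, measure_univ,
      mul_one, ← ENNReal.ofReal_add (by positivity) (by positivity),
      ← ENNReal.ofReal_add (by positivity) (by positivity)]
    congr 1; ring
  simp only [e3]
  rw [lintegral_add_right _ measurable_const, lintegral_const, measure_univ, mul_one,
    ENNReal.ofReal_add (S.varDiff_nonneg u v) (by positivity)]
  congr 1
  have hm4 : Measurable fun y => ENNReal.ofReal ((S.F u y - S.F v y - S.meanDiff u v) ^ 2) :=
    ((((S.measurable_F u).sub (S.measurable_F v)).sub_const _).pow_const 2).ennreal_ofReal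
  rw [← S.lintegral_F_sub_sq, ← (measurePreserving_fst (μ := S.P)
    (ν := Measure.pi fun v => S.ν v j)).lintegral_comp hm4]
  rfl

theorem integrable_diff_sub_sq (u v : Fin m) (j : Fin n) :
    Integrable (fun c => (S.diff u v c - S.meanDiff u v) ^ 2) (S.κ j) := by
  refine Integrable.of_bound
    (((S.measurable_diff u v).sub_const _).pow_const 2).aestronglyMeasurable
    ((2 * (Δ + 2 * Be)) ^ 2) (Filter.Eventually.of_forall fun c => ?_)
  rw [Real.norm_eq_abs, abs_pow]
  exact pow_le_pow_left₀ (abs_nonneg _) (S.abs_diff_sub_le u v c) 2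

theorem integral_diff_sub_sq {u v : Fin m} (huv : u ≠ v) (j : Fin n) :
    ∫ c, (S.diff u v c - S.meanDiff u v) ^ 2 ∂(S.κ j) = S.varDiff u v + 2 * γ ^ 2 := by
  rw [integral_eq_lintegral_of_nonneg_ae (Filter.Eventually.of_forall fun c => sq_nonneg _)
    (S.integrable_diff_sub_sq u v j).aestronglyMeasurable, S.lintegral_diff_sub_sq huv j,
    ENNReal.toReal_ofReal (add_nonneg (S.varDiff_nonneg u v) (by positivity))]

/-- The squared deviation of a difference of entries after the noise of row `v` is replaced. -/
noncomputable def sqGap (u v : Fin m) (p : (Y × (Fin m → ℝ)) × (Y × (Fin m → ℝ))) : ℝ :=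
  (S.diff u v p.1 - S.meanDiff u v) ^ 2 -
    (S.diff u v (p.1.1, Function.update p.1.2 v (p.2.2 v)) - S.meanDiff u v) ^ 2

theorem measurable_update_snd (v : Fin m) :
    Measurable fun p : (Y × (Fin m → ℝ)) × (Y × (Fin m → ℝ)) =>
      (p.1.1, Function.update p.1.2 v (p.2.2 v)) := by
  refine (measurable_fst.comp measurable_fst).prodMk (measurable_pi_iff.2 fun w => ?_)
  by_cases h : w = v
  · subst h
    simp only [Function.update_self]
    exact (measurable_pi_apply w).comp (measurable_snd.comp measurable_snd)
  · simp only [Function.update_of_ne h]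
    exact (measurable_pi_apply w).comp (measurable_snd.comp measurable_fst)

theorem measurable_sqGap (u v : Fin m) : Measurable (S.sqGap u v) :=
  ((((S.measurable_diff u v).comp measurable_fst).sub_const _).pow_const 2).sub
    ((((S.measurable_diff u v).comp (measurable_update_snd v)).sub_const _).pow_const 2)

theorem abs_sqGap_le (u v : Fin m) (p : (Y × (Fin m → ℝ)) × (Y × (Fin m → ℝ))) :
    |S.sqGap u v p| ≤ 4 * (Δ + 2 * Be) ^ 2 := by
  have h1 := pow_le_pow_left₀ (abs_nonneg _) (S.abs_diff_sub_le u v p.1) 2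
  have h2 := pow_le_pow_left₀ (abs_nonneg _)
    (S.abs_diff_sub_le u v (p.1.1, Function.update p.1.2 v (p.2.2 v))) 2
  rw [sq_abs] at h1 h2
  unfold sqGap
  rw [abs_le]
  constructor <;>
    nlinarith [sq_nonneg (S.diff u v p.1 - S.meanDiff u v),
      sq_nonneg (S.diff u v (p.1.1, Function.update p.1.2 v (p.2.2 v)) - S.meanDiff u v)]

theorem le_lintegral_sqGap_sq {u v : Fin m} (huv : u ≠ v) (j : Fin n) :
    ENNReal.ofReal (8 * γ ^ 4) ≤
      ∫⁻ p, ENNReal.ofReal (S.sqGap u v p ^ 2) ∂((S.κ j).prod (S.κ j)) := by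
  have hm : Measurable fun p => ENNReal.ofReal (S.sqGap u v p ^ 2) :=
    ((S.measurable_sqGap u v).pow_const 2).ennreal_ofReal
  rw [lintegral_prod_symm' _ hm]
  have hlow : ∀ c' : Y × (Fin m → ℝ),
      ENNReal.ofReal (4 * γ ^ 2 * (S.E (c'.2 v) ^ 2 + γ ^ 2)) ≤
      ∫⁻ c, ENNReal.ofReal (S.sqGap u v (c, c') ^ 2) ∂(S.κ j) := fun c' => by
    have hm1 : Measurable fun c => ENNReal.ofReal (S.sqGap u v (c, c') ^ 2) :=
      hm.comp (measurable_id.prodMk measurable_const)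
    rw [S.lintegral_resample u j hm1]
    have h1 : ∀ c : Y × (Fin m → ℝ),
        ENNReal.ofReal (4 * γ ^ 2 * (S.E (c'.2 v) - S.E (c.2 v)) ^ 2) ≤
        ∫⁻ t, ENNReal.ofReal (S.sqGap u v ((c.1, Function.update c.2 u t), c') ^ 2)
          ∂(S.ν u j) := fun c => by
      set D := S.E (c'.2 v) - S.E (c.2 v) with hD
      set a := D * (2 * (S.F u c.1 - S.F v c.1 - S.meanDiff u v) - S.E (c.2 v) - S.E (c'.2 v))
        with ha
      have e1 : ∀ t, S.sqGap u v ((c.1, Function.update c.2 u t), c') ^ 2 =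
          (a + (2 * D) * S.E t) ^ 2 := fun t => by
        have : Function.update (Function.update c.2 u t) v (c'.2 v) u = t := by
          rw [Function.update_of_ne huv, Function.update_self]
        simp only [sqGap, diff_eq, Function.update_self, Function.update_of_ne huv.symm, this]
        rw [ha, hD]; ring
      simp only [e1, S.lintegral_add_E_sq]
      exact ENNReal.ofReal_le_ofReal (by nlinarith [sq_nonneg a])
    refine le_trans ?_ (lintegral_mono h1)
    have hm2 : Measurable fun c : Y × (Fin m → ℝ) =>
        ENNReal.ofReal (4 * γ ^ 2 * (S.E (c'.2 v) - S.E (c.2 v)) ^ 2) :=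
      ((((S.measurable_E.comp ((measurable_pi_apply v).comp measurable_snd)).const_sub _).pow_const
        2).const_mul _).ennreal_ofReal
    rw [S.lintegral_resample v j hm2]
    have e2 : ∀ t, 4 * γ ^ 2 * (S.E (c'.2 v) - S.E t) ^ 2 =
        (2 * γ * S.E (c'.2 v) + (-(2 * γ)) * S.E t) ^ 2 := fun t => by ring
    simp only [Function.update_self, e2, S.lintegral_add_E_sq, lintegral_const, measure_univ,
      mul_one]
    exact ENNReal.ofReal_le_ofReal (by nlinarith)
  refine le_trans ?_ (lintegral_mono hlow)
  have hm3 : Measurable fun c : Y × (Fin m → ℝ) =>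
      ENNReal.ofReal (4 * γ ^ 2 * (S.E (c.2 v) ^ 2 + γ ^ 2)) :=
    ((((S.measurable_E.comp ((measurable_pi_apply v).comp measurable_snd)).pow_const 2).add_const
      _).const_mul _).ennreal_ofReal
  rw [S.lintegral_resample v j hm3]
  have e3 : ∀ t, ENNReal.ofReal (4 * γ ^ 2 * (S.E t ^ 2 + γ ^ 2)) =
      ENNReal.ofReal ((0 + (2 * γ) * S.E t) ^ 2) + ENNReal.ofReal (4 * γ ^ 4) := fun t => by
    rw [← ENNReal.ofReal_add (sq_nonneg _) (by positivity)]
    congr 1; ring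
  simp only [Function.update_self, e3]
  rw [lintegral_const, measure_univ, mul_one, lintegral_add_right _ measurable_const,
    S.lintegral_add_E_sq, lintegral_const, measure_univ, mul_one,
    ← ENNReal.ofReal_add (by positivity) (by positivity)]
  exact ENNReal.ofReal_le_ofReal (le_of_eq (by ring))

theorem le_measure_sqGap {u v : Fin m} (huv : u ≠ v) (j : Fin n) :
    γ ^ 4 / (4 * (Δ + 2 * Be) ^ 4) ≤
      ((S.κ j).prod (S.κ j)).real {p | 2 * γ ^ 2 ≤ |S.sqGap u v p|} := by
  set B := Δ + 2 * Be with hB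
  set ρ := ((S.κ j).prod (S.κ j)).real {p | 2 * γ ^ 2 ≤ |S.sqGap u v p|} with hρ
  have hρ0 : 0 ≤ ρ := measureReal_nonneg
  have hB0 : 0 ≤ B := by have := S.Be_nonneg; have := S.Δ_nonneg; positivity
  rcases hB0.eq_or_lt with h | hBpos
  · rw [← h]; simpa using hρ0
  have hms : MeasurableSet {p | 2 * γ ^ 2 ≤ |S.sqGap u v p|} :=
    measurableSet_le measurable_const (S.measurable_sqGap u v).abs
  have hpt : ∀ p, ENNReal.ofReal (S.sqGap u v p ^ 2) ≤
      {p | 2 * γ ^ 2 ≤ |S.sqGap u v p|}.indicator (fun _ => ENNReal.ofReal (16 * B ^ 4)) p +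
        ENNReal.ofReal (4 * γ ^ 4) := fun p => by
    by_cases h : 2 * γ ^ 2 ≤ |S.sqGap u v p|
    · rw [Set.indicator_of_mem (by exact h)]
      refine le_add_right (ENNReal.ofReal_le_ofReal ?_)
      have := pow_le_pow_left₀ (abs_nonneg _) (S.abs_sqGap_le u v p) 2
      rw [sq_abs] at this
      calc S.sqGap u v p ^ 2 ≤ (4 * B ^ 2) ^ 2 := this
        _ = _ := by ring
    · refine le_add_left (ENNReal.ofReal_le_ofReal ?_)
      have := pow_le_pow_left₀ (abs_nonneg _) (not_le.1 h).le 2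
      rw [sq_abs] at this
      calc S.sqGap u v p ^ 2 ≤ (2 * γ ^ 2) ^ 2 := this
        _ = _ := by ring
  have h1 := (S.le_lintegral_sqGap_sq huv j).trans (lintegral_mono hpt)
  rw [lintegral_add_right _ measurable_const, lintegral_indicator_const hms, lintegral_const,
    measure_univ, mul_one, ← ENNReal.ofReal_toReal (measure_ne_top ((S.κ j).prod (S.κ j)) _),
    ← ENNReal.ofReal_mul (by positivity), ← ENNReal.ofReal_add (by positivity) (by positivity)]
    at h1
  have h2 := (ENNReal.ofReal_le_ofReal_iff (by positivity)).1 h1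
  rw [div_le_iff₀ (by positivity)]
  have h3 : 8 * γ ^ 4 ≤ 16 * B ^ 4 * ρ + 4 * γ ^ 4 := h2
  linarith

end ColumnModel
namespace ColumnModel

variable {m n : ℕ} {Y : Type u} [MeasurableSpace Y] {Δ Be γ : ℝ}
  (S : ColumnModel m n Y Δ Be γ)

theorem measurable_avg_diff (O : Finset (Fin n)) (u v : Fin m) :
    Measurable fun C : Fin n → Y × (Fin m → ℝ) => avg O fun j => S.diff u v (C j) :=
  (Finset.measurable_fun_sum O fun j _ =>
    (S.measurable_diff u v).comp (measurable_pi_apply j)).div_const _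

theorem measurable_ssd_diff (O : Finset (Fin n)) (u v : Fin m) :
    Measurable fun C : Fin n → Y × (Fin m → ℝ) => ssd O fun j => S.diff u v (C j) :=
  Finset.measurable_fun_sum O fun j _ =>
    (((S.measurable_diff u v).comp (measurable_pi_apply j)).sub
      (S.measurable_avg_diff O u v)).pow_const 2

theorem law_avg_le {O : Finset (Fin n)} (hO : O.Nonempty) (hB : 0 < Δ + 2 * Be) (u v : Fin m)
    {t : ℝ} (ht : 0 ≤ t) :
    S.law {C | t ≤ |avg O (fun j => S.diff u v (C j)) - S.meanDiff u v|} ≤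
      ENNReal.ofReal (2 * Real.exp (-(t ^ 2 * O.card / (8 * (Δ + 2 * Be) ^ 2)))) := by
  have h := measure_abs_sum_ge_le S.κ (Y := fun _ c => S.diff u v c - S.meanDiff u v)
    (fun _ => (S.measurable_diff u v).sub_const _) (K := 2 * (Δ + 2 * Be)) (by positivity)
    (fun _ c => S.abs_diff_sub_le u v c) (fun j => S.integral_diff_sub u v j) hO ht
  have e : 2 * (2 * (Δ + 2 * Be)) ^ 2 = 8 * (Δ + 2 * Be) ^ 2 := by ring
  rw [e] at h
  refine le_trans (measure_mono fun C hC => ?_) h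
  have hc : (0 : ℝ) < O.card := by exact_mod_cast hO.card_pos
  rw [Set.mem_ofPred_eq] at hC ⊢
  have e2 : ∑ j ∈ O, (S.diff u v (C j) - S.meanDiff u v) =
      (avg O (fun j => S.diff u v (C j)) - S.meanDiff u v) * O.card := by
    rw [Finset.sum_sub_distrib, ← card_mul_avg hO, Finset.sum_const, nsmul_eq_mul]
    ring
  rw [e2, abs_mul, abs_of_pos hc]
  exact mul_le_mul_of_nonneg_right hC hc.le

theorem law_sq_le {O : Finset (Fin n)} (hO : O.Nonempty) (hB : 0 < Δ + 2 * Be) {u v : Fin m}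
    (huv : u ≠ v) {t : ℝ} (ht : 0 ≤ t) :
    S.law {C | t ≤ |avg O (fun j => (S.diff u v (C j) - S.meanDiff u v) ^ 2) -
        (S.varDiff u v + 2 * γ ^ 2)|} ≤
      ENNReal.ofReal (2 * Real.exp (-(t ^ 2 * O.card / (32 * (Δ + 2 * Be) ^ 4)))) := by
  set V := S.varDiff u v + 2 * γ ^ 2 with hV
  have hV0 : 0 ≤ V := add_nonneg (S.varDiff_nonneg u v) (by positivity)
  have hsq : ∀ c, (S.diff u v c - S.meanDiff u v) ^ 2 ≤ 4 * (Δ + 2 * Be) ^ 2 := fun c => by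
    have := pow_le_pow_left₀ (abs_nonneg _) (S.abs_diff_sub_le u v c) 2
    rw [sq_abs] at this
    calc (S.diff u v c - S.meanDiff u v) ^ 2 ≤ (2 * (Δ + 2 * Be)) ^ 2 := this
      _ = _ := by ring
  have hV1 : ∀ _ : Fin n, V ≤ 4 * (Δ + 2 * Be) ^ 2 := fun j => by
    rw [hV, ← S.integral_diff_sub_sq huv j]
    calc ∫ c, (S.diff u v c - S.meanDiff u v) ^ 2 ∂(S.κ j)
        ≤ ∫ c, 4 * (Δ + 2 * Be) ^ 2 ∂(S.κ j) :=
          integral_mono (S.integrable_diff_sub_sq u v j) (integrable_const _) hsq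
      _ = _ := by simp
  have h := measure_abs_sum_ge_le S.κ (Y := fun _ c => (S.diff u v c - S.meanDiff u v) ^ 2 - V)
    (fun _ => (((S.measurable_diff u v).sub_const _).pow_const 2).sub_const _)
    (K := 4 * (Δ + 2 * Be) ^ 2) (by positivity)
    (fun j c => by
      rw [abs_le]
      have h1 := hsq c
      have h2 := hV1 j
      have h3 := sq_nonneg (S.diff u v c - S.meanDiff u v)
      constructor <;> linarith)
    (fun j => by
      rw [integral_sub (S.integrable_diff_sub_sq u v j) (integrable_const _),
        S.integral_diff_sub_sq huv j]
      simp [hV]) hO ht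
  have e : 2 * (4 * (Δ + 2 * Be) ^ 2) ^ 2 = 32 * (Δ + 2 * Be) ^ 4 := by ring
  rw [e] at h
  refine le_trans (measure_mono fun C hC => ?_) h
  have hc : (0 : ℝ) < O.card := by exact_mod_cast hO.card_pos
  rw [Set.mem_ofPred_eq] at hC ⊢
  have e2 : ∑ j ∈ O, ((S.diff u v (C j) - S.meanDiff u v) ^ 2 - V) =
      (avg O (fun j => (S.diff u v (C j) - S.meanDiff u v) ^ 2) - V) * O.card := by
    rw [Finset.sum_sub_distrib, ← card_mul_avg hO, Finset.sum_const, nsmul_eq_mul]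
    ring
  rw [e2, abs_mul, abs_of_pos hc]
  exact mul_le_mul_of_nonneg_right hC hc.le

open Classical in
/-- The columns of `O` in which exchanging the noise of row `v` changes the squared deviation
noticeably. -/
noncomputable def active (O : Finset (Fin n)) (u v : Fin m)
    (p : (Fin n → Y × (Fin m → ℝ)) × (Fin n → Y × (Fin m → ℝ))) : Finset (Fin n) :=
  O.filter fun j => 2 * γ ^ 2 ≤ |S.sqGap u v (p.1 j, p.2 j)|

theorem law_active_le {O : Finset (Fin n)} (hO : O.Nonempty) {u v : Fin m} (huv : u ≠ v) :
    (S.law.prod S.law) {p | ((S.active O u v p).card : ℝ) <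
        γ ^ 4 / (8 * (Δ + 2 * Be) ^ 4) * O.card} ≤
      ENNReal.ofReal (Real.exp (-((γ ^ 4 / (8 * (Δ + 2 * Be) ^ 4)) ^ 2 * O.card / 2))) := by
  classical
  set θ := γ ^ 4 / (8 * (Δ + 2 * Be) ^ 4) with hθ
  have hθ0 : 0 ≤ θ := by positivity
  set G : Set ((Y × (Fin m → ℝ)) × (Y × (Fin m → ℝ))) := {p | 2 * γ ^ 2 ≤ |S.sqGap u v p|} with hG
  have hGm : MeasurableSet G := measurableSet_le measurable_const (S.measurable_sqGap u v).abs
  have hGp : ∀ j, 2 * θ ≤ ((S.κ j).prod (S.κ j)).real G := fun j => by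
    refine le_trans (le_of_eq ?_) (S.le_measure_sqGap huv j)
    rw [hθ]
    by_cases h : (Δ + 2 * Be) = 0
    · simp [h]
    · field_simp
      ring
  set Z : Fin n → (Y × (Fin m → ℝ)) × (Y × (Fin m → ℝ)) → ℝ := fun j p =>
    ((S.κ j).prod (S.κ j)).real G - G.indicator 1 p with hZ
  have hZm : ∀ j, Measurable (Z j) := fun j => (measurable_one.indicator hGm).const_sub _
  have hZb : ∀ j p, |Z j p| ≤ 1 := fun j p => by
    have h1 : 0 ≤ ((S.κ j).prod (S.κ j)).real G := measureReal_nonneg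
    have h2 : ((S.κ j).prod (S.κ j)).real G ≤ 1 := measureReal_le_one
    rw [abs_le]
    by_cases h : p ∈ G <;> simp only [hZ, h, Set.indicator_of_mem, Set.indicator_of_notMem,
      not_false_eq_true, Pi.one_apply] <;> constructor <;> linarith
  have hZ0 : ∀ j, ∫ p, Z j p ∂((S.κ j).prod (S.κ j)) = 0 := fun j => by
    have hi : Integrable (G.indicator (1 : (Y × (Fin m → ℝ)) × (Y × (Fin m → ℝ)) → ℝ))
        ((S.κ j).prod (S.κ j)) :=
      (integrable_const (1 : ℝ)).indicator hGm
    simp only [hZ]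
    rw [integral_sub (integrable_const _) hi, integral_indicator_one hGm]
    simp
  have h := measure_sum_ge_le (fun j => (S.κ j).prod (S.κ j)) hZm one_pos hZb hZ0 hO hθ0
  have hmp := (measurePreserving_arrowProdEquivProdArrow (Y × (Fin m → ℝ)) (Y × (Fin m → ℝ))
    (Fin n) S.κ S.κ).symm
  have hcount : ∀ p : (Fin n → Y × (Fin m → ℝ)) × (Fin n → Y × (Fin m → ℝ)),
      ∑ j ∈ O, G.indicator (1 : (Y × (Fin m → ℝ)) × (Y × (Fin m → ℝ)) → ℝ) (p.1 j, p.2 j) =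
        (S.active O u v p).card := fun p => by
    rw [active, Finset.card_filter]
    push_cast
    refine Finset.sum_congr rfl fun j _ => ?_
    by_cases hj : 2 * γ ^ 2 ≤ |S.sqGap u v (p.1 j, p.2 j)|
    · rw [Set.indicator_of_mem (by exact hj), if_pos hj, Pi.one_apply]
    · rw [Set.indicator_of_notMem (by exact hj), if_neg hj]
  have hsub : {p | ((S.active O u v p).card : ℝ) < θ * O.card} ⊆
      (MeasurableEquiv.arrowProdEquivProdArrow (Y × (Fin m → ℝ)) (Y × (Fin m → ℝ)) (Fin n)).symm ⁻¹'
        {c | θ * O.card ≤ ∑ j ∈ O, Z j (c j)} := by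
    intro p hp
    rw [Set.mem_ofPred_eq] at hp
    rw [Set.mem_preimage, Set.mem_ofPred_eq]
    change θ * O.card ≤ ∑ j ∈ O, Z j (p.1 j, p.2 j)
    simp only [hZ]
    rw [Finset.sum_sub_distrib, hcount p]
    have h5 : (O.card : ℝ) * (2 * θ) ≤ ∑ j ∈ O, ((S.κ j).prod (S.κ j)).real G := by
      rw [← nsmul_eq_mul]
      exact Finset.card_nsmul_le_sum _ _ _ fun j _ => hGp j
    linarith
  have hms : MeasurableSet {c : Fin n → (Y × (Fin m → ℝ)) × (Y × (Fin m → ℝ)) |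
      θ * O.card ≤ ∑ j ∈ O, Z j (c j)} :=
    measurableSet_le measurable_const
      (Finset.measurable_fun_sum O fun j _ => (hZm j).comp (measurable_pi_apply j))
  have h6 := hmp.measure_preimage hms.nullMeasurableSet
  refine (measure_mono hsub).trans ?_
  unfold law
  rw [h6]
  refine h.trans (ENNReal.ofReal_le_ofReal (le_of_eq ?_))
  norm_num

/-! ### Anticoncentration of the sample variance -/

/-- The columns `C` with the noise of row `v` replaced by `s`. -/
def replaceRow (v : Fin m) (C : Fin n → Y × (Fin m → ℝ)) (s : Fin n → ℝ) :
    Fin n → Y × (Fin m → ℝ) := fun j => ((C j).1, Function.update (C j).2 v (s j))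

open Classical in
/-- The noise of row `v` taken from the second sample in the columns of `b`. -/
noncomputable def mixRow (v : Fin m) (b : Finset (Fin n))
    (p : (Fin n → Y × (Fin m → ℝ)) × (Fin n → Y × (Fin m → ℝ))) : Fin n → Y × (Fin m → ℝ) :=
  replaceRow v p.1 fun j => if j ∈ b then (p.2 j).2 v else (p.1 j).2 v

theorem measurePreserving_mixRow (v : Fin m) (b : Finset (Fin n)) :
    MeasurePreserving (mixRow v b) (S.law.prod S.law) S.law := by
  classical
  set f : Fin n → (Y × (Fin m → ℝ)) × (Y × (Fin m → ℝ)) → Y × (Fin m → ℝ) := fun j p =>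
    (p.1.1, Function.update p.1.2 v (if j ∈ b then p.2.2 v else p.1.2 v)) with hf
  have hfp : ∀ j, MeasurePreserving (f j) ((S.κ j).prod (S.κ j)) (S.κ j) := fun j => by
    by_cases hj : j ∈ b
    · have e : f j = fun p => (p.1.1, Function.update p.1.2 v (p.2.2 v)) := by
        funext p; simp [hf, hj]
      rw [e]
      have hm := measurable_update_snd (Y := Y) v
      refine ⟨hm, ?_⟩
      ext A hA
      rw [Measure.map_apply hm hA, ← lintegral_indicator_one (hm hA), ← lintegral_indicator_one hA,
        lintegral_prod _ ((measurable_one.indicator (hm hA)).aemeasurable),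
        S.lintegral_resample v j (measurable_one.indicator hA)]
      refine lintegral_congr fun c => ?_
      have hev : MeasurePreserving (fun c : Y × (Fin m → ℝ) => c.2 v) (S.κ j) (S.ν v j) :=
        (measurePreserving_eval (fun v => S.ν v j) v).comp measurePreserving_snd
      have hm3 : Measurable fun t =>
          A.indicator (1 : Y × (Fin m → ℝ) → ℝ≥0∞) (c.1, Function.update c.2 v t) :=
        (measurable_one.indicator hA).comp (measurable_const.prodMk (measurable_update c.2))
      exact hev.lintegral_comp hm3
    · have e : f j = Prod.fst := by
        funext p; simp [hf, hj]
      rw [e]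
      exact measurePreserving_fst
  exact measurePreserving_pi_prod S.κ hfp

theorem diff_mixRow (u v : Fin m) (b : Finset (Fin n))
    (p : (Fin n → Y × (Fin m → ℝ)) × (Fin n → Y × (Fin m → ℝ))) (j : Fin n) :
    S.diff u v (mixRow v b p j) = if j ∈ b then
      S.diff u v ((p.1 j).1, Function.update (p.1 j).2 v ((p.2 j).2 v)) else S.diff u v (p.1 j) := by
  by_cases h : j ∈ b
  · simp [mixRow, replaceRow, h]
  · simp [mixRow, replaceRow, h]

/-- If along every resampling of the noise of row `v` the event `W` keeps the sum of squared
deviations in a window, and `Bl` contains all outcomes below the window, then `W` is much less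
likely than `Bl`. -/
theorem law_window_le {O : Finset (Fin n)} {u v : Fin m} (huv : u ≠ v) (hB : 0 < Δ + 2 * Be)
    {W Bl : Set (Fin n → Y × (Fin m → ℝ))} (hW : MeasurableSet W) (hBl : MeasurableSet Bl)
    {L : ℕ} (h : ∀ C, (∀ s, replaceRow v C s ∉ W) ∨ ∃ τ : ℝ, ∀ s,
      (replaceRow v C s ∈ W → τ ≤ ssd O (fun j => S.diff u v (replaceRow v C s j)) ∧
        ssd O (fun j => S.diff u v (replaceRow v C s j)) < τ + L * γ ^ 2) ∧
      (ssd O (fun j => S.diff u v (replaceRow v C s j)) < τ → replaceRow v C s ∈ Bl))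
    {a r : ℕ} (ha : 0 < a) (haO : (a : ℝ) ≤ γ ^ 4 / (8 * (Δ + 2 * Be) ^ 4) * O.card)
    {ε : ℝ} (hε : 0 ≤ ε) (hε1 : ε ≤ 1) (hr : 2 ≤ r) (hεr : ε * r ≤ 1 / 2)
    (hra : (r : ℝ) ≤ a * ε / 8) :
    S.law W ≤ ENNReal.ofReal (2 ^ L * (2 / r)) * S.law Bl +
      ENNReal.ofReal (L * 2 ^ L * Real.exp (-(a * ε ^ 2 / 32)) +
        Real.exp (-((γ ^ 4 / (8 * (Δ + 2 * Be) ^ 4)) ^ 2 * O.card / 2)) +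
        2 * Real.exp (-((γ ^ 2 / (6 * (Δ + 2 * Be))) ^ 2 * O.card / (8 * (Δ + 2 * Be) ^ 2)))) := by
  classical
  set B := Δ + 2 * Be with hBdef
  set θ := γ ^ 4 / (8 * B ^ 4) with hθ
  set d := γ ^ 2 / (6 * B) with hd
  have haR : (0 : ℝ) < a := by exact_mod_cast ha
  have hOc : (0 : ℝ) < O.card := by
    by_contra! hneg
    have h0 : (O.card : ℝ) = 0 := le_antisymm hneg (Nat.cast_nonneg _)
    rw [h0, mul_zero] at haO
    linarith
  have hO : O.Nonempty := Finset.card_pos.1 (by exact_mod_cast hOc)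
  obtain ⟨j₀, hj₀⟩ := hO
  have hγB : γ ^ 2 ≤ B ^ 2 := by
    have hBe := S.Be_nonneg
    have hΔ := S.Δ_nonneg
    have : γ ^ 2 ≤ Be ^ 2 := by
      rw [← S.integral_E_sq v j₀]
      calc ∫ x, S.E x ^ 2 ∂(S.ν v j₀) ≤ ∫ x, Be ^ 2 ∂(S.ν v j₀) := by
            refine integral_mono (S.integrable_E_sq v j₀) (integrable_const _) fun x => ?_
            rw [← sq_abs]
            exact pow_le_pow_left₀ (abs_nonneg _) (S.abs_E_le x) 2
        _ = Be ^ 2 := by simp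
    nlinarith
  set few : Set ((Fin n → Y × (Fin m → ℝ)) × (Fin n → Y × (Fin m → ℝ))) :=
    {p | ((S.active O u v p).card : ℝ) < θ * O.card} with hfew
  set bad : Set (Fin n → Y × (Fin m → ℝ)) :=
    {C | d ≤ |avg O (fun j => S.diff u v (C j)) - S.meanDiff u v|} with hbad
  have hfewm : MeasurableSet few := by
    have : Measurable fun p : (Fin n → Y × (Fin m → ℝ)) × (Fin n → Y × (Fin m → ℝ)) =>
        ((S.active O u v p).card : ℝ) := by
      simp only [active, Finset.card_filter]
      push_cast
      refine Finset.measurable_fun_sum O fun j _ => Measurable.ite ?_ measurable_const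
        measurable_const
      exact measurableSet_le measurable_const ((S.measurable_sqGap u v).comp
        (((measurable_pi_apply j).comp measurable_fst).prodMk
          ((measurable_pi_apply j).comp measurable_snd))).abs
    exact measurableSet_lt this measurable_const
  have hbadm : MeasurableSet bad :=
    measurableSet_le measurable_const ((S.measurable_avg_diff O u v).sub_const _).abs
  have hpt : ∀ p : (Fin n → Y × (Fin m → ℝ)) × (Fin n → Y × (Fin m → ℝ)),
      ∑ b : Finset (Fin n), W.indicator (1 : (Fin n → Y × (Fin m → ℝ)) → ℝ≥0∞) (mixRow v b p) ≤
      ENNReal.ofReal (2 ^ L * (2 / r)) *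
        ∑ b : Finset (Fin n), Bl.indicator (1 : (Fin n → Y × (Fin m → ℝ)) → ℝ≥0∞) (mixRow v b p) +
      ENNReal.ofReal (2 ^ n * (L * 2 ^ L * Real.exp (-(a * ε ^ 2 / 32)))) +
      ENNReal.ofReal (2 ^ n) * few.indicator 1 p +
      ∑ b : Finset (Fin n), bad.indicator (1 : (Fin n → Y × (Fin m → ℝ)) → ℝ≥0∞) (mixRow v b p) := by
    intro p
    have hsumcard : ∀ X : Set (Fin n → Y × (Fin m → ℝ)),
        ∑ b : Finset (Fin n), X.indicator (1 : (Fin n → Y × (Fin m → ℝ)) → ℝ≥0∞) (mixRow v b p) =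
        ENNReal.ofReal ((Finset.univ.filter fun b : Finset (Fin n) => mixRow v b p ∈ X).card : ℝ) :=
      fun X => by
        rw [ENNReal.ofReal_natCast, Finset.card_filter]
        push_cast
        refine Finset.sum_congr rfl fun b _ => ?_
        by_cases hb : mixRow v b p ∈ X
        · rw [Set.indicator_of_mem hb, if_pos hb, Pi.one_apply]
        · rw [Set.indicator_of_notMem hb, if_neg hb]
    have h2n : ((Finset.univ : Finset (Finset (Fin n))).card : ℝ) = 2 ^ n := by
      simp
    by_cases hf : p ∈ few
    · rw [hsumcard W, Set.indicator_of_mem hf, Pi.one_apply, mul_one]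
      refine le_add_right (le_add_left (ENNReal.ofReal_le_ofReal ?_))
      rw [← h2n]
      exact_mod_cast Finset.card_le_card (Finset.filter_subset _ _)
    rcases h p.1 with hno | ⟨τ, hτ⟩
    · rw [hsumcard W]
      have : (Finset.univ.filter fun b : Finset (Fin n) => mixRow v b p ∈ W) = ∅ :=
        Finset.filter_eq_empty_iff.2 fun b _ => hno _
      rw [this]
      simp
    have hcard : (a : ℝ) ≤ (S.active O u v p).card := haO.trans (not_lt.1 hf)
    obtain ⟨A, hAsub, hAcard⟩ := Finset.exists_subset_card_eq
      (s := S.active O u v p) (n := a) (by exact_mod_cast hcard)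
    have hAO : A ⊆ O := hAsub.trans (Finset.filter_subset _ _)
    set pv : Fin n → ℝ := fun j => S.diff u v (p.1 j) with hpv
    set qv : Fin n → ℝ := fun j =>
      S.diff u v ((p.1 j).1, Function.update (p.1 j).2 v ((p.2 j).2 v)) with hqv
    have hconf : ∀ b, (fun j => S.diff u v (mixRow v b p j)) =
        fun j => if j ∈ b then qv j else pv j := fun b => by
      funext j
      exact S.diff_mixRow u v b p j
    have hmain := card_swap_window_le hAO (Finset.card_pos.1 (hAcard ▸ ha)) (p := pv) (q := qv)
      (μ := S.meanDiff u v) (K := B) (δ := γ ^ 2) (d := d) (fun j hj => ?_) (fun j hj => ?_)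
      ?_ ?_ (by positivity) hε hε1 hr hεr (by rw [hAcard]; exact hra) τ L
    · simp only [← hconf] at hmain
      have hle : ((Finset.univ.filter fun b : Finset (Fin n) => mixRow v b p ∈ W).card : ℝ) ≤
          ((Finset.univ.filter fun b : Finset (Fin n) =>
            |avg O (fun j => S.diff u v (mixRow v b p j)) - S.meanDiff u v| ≤ d ∧
            τ ≤ ssd O (fun j => S.diff u v (mixRow v b p j)) ∧
            ssd O (fun j => S.diff u v (mixRow v b p j)) < τ + L * γ ^ 2).card : ℝ) +
          ((Finset.univ.filter fun b : Finset (Fin n) => mixRow v b p ∈ bad).card : ℝ) := by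
        norm_cast
        refine le_trans (Finset.card_le_card fun b hb => ?_) (Finset.card_union_le _ _)
        rw [Finset.mem_filter] at hb
        rw [Finset.mem_union, Finset.mem_filter, Finset.mem_filter]
        by_cases hg : mixRow v b p ∈ bad
        · exact Or.inr ⟨Finset.mem_univ _, hg⟩
        · exact Or.inl ⟨Finset.mem_univ _, (not_le.1 hg).le, (hτ _).1 hb.2⟩
      have hle2 : ((Finset.univ.filter fun b : Finset (Fin n) =>
            ssd O (fun j => S.diff u v (mixRow v b p j)) < τ).card : ℝ) ≤
          ((Finset.univ.filter fun b : Finset (Fin n) => mixRow v b p ∈ Bl).card : ℝ) := by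
        norm_cast
        refine Finset.card_le_card fun b hb => ?_
        rw [Finset.mem_filter] at hb ⊢
        exact ⟨hb.1, (hτ _).2 hb.2⟩
      rw [hsumcard W, hsumcard Bl, hsumcard bad, Set.indicator_of_notMem hf, mul_zero, add_zero,
        ← ENNReal.ofReal_mul (by positivity), ← ENNReal.ofReal_add (by positivity) (by positivity),
        ← ENNReal.ofReal_add (by positivity) (by positivity)]
      refine ENNReal.ofReal_le_ofReal ?_
      rw [Fintype.card_fin, hAcard] at hmain
      have h5 : 2 ^ L * (2 / (r : ℝ)) * ((Finset.univ.filter fun b : Finset (Fin n) =>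
            ssd O (fun j => S.diff u v (mixRow v b p j)) < τ).card : ℝ) ≤ 2 ^ L * (2 / (r : ℝ)) *
          ((Finset.univ.filter fun b : Finset (Fin n) => mixRow v b p ∈ Bl).card : ℝ) :=
        mul_le_mul_of_nonneg_left hle2 (by positivity)
      have e5 : (2 : ℝ) ^ n * (L * 2 ^ L * Real.exp (-(a * ε ^ 2 / 32))) =
        L * 2 ^ L * (2 ^ n * Real.exp (-(a * ε ^ 2 / 32))) := by ring
      rw [e5]
      linarith
    · exact (Finset.mem_filter.1 (hAsub hj)).2
    · have h2 := S.abs_E_le ((p.1 j).2 v)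
      have h3 := S.abs_E_le ((p.2 j).2 v)
      have e6 : pv j - qv j = S.E ((p.2 j).2 v) - S.E ((p.1 j).2 v) := by
        simp only [hpv, hqv, diff_eq, Function.update_self, Function.update_of_ne huv]
        ring
      have hΔ := S.Δ_nonneg
      rw [e6, hBdef]
      rw [abs_le] at *
      constructor <;> linarith [h2.1, h2.2, h3.1, h3.2]
    · rw [hAcard]
      have h7 : θ * B ≤ d := by
        rw [hθ, hd, div_mul_eq_mul_div, div_le_div_iff₀ (by positivity) (by positivity)]
        have h9 : 0 ≤ γ ^ 2 * B ^ 2 := by positivity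
        have h10 : 6 * (γ ^ 2 * B ^ 2) * γ ^ 2 ≤ 6 * (γ ^ 2 * B ^ 2) * B ^ 2 :=
          mul_le_mul_of_nonneg_left hγB (by positivity)
        have h11 : 0 ≤ γ ^ 2 * B ^ 4 := by positivity
        nlinarith
      calc (a : ℝ) * B ≤ θ * O.card * B := mul_le_mul_of_nonneg_right haO hB.le
        _ = θ * B * O.card := by ring
        _ ≤ d * O.card := mul_le_mul_of_nonneg_right h7 hOc.le
    · rw [hd]
      apply le_of_eq
      field_simp
  have hmp := fun b => S.measurePreserving_mixRow v b
  have hint : ∀ X : Set (Fin n → Y × (Fin m → ℝ)), MeasurableSet X →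
      ∫⁻ p, ∑ b : Finset (Fin n), X.indicator (1 : (Fin n → Y × (Fin m → ℝ)) → ℝ≥0∞)
        (mixRow v b p) ∂(S.law.prod S.law) =
      ENNReal.ofReal (2 ^ n) * S.law X := fun X hX => by
    rw [lintegral_finsetSum]
    · rw [Finset.sum_congr rfl fun b _ => by
        rw [(hmp b).lintegral_comp (measurable_one.indicator hX), lintegral_indicator_one hX]]
      rw [Finset.sum_const, nsmul_eq_mul]
      congr 1
      rw [Finset.card_univ, Fintype.card_finset, Fintype.card_fin, ENNReal.ofReal_pow (by norm_num)]
      push_cast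
      norm_num
    · exact fun b _ => (measurable_one.indicator hX).comp (hmp b).measurable
  have hmW : ∀ X : Set (Fin n → Y × (Fin m → ℝ)), MeasurableSet X → Measurable
      fun p => ∑ b : Finset (Fin n), X.indicator (1 : (Fin n → Y × (Fin m → ℝ)) → ℝ≥0∞)
        (mixRow v b p) := fun X hX =>
    Finset.measurable_fun_sum _ fun b _ => (measurable_one.indicator hX).comp (hmp b).measurable
  have hI := lintegral_mono (μ := S.law.prod S.law) hpt
  rw [hint W hW, lintegral_add_right _ (hmW bad hbadm), hint bad hbadm,
    lintegral_add_right _ ((measurable_one.indicator hfewm).const_mul _),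
    lintegral_const_mul _ (measurable_one.indicator hfewm), lintegral_indicator_one hfewm,
    lintegral_add_right _ measurable_const, lintegral_const_mul _ (hmW Bl hBl), hint Bl hBl,
    lintegral_const, measure_univ, mul_one,
    ENNReal.ofReal_mul (show (0 : ℝ) ≤ 2 ^ n by positivity)] at hI
  have hne : ENNReal.ofReal ((2 : ℝ) ^ n) ≠ 0 := by
    rw [Ne, ENNReal.ofReal_eq_zero]; push Not; positivity
  have hfin : ENNReal.ofReal (2 ^ n) * S.law W ≤ ENNReal.ofReal (2 ^ n) *
      (ENNReal.ofReal (2 ^ L * (2 / r)) * S.law Bl +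
        ENNReal.ofReal (L * 2 ^ L * Real.exp (-(a * ε ^ 2 / 32))) +
        (S.law.prod S.law) few + S.law bad) := by
    refine hI.trans (le_of_eq ?_)
    ring
  have hfin2 := (ENNReal.mul_le_mul_iff_right hne ENNReal.ofReal_ne_top).1 hfin
  refine hfin2.trans ?_
  rw [add_assoc, add_assoc]
  refine add_le_add_right ?_ _
  rw [ENNReal.ofReal_add (by positivity) (by positivity),
    ENNReal.ofReal_add (by positivity) (by positivity), add_assoc]
  refine add_le_add_right (add_le_add ?_ ?_) _
  · exact S.law_active_le ⟨j₀, hj₀⟩ huv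
  · exact S.law_avg_le ⟨j₀, hj₀⟩ hB u v (by positivity)

end ColumnModel

/-! ### Leaving out one column -/

section LeaveOneOut

variable {α : Type*}

theorem abs_avg_le {O : Finset α} {z : α → ℝ} {K : ℝ} (hK : 0 ≤ K) (h : ∀ j ∈ O, |z j| ≤ K) :
    |avg O z| ≤ K := by
  unfold avg
  rcases O.eq_empty_or_nonempty with rfl | hO
  · simpa using hK
  have hc : (0 : ℝ) < O.card := by exact_mod_cast hO.card_pos
  rw [abs_div, abs_of_pos hc, div_le_iff₀ hc]
  calc |∑ j ∈ O, z j| ≤ ∑ j ∈ O, |z j| := Finset.abs_sum_le_sum_abs _ _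
    _ ≤ O.card • K := Finset.sum_le_card_nsmul _ _ _ h
    _ = K * O.card := by rw [nsmul_eq_mul]; ring

theorem sq_avg_le (O : Finset α) (z : α → ℝ) : avg O z ^ 2 ≤ avg O fun j => z j ^ 2 := by
  unfold avg
  rcases O.eq_empty_or_nonempty with rfl | hO
  · simp
  have hc : (0 : ℝ) < O.card := by exact_mod_cast hO.card_pos
  rw [div_pow, div_le_div_iff₀ (by positivity) hc]
  have := sq_sum_le_card_mul_sum_sq (s := O) (f := z)
  nlinarith

theorem avg_le {O : Finset α} {z : α → ℝ} {K : ℝ} (hK : 0 ≤ K) (h : ∀ j ∈ O, z j ≤ K) :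
    avg O z ≤ K := by
  unfold avg
  rcases O.eq_empty_or_nonempty with rfl | hO
  · simpa using hK
  have hc : (0 : ℝ) < O.card := by exact_mod_cast hO.card_pos
  rw [div_le_iff₀ hc, mul_comm, ← nsmul_eq_mul]
  exact Finset.sum_le_card_nsmul _ _ _ h

variable [DecidableEq α]

theorem ssd_erase_le {O : Finset α} {i : α} (hi : i ∈ O) (z : α → ℝ) :
    ssd (O.erase i) z + (z i - avg O z) ^ 2 ≤ ssd O z := by
  have h1 := ssd_le (O.erase i) z (avg O z)
  have h2 : ssd O z = (z i - avg O z) ^ 2 + ∑ j ∈ O.erase i, (z j - avg O z) ^ 2 :=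
    (Finset.add_sum_erase O (fun j => (z j - avg O z) ^ 2) hi).symm
  linarith

theorem ssd_le_erase {O : Finset α} {i : α} (hi : i ∈ O) (z : α → ℝ) :
    ssd O z ≤ ssd (O.erase i) z + (z i - avg (O.erase i) z) ^ 2 := by
  have h1 := ssd_le O z (avg (O.erase i) z)
  rw [← Finset.add_sum_erase O _ hi] at h1
  unfold ssd at h1 ⊢
  linarith

theorem abs_avg_sub_avg_erase_le {O : Finset α} {i : α} (hi : i ∈ O) {z : α → ℝ} {K : ℝ}
    (hK : 0 ≤ K) (h : ∀ j ∈ O, |z j| ≤ K) :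
    |avg O z - avg (O.erase i) z| ≤ 2 * K / O.card := by
  have hO : (0 : ℝ) < O.card := by exact_mod_cast Finset.card_pos.2 ⟨i, hi⟩
  have h1 : (O.card : ℝ) * avg O z = z i + ((O.card : ℝ) - 1) * avg (O.erase i) z := by
    rw [card_mul_avg ⟨i, hi⟩, ← Finset.add_sum_erase O z hi]
    rcases (O.erase i).eq_empty_or_nonempty with he | he
    · simp [he, avg]
    · rw [← card_mul_avg he, Finset.card_erase_of_mem hi, Nat.cast_pred (Finset.card_pos.2 ⟨i, hi⟩)]
  have h2 : (O.card : ℝ) * (avg O z - avg (O.erase i) z) = z i - avg (O.erase i) z := by linarith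
  rw [le_div_iff₀ hO, ← abs_of_pos hO, ← abs_mul, mul_comm, h2]
  have h3 := h i hi
  have h4 := abs_avg_le (O := O.erase i) hK fun j hj => h j (Finset.mem_of_mem_erase hj)
  calc |z i - avg (O.erase i) z| ≤ |z i| + |avg (O.erase i) z| := abs_sub _ _
    _ ≤ _ := by linarith

end LeaveOneOut

theorem measurableSet_mem_topk {Ω : Type*} [MeasurableSpace Ω] {m : ℕ} (c : Finset (Fin m))
    {key : Ω → Fin m → ℝ} (hkey : ∀ v, Measurable fun ω => key ω v) (σ : Equiv.Perm (Fin m)) (k : ℕ)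
    (v : Fin m) : MeasurableSet {ω | v ∈ topk c (key ω) σ k} := by
  classical
  have h1 : Measurable fun ω =>
      (c.filter fun w => key ω w < key ω v ∨ (key ω w = key ω v ∧ σ w < σ v)).card := by
    simp only [Finset.card_filter]
    refine Finset.measurable_fun_sum c fun w _ => Measurable.ite ?_ measurable_const measurable_const
    exact (measurableSet_lt (hkey w) (hkey v)).union
      ((measurableSet_eq_fun (hkey w) (hkey v)).inter (MeasurableSet.const _))
  have h2 : {ω | v ∈ topk c (key ω) σ k} = {_ω | v ∈ c} ∩
      {ω | (c.filter fun w => key ω w < key ω v ∨ (key ω w = key ω v ∧ σ w < σ v)).card < k} := by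
    ext ω
    simp only [topk, Set.mem_ofPred_eq, Finset.mem_filter, Set.mem_inter_iff]
  rw [h2]
  exact (MeasurableSet.const _).inter (measurableSet_lt h1 measurable_const)

theorem mem_candidates {m n : ℕ} {β : ℝ} {obs : Fin m → Fin n → Bool} {u v : Fin m} {i : Fin n} :
    v ∈ candidates β obs u i ↔
      v ≠ u ∧ obs v i = true ∧ β ≤ ((overlap obs u v).card : ℝ) := by
  classical
  unfold candidates
  rw [Finset.mem_filter]
  simp

theorem mem_overlap {m n : ℕ} {obs : Fin m → Fin n → Bool} {u v : Fin m} {j : Fin n} :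
    j ∈ overlap obs u v ↔ obs u j = true ∧ obs v j = true := by
  simp [overlap]

namespace ColumnModel

variable {m n : ℕ} {Y : Type u} [MeasurableSpace Y] {Δ Be γ : ℝ}
  (S : ColumnModel m n Y Δ Be γ)

/-- The noisy matrix with columns `C`. -/
def noisy (C : Fin n → Y × (Fin m → ℝ)) (v : Fin m) (j : Fin n) : ℝ := S.entry v (C j)

theorem diffMean_noisy (obs : Fin m → Fin n → Bool) (C : Fin n → Y × (Fin m → ℝ)) (u v : Fin m) :
    diffMean obs (S.noisy C) u v = avg (overlap obs u v) fun j => S.diff u v (C j) := rfl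

theorem diffVar_noisy (obs : Fin m → Fin n → Bool) (C : Fin n → Y × (Fin m → ℝ)) (u v : Fin m) :
    diffVar obs (S.noisy C) u v =
      ssd (overlap obs u v) (fun j => S.diff u v (C j)) / ((overlap obs u v).card - 1) := rfl

/-- The sample variance of the difference of rows `u` and `v` without column `i`, up to the
normalization. -/
noncomputable def looKey (obs : Fin m → Fin n → Bool) (u : Fin m) (i : Fin n)
    (C : Fin n → Y × (Fin m → ℝ)) (v : Fin m) : ℝ :=
  ssd ((overlap obs u v).erase i) (fun j => S.diff u v (C j)) / ((overlap obs u v).card - 1)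

variable (obs : Fin m → Fin n → Bool) (u : Fin m) (i : Fin n)

theorem measurable_looKey (v : Fin m) : Measurable fun C => S.looKey obs u i C v :=
  (S.measurable_ssd_diff _ u v).div_const _

theorem measurable_diffVar_noisy (v : Fin m) :
    Measurable fun C => diffVar obs (S.noisy C) u v :=
  (S.measurable_ssd_diff _ u v).div_const _

theorem looKey_le {C : Fin n → Y × (Fin m → ℝ)} {v : Fin m} (h1 : 1 < (overlap obs u v).card) :
    S.looKey obs u i C v ≤ diffVar obs (S.noisy C) u v := by
  have h2 : (0 : ℝ) < (overlap obs u v).card - 1 := by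
    have : (1 : ℝ) < (overlap obs u v).card := by exact_mod_cast h1
    linarith
  rw [diffVar_noisy, looKey, div_le_div_iff_of_pos_right h2]
  by_cases hi : i ∈ overlap obs u v
  · have := ssd_erase_le hi fun j => S.diff u v (C j)
    nlinarith [sq_nonneg (S.diff u v (C i) - avg (overlap obs u v) fun j => S.diff u v (C j))]
  · rw [Finset.erase_eq_of_notMem hi]

theorem sq_le_diffVar_sub {C : Fin n → Y × (Fin m → ℝ)} {v : Fin m}
    (h1 : 1 < (overlap obs u v).card) (hi : i ∈ overlap obs u v) :
    (S.diff u v (C i) - diffMean obs (S.noisy C) u v) ^ 2 ≤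
      ((overlap obs u v).card - 1) * (diffVar obs (S.noisy C) u v - S.looKey obs u i C v) := by
  have h2 : (0 : ℝ) < (overlap obs u v).card - 1 := by
    have : (1 : ℝ) < (overlap obs u v).card := by exact_mod_cast h1
    linarith
  rw [diffVar_noisy, looKey, mul_sub, mul_div_cancel₀ _ h2.ne', mul_div_cancel₀ _ h2.ne',
    diffMean_noisy]
  have := ssd_erase_le hi fun j => S.diff u v (C j)
  linarith

theorem diffVar_sub_le_sq {C : Fin n → Y × (Fin m → ℝ)} {v : Fin m}
    (h1 : 1 < (overlap obs u v).card) (hi : i ∈ overlap obs u v) :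
    diffVar obs (S.noisy C) u v - S.looKey obs u i C v ≤
      (S.diff u v (C i) - avg ((overlap obs u v).erase i) fun j => S.diff u v (C j)) ^ 2 /
      ((overlap obs u v).card - 1) := by
  have h2 : (0 : ℝ) < (overlap obs u v).card - 1 := by
    have : (1 : ℝ) < (overlap obs u v).card := by exact_mod_cast h1
    linarith
  rw [diffVar_noisy, looKey, ← sub_div, div_le_div_iff_of_pos_right h2]
  have := ssd_le_erase hi fun j => S.diff u v (C j)
  linarith

theorem diffVar_le_add {C : Fin n → Y × (Fin m → ℝ)} {v : Fin m}
    (h1 : 1 < (overlap obs u v).card) :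
    diffVar obs (S.noisy C) u v ≤
      S.looKey obs u i C v + 4 * (Δ + 2 * Be) ^ 2 / ((overlap obs u v).card - 1) := by
  have h2 : (0 : ℝ) < (overlap obs u v).card - 1 := by
    have : (1 : ℝ) < (overlap obs u v).card := by exact_mod_cast h1
    linarith
  have hB : 0 ≤ Δ + 2 * Be := by linarith [S.Δ_nonneg, S.Be_nonneg]
  by_cases hi : i ∈ overlap obs u v
  · have h3 := S.diffVar_sub_le_sq obs u i (C := C) h1 hi
    refine le_trans (by linarith : _ ≤ S.looKey obs u i C v + _) (add_le_add_right
      (h3.trans ((div_le_div_iff_of_pos_right h2).2 ?_)) _)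
    rw [← sq_abs]
    have h4 : |S.diff u v (C i) - avg ((overlap obs u v).erase i) fun j => S.diff u v (C j)| ≤
        2 * (Δ + 2 * Be) := by
      refine (abs_sub _ _).trans ?_
      have h5 := S.abs_diff_le u v (C i)
      have h6 := abs_avg_le (O := (overlap obs u v).erase i) hB fun j _ => S.abs_diff_le u v (C j)
      linarith
    calc _ ≤ (2 * (Δ + 2 * Be)) ^ 2 := pow_le_pow_left₀ (abs_nonneg _) h4 2
      _ = _ := by ring
  · rw [diffVar_noisy, looKey, Finset.erase_eq_of_notMem hi]
    have : 0 ≤ 4 * (Δ + 2 * Be) ^ 2 / (((overlap obs u v).card : ℝ) - 1) := by positivity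
    linarith

/-- The rows that would be selected without looking at column `i`. -/
noncomputable def loo (β : ℝ) (k : ℕ) (σ : Equiv.Perm (Fin m)) (C : Fin n → Y × (Fin m → ℝ)) :
    Finset (Fin m) :=
  topk (candidates β obs u i) (S.looKey obs u i C) σ k

theorem measurableSet_mem_loo (β : ℝ) (k : ℕ) (σ : Equiv.Perm (Fin m)) (v : Fin m) :
    MeasurableSet {C | v ∈ S.loo obs u i β k σ C} :=
  measurableSet_mem_topk _ (S.measurable_looKey obs u i) σ k v

theorem measurableSet_mem_nearest (β : ℝ) (k : ℕ) (σ : Equiv.Perm (Fin m)) (v : Fin m) :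
    MeasurableSet {C | v ∈ nearest β k obs (S.noisy C) σ u i} := by
  simp only [nearest_eq_topk]
  exact measurableSet_mem_topk _ (S.measurable_diffVar_noisy obs u) σ k v

theorem card_loo_eq (β : ℝ) (k : ℕ) (σ : Equiv.Perm (Fin m)) (C : Fin n → Y × (Fin m → ℝ)) :
    (S.loo obs u i β k σ C).card = (nearest β k obs (S.noisy C) σ u i).card := by
  rw [nearest_eq_topk, loo, card_topk, card_topk]

theorem loo_eq_nearest_of_not_obs (β : ℝ) (k : ℕ) (σ : Equiv.Perm (Fin m))
    (C : Fin n → Y × (Fin m → ℝ)) (h : obs u i = false) :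
    S.loo obs u i β k σ C = nearest β k obs (S.noisy C) σ u i := by
  rw [nearest_eq_topk, loo]
  refine topk_congr fun v _ => ?_
  rw [diffVar_noisy, looKey, Finset.erase_eq_of_notMem]
  simp [mem_overlap, h]

theorem looKey_replaceRow {v w : Fin m} (hu : u ≠ v) (hw : w ≠ v) (C : Fin n → Y × (Fin m → ℝ))
    (s : Fin n → ℝ) : S.looKey obs u i (replaceRow v C s) w = S.looKey obs u i C w := by
  have : ∀ j, S.diff u w (replaceRow v C s j) = S.diff u w (C j) := fun j => by
    simp [diff, entry, replaceRow, hu, hw]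
  simp only [looKey, this]

theorem looKey_update (C : Fin n → Y × (Fin m → ℝ)) (c : Y × (Fin m → ℝ)) (v : Fin m) :
    S.looKey obs u i (Function.update C i c) v = S.looKey obs u i C v := by
  have h1 : ∀ j ∈ (overlap obs u v).erase i, S.diff u v (Function.update C i c j) =
      S.diff u v (C j) := fun j hj => by
    rw [Function.update_of_ne (Finset.ne_of_mem_erase hj)]
  have h2 : avg ((overlap obs u v).erase i) (fun j => S.diff u v (Function.update C i c j)) =
      avg ((overlap obs u v).erase i) (fun j => S.diff u v (C j)) := by
    unfold avg
    rw [Finset.sum_congr rfl h1]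
  simp only [looKey, ssd, h2]
  congr 1
  exact Finset.sum_congr rfl fun j hj => by rw [h1 j hj]

theorem loo_update (β : ℝ) (k : ℕ) (σ : Equiv.Perm (Fin m)) (C : Fin n → Y × (Fin m → ℝ))
    (c : Y × (Fin m → ℝ)) : S.loo obs u i β k σ (Function.update C i c) = S.loo obs u i β k σ C :=
  topk_congr fun v _ => S.looKey_update obs u i C c v

/-- The probability that column `i` makes row `v` one of the nearest. -/
theorem law_mem_nearest_sdiff_le {β : ℝ} {k : ℕ} {σ : Equiv.Perm (Fin m)} (hB : 0 < Δ + 2 * Be)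
    (hk : 0 < k) {e : ℝ} (he : 0 < e)
    (hcard : ∀ w ∈ candidates β obs u i, 1 < (overlap obs u w).card ∧
      4 * (Δ + 2 * Be) ^ 2 / (((overlap obs u w).card : ℝ) - 1) ≤ e)
    {v : Fin m} (hv : v ∈ candidates β obs u i) {L : ℕ}
    (hL : 2 * e * (((overlap obs u v).card : ℝ) - 1) ≤ L * γ ^ 2)
    {a r : ℕ} (ha : 0 < a)
    (haO : (a : ℝ) ≤ γ ^ 4 / (8 * (Δ + 2 * Be) ^ 4) * ((overlap obs u v).erase i).card)
    {ε : ℝ} (hε : 0 ≤ ε) (hε1 : ε ≤ 1) (hr : 2 ≤ r) (hεr : ε * r ≤ 1 / 2)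
    (hra : (r : ℝ) ≤ a * ε / 8) :
    S.law {C | v ∈ nearest β k obs (S.noisy C) σ u i ∧ v ∉ S.loo obs u i β k σ C} ≤
      ENNReal.ofReal (2 ^ L * (2 / r)) * S.law {C | v ∈ S.loo obs u i β k σ C} +
      ENNReal.ofReal (L * 2 ^ L * Real.exp (-(a * ε ^ 2 / 32)) +
        Real.exp (-((γ ^ 4 / (8 * (Δ + 2 * Be) ^ 4)) ^ 2 * ((overlap obs u v).erase i).card / 2)) +
        2 * Real.exp (-((γ ^ 2 / (6 * (Δ + 2 * Be))) ^ 2 * ((overlap obs u v).erase i).card /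
          (8 * (Δ + 2 * Be) ^ 2)))) := by
  classical
  have huv : u ≠ v := (mem_candidates.1 hv).1.symm
  have hc1 : (0 : ℝ) < (overlap obs u v).card - 1 := by
    have : (1 : ℝ) < (overlap obs u v).card := by exact_mod_cast (hcard v hv).1
    linarith
  refine S.law_window_le huv hB
    ((S.measurableSet_mem_nearest obs u i β k σ v).inter
      (S.measurableSet_mem_loo obs u i β k σ v).compl)
    (S.measurableSet_mem_loo obs u i β k σ v) (fun C => ?_) ha haO hε hε1 hr hεr hra
  have hT : ∀ (s : Fin n → ℝ) (x : ℝ),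
      (((candidates β obs u i).erase v).filter fun w =>
        S.looKey obs u i (replaceRow v C s) w ≤ x) =
      ((candidates β obs u i).erase v).filter fun w => S.looKey obs u i C w ≤ x := fun s x =>
    Finset.filter_congr fun w hw => by
      rw [S.looKey_replaceRow obs u i huv (Finset.ne_of_mem_erase hw)]
  have hmem : ∀ s, (((candidates β obs u i).erase v).filter fun w => S.looKey obs u i C w ≤
      S.looKey obs u i (replaceRow v C s) v).card < k →
      v ∈ S.loo obs u i β k σ (replaceRow v C s) := fun s hs =>
    mem_topk_of_card_lt hv (by rw [hT]; exact hs)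
  by_cases hx : ∃ x₀, k ≤ (((candidates β obs u i).erase v).filter fun w =>
      S.looKey obs u i C w ≤ x₀).card
  · obtain ⟨x₀, hx₀⟩ := hx
    obtain ⟨κ, hκ⟩ := exists_threshold _ _ hk hx₀
    refine Or.inr ⟨κ * ((overlap obs u v).card - 1), fun s => ?_⟩
    have e1 : ssd ((overlap obs u v).erase i) (fun j => S.diff u v (replaceRow v C s j)) =
        S.looKey obs u i (replaceRow v C s) v * ((overlap obs u v).card - 1) := by
      rw [looKey, div_mul_cancel₀ _ hc1.ne']
    rw [e1]
    refine ⟨fun hs => ⟨?_, ?_⟩, fun hs => hmem s ?_⟩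
    · refine mul_le_mul_of_nonneg_right ((hκ _).1 ?_) hc1.le
      by_contra! hlt
      exact hs.2 (hmem s hlt)
    · have h2 : S.looKey obs u i (replaceRow v C s) v < κ + 2 * e := by
        by_contra! hge
        have hs1 : v ∈ nearest β k obs (S.noisy (replaceRow v C s)) σ u i := hs.1
        rw [nearest_eq_topk] at hs1
        have h3 := (hκ (S.looKey obs u i (replaceRow v C s) v - 2 * e)).2 (by linarith)
        have h4 := card_lt_of_mem_topk (key := S.looKey obs u i (replaceRow v C s)) (e := e)
          (fun w hw => S.looKey_le obs u i (hcard w hw).1)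
          (fun w hw => (S.diffVar_le_add obs u i (hcard w hw).1).trans
            (add_le_add_right (hcard w hw).2 _)) hs1
        refine absurd h4 (not_lt.2 (h3.trans (Finset.card_le_card fun w hw => ?_)))
        rw [Finset.mem_filter] at hw ⊢
        refine ⟨hw.1, ?_⟩
        rw [S.looKey_replaceRow obs u i huv (Finset.ne_of_mem_erase hw.1)]
        linarith [hw.2]
      calc _ < (κ + 2 * e) * ((overlap obs u v).card - 1) := mul_lt_mul_of_pos_right h2 hc1
        _ ≤ _ := by linarith
    · by_contra! hge
      have := mul_le_mul_of_nonneg_right ((hκ _).1 hge) hc1.le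
      linarith
  · push Not at hx
    exact Or.inl fun s hs => hs.2 (hmem s (hx _))

end ColumnModel

theorem lintegral_card_eq_sum {Ω : Type*} [MeasurableSpace Ω] {m : ℕ} (P : Measure Ω)
    (T : Ω → Finset (Fin m)) (hT : ∀ v, MeasurableSet {ω | v ∈ T ω}) :
    ∫⁻ ω, ((T ω).card : ℝ≥0∞) ∂P = ∑ v, P {ω | v ∈ T ω} := by
  classical
  have h : ∀ ω, ((T ω).card : ℝ≥0∞) =
      ∑ v, {ω | v ∈ T ω}.indicator (fun _ => (1 : ℝ≥0∞)) ω := fun ω => by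
    simp [Set.indicator_apply]
  simp only [h]
  rw [lintegral_finsetSum _ fun v _ => measurable_const.indicator (hT v)]
  refine Finset.sum_congr rfl fun v _ => ?_
  rw [lintegral_indicator (hT v)]
  simp

theorem exists_window_parameters {θ B d : ℝ} (hθ0 : 0 < θ) (hB : 0 < B) (hd0 : 0 < d) :
    ∃ x₀ ϑ : ℝ, 2 ≤ x₀ ∧ 0 < ϑ ∧ ∀ x, x₀ ≤ x → ∃ (a r : ℕ) (ε : ℝ), 0 < a ∧ 2 ≤ r ∧ 0 ≤ ε ∧
      ε ≤ 1 ∧ ε * r ≤ 1 / 2 ∧ (r : ℝ) ≤ a * ε / 8 ∧ (a : ℝ) ≤ θ * (x ^ 3 / 4) ∧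
      2 / (r : ℝ) ≤ 8 * ϑ / x ∧ 2 * x ≤ a * ε ^ 2 / 32 ∧ ∀ q, x ^ 3 / 4 ≤ q →
        2 * x ≤ θ ^ 2 * q / 2 ∧ 2 * x ≤ d ^ 2 * q / (8 * B ^ 2) := by
  set ϑ := Real.sqrt (768 / θ) with hϑ
  have hϑ0 : 0 < ϑ := Real.sqrt_pos.2 (by positivity)
  have hϑ2 : θ * ϑ ^ 2 = 768 := by
    rw [hϑ, Real.sq_sqrt (by positivity)]; field_simp
  have p1 : 0 < 8 / θ := by positivity
  have p2 : 0 < 16 / θ ^ 2 := by positivity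
  have p3 : 0 < 64 * B ^ 2 / d ^ 2 := by positivity
  refine ⟨4 * ϑ + 2 + 8 / θ + 16 / θ ^ 2 + 64 * B ^ 2 / d ^ 2, ϑ, by linarith, hϑ0,
    fun x hx => ?_⟩
  have hx2 : 2 ≤ x := by linarith
  have hx0 : 0 < x := by linarith
  have hxϑ : 4 * ϑ ≤ x := by linarith
  have hxx : x ≤ x ^ 2 := by nlinarith
  have hxx3 : x ^ 2 ≤ x ^ 3 := by nlinarith [sq_nonneg x]
  have hx8 : 8 ≤ x ^ 3 := by nlinarith
  have hxθ : 8 ≤ θ * x ^ 3 := by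
    have : 8 / θ ≤ x ^ 3 := by linarith
    rw [div_le_iff₀ hθ0] at this; linarith
  have hxθ2 : 16 ≤ θ ^ 2 * x ^ 2 := by
    have : 16 / θ ^ 2 ≤ x ^ 2 := by linarith
    rw [div_le_iff₀ (by positivity)] at this; linarith
  have hxd2 : 64 * B ^ 2 ≤ d ^ 2 * x ^ 2 := by
    have : 64 * B ^ 2 / d ^ 2 ≤ x ^ 2 := by linarith
    rw [div_le_iff₀ (by positivity)] at this; linarith
  set a := ⌊θ * x ^ 3 / 4⌋₊ with ha
  have ha1 : (a : ℝ) ≤ θ * x ^ 3 / 4 := Nat.floor_le (by positivity)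
  have ha2 : θ * x ^ 3 / 8 ≤ a := by
    have := Nat.lt_floor_add_one (θ * x ^ 3 / 4)
    rw [← ha] at this
    linarith
  have ha0 : 0 < a := by
    have : (0 : ℝ) < a := by linarith
    exact_mod_cast this
  set r := ⌊x / (2 * ϑ)⌋₊ with hr
  have hr1 : (r : ℝ) ≤ x / (2 * ϑ) := Nat.floor_le (by positivity)
  have hxr : 2 ≤ x / (2 * ϑ) := by rw [le_div_iff₀ (by positivity)]; linarith
  have hr2 : 2 ≤ r := Nat.le_floor (by exact_mod_cast hxr)
  have hr3 : x / (4 * ϑ) ≤ r := by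
    have := Nat.lt_floor_add_one (x / (2 * ϑ))
    rw [← hr] at this
    have e : x / (2 * ϑ) = 2 * (x / (4 * ϑ)) := by field_simp; ring
    rw [e] at this hxr
    linarith
  have hr0 : (0 : ℝ) < r := by positivity
  have hε : ϑ / x ≤ 1 := by rw [div_le_one hx0]; linarith
  have hεr : ϑ / x * r ≤ 1 / 2 := by
    calc ϑ / x * r ≤ ϑ / x * (x / (2 * ϑ)) := mul_le_mul_of_nonneg_left hr1 (by positivity)
      _ = 1 / 2 := by field_simp
  have hra : (r : ℝ) ≤ a * (ϑ / x) / 8 := by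
    calc (r : ℝ) ≤ x / (2 * ϑ) := hr1
      _ ≤ (θ * x ^ 3 / 8) * (ϑ / x) / 8 := by
        have e : (θ * x ^ 3 / 8) * (ϑ / x) / 8 = θ * ϑ ^ 2 * x ^ 2 / (64 * ϑ) := by
          field_simp; norm_num
        rw [e, hϑ2, div_le_div_iff₀ (by positivity) (by positivity)]
        have : ϑ * x ≤ ϑ * x ^ 2 := mul_le_mul_of_nonneg_left hxx hϑ0.le
        nlinarith
      _ ≤ _ := by gcongr
  refine ⟨a, r, ϑ / x, ha0, hr2, by positivity, hε, hεr, hra, by linarith, ?_, ?_, fun q hq =>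
    ⟨?_, ?_⟩⟩
  · rw [div_le_div_iff₀ hr0 hx0]
    rw [div_le_iff₀ (by positivity)] at hr3
    linarith
  · calc 2 * x ≤ (θ * x ^ 3 / 8) * (ϑ / x) ^ 2 / 32 := by
          have e : (θ * x ^ 3 / 8) * (ϑ / x) ^ 2 / 32 = θ * ϑ ^ 2 * x / 256 := by
            field_simp; norm_num
          rw [e, hϑ2]; linarith
      _ ≤ _ := by gcongr
  · calc 2 * x ≤ θ ^ 2 * (x ^ 3 / 4) / 2 := by
          have := mul_le_mul_of_nonneg_right hxθ2 hx0.le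
          nlinarith
      _ ≤ _ := by gcongr
  · calc 2 * x ≤ d ^ 2 * (x ^ 3 / 4) / (8 * B ^ 2) := by
          rw [le_div_iff₀ (by positivity)]
          have := mul_le_mul_of_nonneg_right hxd2 hx0.le
          nlinarith
      _ ≤ _ := by gcongr

namespace ColumnModel

variable {m n : ℕ} {Y : Type u} [MeasurableSpace Y] {Δ Be γ : ℝ}
  (S : ColumnModel m n Y Δ Be γ)

theorem sq_le_Be_sq (S : ColumnModel m n Y Δ Be γ) (v : Fin m) (j : Fin n) : γ ^ 2 ≤ Be ^ 2 := by
  rw [← S.integral_E_sq v j]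
  calc ∫ x, S.E x ^ 2 ∂(S.ν v j) ≤ ∫ x, Be ^ 2 ∂(S.ν v j) := by
        refine integral_mono (S.integrable_E_sq v j) (integrable_const _) fun x => ?_
        rw [← sq_abs]
        exact pow_le_pow_left₀ (abs_nonneg _) (S.abs_E_le x) 2
    _ = Be ^ 2 := by simp

/-- If the noise does not vanish, then one column has little influence on the set of nearest
rows. -/
theorem exists_lintegral_card_nearest_sdiff_le (Δ Be γ : ℝ) (hγ : γ ≠ 0) :
    ∃ x₀ K : ℝ, 0 ≤ K ∧ ∀ {m n : ℕ} {Y : Type u} [MeasurableSpace Y]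
      (S : ColumnModel m n Y Δ Be γ) (obs : Fin m → Fin n → Bool) (u : Fin m) (i : Fin n) (k : ℕ)
      (σ : Equiv.Perm (Fin m)) (x : ℝ), x₀ ≤ x → 0 < k → (m : ℝ) ≤ Real.exp x →
      (∀ w ∈ candidates (x ^ 3 / 2) obs u i, ((overlap obs u w).card : ℝ) ≤ 8 * x ^ 3) →
      ∫⁻ C, ((nearest (x ^ 3 / 2) k obs (S.noisy C) σ u i \
        S.loo obs u i (x ^ 3 / 2) k σ C).card : ℝ≥0∞) ∂S.law ≤ ENNReal.ofReal (K / x * k) := by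
  set B := Δ + 2 * Be with hBdef
  by_cases hB : 0 < B
  swap
  · refine ⟨0, 0, le_rfl, fun S obs u i => ?_⟩
    exfalso
    have h1 := S.sq_le_Be_sq u i
    have h2 := S.Δ_nonneg
    have h3 : Be = 0 := by linarith [S.Be_nonneg]
    rw [h3] at h1
    have : 0 < γ ^ 2 := by positivity
    linarith
  have hθ0 : 0 < γ ^ 4 / (8 * B ^ 4) := by positivity
  have hd0 : 0 < γ ^ 2 / (6 * B) := by positivity
  obtain ⟨x₀, ϑ, hx₀, hϑ0, hpar⟩ := exists_window_parameters hθ0 hB hd0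
  set L := ⌈256 * B ^ 2 / γ ^ 2⌉₊ with hL
  refine ⟨x₀, 2 ^ L * (8 * ϑ) + (L * 2 ^ L + 3), by positivity, ?_⟩
  intro m n Y _ S obs u i k σ x hx hk hm hO
  classical
  have hx2 : 2 ≤ x := by linarith
  have hx0 : 0 < x := by linarith
  have hx8 : 8 ≤ x ^ 3 := by nlinarith [sq_nonneg x]
  obtain ⟨a, r, ε, ha0, hr2, hε0, hε, hεr, hra, ha1, hr3, hε2, htail⟩ := hpar x hx
  have hr0 : (0 : ℝ) < r := by positivity
  have hcard : ∀ w ∈ candidates (x ^ 3 / 2) obs u i, x ^ 3 / 4 ≤ ((overlap obs u w).card : ℝ) - 1 :=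
    fun w hw => by
      have := (mem_candidates.1 hw).2.2
      linarith
  set tiny := (L * 2 ^ L + 3) * Real.exp (-(2 * x)) with htiny
  have key : ∀ v, S.law {C | v ∈ nearest (x ^ 3 / 2) k obs (S.noisy C) σ u i \
      S.loo obs u i (x ^ 3 / 2) k σ C} ≤
      ENNReal.ofReal (2 ^ L * (2 / r)) * S.law {C | v ∈ S.loo obs u i (x ^ 3 / 2) k σ C} +
      ENNReal.ofReal tiny := fun v => by
    by_cases hv : v ∈ candidates (x ^ 3 / 2) obs u i
    swap
    · have : {C | v ∈ nearest (x ^ 3 / 2) k obs (S.noisy C) σ u i \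
          S.loo obs u i (x ^ 3 / 2) k σ C} = ∅ := by
        ext C
        simp only [Set.mem_ofPred_eq, Finset.mem_sdiff, Set.mem_empty_iff_false, iff_false]
        intro h
        rw [nearest_eq_topk] at h
        exact hv (topk_subset h.1)
      rw [this, measure_empty]
      exact zero_le
    have hO' : x ^ 3 / 4 ≤ (((overlap obs u v).erase i).card : ℝ) := by
      have h1 := hcard v hv
      have h2 := Finset.pred_card_le_card_erase (s := overlap obs u v) (a := i)
      have h3 : ((overlap obs u v).card : ℝ) ≤ ((overlap obs u v).erase i).card + 1 := by
        exact_mod_cast Nat.sub_le_iff_le_add.1 h2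
      linarith
    have := S.law_mem_nearest_sdiff_le obs u i (β := x ^ 3 / 2) (k := k) (σ := σ) hB hk
      (e := 16 * B ^ 2 / x ^ 3) (by positivity) (fun w hw => ?_) hv (L := L) ?_ ha0 ?_
      (ε := ε) hε0 hε hr2 hεr hra
    · simp only [Finset.mem_sdiff]
      refine this.trans (add_le_add_right (ENNReal.ofReal_le_ofReal ?_) _)
      have i1 := Real.exp_le_exp.2 (neg_le_neg hε2)
      have i2 := Real.exp_le_exp.2 (neg_le_neg (htail _ hO').1)
      have i3 := Real.exp_le_exp.2 (neg_le_neg (htail _ hO').2)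
      have hL0 : (0 : ℝ) ≤ L * 2 ^ L := by positivity
      have := mul_le_mul_of_nonneg_left i1 hL0
      rw [htiny]
      linarith
    · have h1 := hcard w hw
      refine ⟨?_, ?_⟩
      · have : (1 : ℝ) < (overlap obs u w).card := by linarith
        exact_mod_cast this
      · rw [div_le_div_iff₀ (by linarith) (by positivity)]
        have := mul_le_mul_of_nonneg_left h1 (by positivity : 0 ≤ B ^ 2)
        linarith
    · calc 2 * (16 * B ^ 2 / x ^ 3) * (((overlap obs u v).card : ℝ) - 1)
          ≤ 2 * (16 * B ^ 2 / x ^ 3) * (8 * x ^ 3) :=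
            mul_le_mul_of_nonneg_left (by linarith [hO v hv]) (by positivity)
        _ = 256 * B ^ 2 / γ ^ 2 * γ ^ 2 := by field_simp; norm_num
        _ ≤ L * γ ^ 2 := mul_le_mul_of_nonneg_right (Nat.le_ceil _) (by positivity)
    · calc (a : ℝ) ≤ γ ^ 4 / (8 * B ^ 4) * (x ^ 3 / 4) := ha1
        _ ≤ _ := mul_le_mul_of_nonneg_left hO' hθ0.le
  rw [lintegral_card_eq_sum]
  swap
  · intro v
    simp only [Finset.mem_sdiff]
    exact (S.measurableSet_mem_nearest obs u i _ k σ v).inter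
      (S.measurableSet_mem_loo obs u i _ k σ v).compl
  refine (Finset.sum_le_sum fun v _ => key v).trans ?_
  rw [Finset.sum_add_distrib, ← Finset.mul_sum,
    ← lintegral_card_eq_sum S.law (fun C => S.loo obs u i (x ^ 3 / 2) k σ C)
      (fun v => S.measurableSet_mem_loo obs u i _ k σ v)]
  have h1 : ∫⁻ C, ((S.loo obs u i (x ^ 3 / 2) k σ C).card : ℝ≥0∞) ∂S.law ≤ ENNReal.ofReal k := by
    calc _ ≤ ∫⁻ C, (k : ℝ≥0∞) ∂S.law := by
          refine lintegral_mono fun C => ?_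
          have : (S.loo obs u i (x ^ 3 / 2) k σ C).card ≤ k := by
            rw [loo, card_topk]; exact min_le_left _ _
          exact Nat.cast_le.2 this
      _ = _ := by rw [lintegral_const, measure_univ, mul_one, ENNReal.ofReal_natCast]
  have htiny0 : 0 ≤ tiny := by positivity
  calc _ ≤ ENNReal.ofReal (2 ^ L * (2 / r)) * ENNReal.ofReal k + ∑ _v : Fin m, ENNReal.ofReal tiny :=
        add_le_add_left (mul_le_mul_right h1 _) _
    _ = ENNReal.ofReal (2 ^ L * (2 / r) * k + m * tiny) := by
        rw [← ENNReal.ofReal_mul (by positivity), Finset.sum_const, nsmul_eq_mul,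
          ENNReal.ofReal_add (by positivity) (by positivity), Finset.card_univ, Fintype.card_fin,
          ENNReal.ofReal_mul (Nat.cast_nonneg m), ENNReal.ofReal_natCast]
    _ ≤ _ := by
        refine ENNReal.ofReal_le_ofReal ?_
        have hk1 : (1 : ℝ) ≤ k := by exact_mod_cast hk
        have j2 : (m : ℝ) * tiny ≤ (L * 2 ^ L + 3) / x * k := by
          have e0 : Real.exp x * Real.exp (-(2 * x)) ≤ 1 / x := by
            rw [← Real.exp_add]
            have : x + -(2 * x) = -x := by ring
            rw [this, Real.exp_neg, ← one_div]
            exact one_div_le_one_div_of_le hx0 (by linarith [Real.add_one_le_exp x])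
          calc (m : ℝ) * tiny ≤ Real.exp x * tiny := mul_le_mul_of_nonneg_right hm htiny0
            _ = (L * 2 ^ L + 3) * (Real.exp x * Real.exp (-(2 * x))) := by rw [htiny]; ring
            _ ≤ (L * 2 ^ L + 3) * (1 / x) := mul_le_mul_of_nonneg_left e0 (by positivity)
            _ = (L * 2 ^ L + 3) / x * 1 := by ring
            _ ≤ _ := mul_le_mul_of_nonneg_left hk1 (by positivity)
        have j3 : 2 ^ L * (2 / (r : ℝ)) * k ≤ 2 ^ L * (8 * ϑ / x) * k := by gcongr
        calc _ ≤ 2 ^ L * (8 * ϑ / x) * k + (L * 2 ^ L + 3) / x * k := add_le_add j3 j2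
          _ = _ := by ring

end ColumnModel

theorem avg_add {α : Type*} (O : Finset α) (z z' : α → ℝ) :
    avg O (fun j => z j + z' j) = avg O z + avg O z' := by
  unfold avg; rw [Finset.sum_add_distrib, add_div]

theorem avg_mono {α : Type*} {O : Finset α} {z z' : α → ℝ} (h : ∀ j ∈ O, z j ≤ z' j) :
    avg O z ≤ avg O z' :=
  div_le_div_of_nonneg_right (Finset.sum_le_sum h) (Nat.cast_nonneg _)

theorem avg_const_mul {α : Type*} (O : Finset α) (z : α → ℝ) (a : ℝ) :
    avg O (fun j => a * z j) = a * avg O z := by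
  unfold avg; rw [← Finset.mul_sum, mul_div_assoc]

theorem avg_nonneg {α : Type*} {O : Finset α} {z : α → ℝ} (h : ∀ j ∈ O, 0 ≤ z j) : 0 ≤ avg O z :=
  div_nonneg (Finset.sum_nonneg h) (Nat.cast_nonneg _)

theorem estimate_sub_eq {m n : ℕ} {β : ℝ} {k : ℕ} {obs : Fin m → Fin n → Bool}
    {Z : Fin m → Fin n → ℝ} {σ : Equiv.Perm (Fin m)} {u : Fin m} {i : Fin n}
    (h : (nearest β k obs Z σ u i).Nonempty) (a : ℝ) :
    estimate β k obs Z σ u i - a =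
      avg (nearest β k obs Z σ u i) fun v => Z v i + diffMean obs Z u v - a := by
  have hc : (0 : ℝ) < (nearest β k obs Z σ u i).card := by exact_mod_cast h.card_pos
  unfold estimate avg
  rw [Finset.sum_sub_distrib, Finset.sum_const, nsmul_eq_mul]
  field_simp

namespace ColumnModel

variable {m n : ℕ} {Y : Type u} [MeasurableSpace Y] {Δ Be γ : ℝ}
  (S : ColumnModel m n Y Δ Be γ) (obs : Fin m → Fin n → Bool) (u : Fin m) (i : Fin n)

/-- The error that row `v` contributes. -/
noncomputable def rowErr (C : Fin n → Y × (Fin m → ℝ)) (v : Fin m) : ℝ :=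
  S.noisy C v i + diffMean obs (S.noisy C) u v - S.F u (C i).1

theorem abs_rowErr_le (C : Fin n → Y × (Fin m → ℝ)) (v : Fin m) :
    |S.rowErr obs u i C v| ≤ 2 * (Δ + 2 * Be) := by
  have hB : 0 ≤ Δ + 2 * Be := by linarith [S.Δ_nonneg, S.Be_nonneg]
  have h1 := S.abs_F_sub_le v u (C i).1
  have h2 := S.abs_E_le ((C i).2 v)
  have h3 := abs_avg_le (O := overlap obs u v) hB fun j _ => S.abs_diff_le u v (C j)
  have h4 := S.Be_nonneg
  rw [← S.diffMean_noisy] at h3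
  have e : S.rowErr obs u i C v = (S.F v (C i).1 - S.F u (C i).1) + S.E ((C i).2 v) +
      diffMean obs (S.noisy C) u v := by
    unfold rowErr noisy entry; ring
  rw [e]
  rw [abs_le] at *
  constructor <;> linarith [h1.1, h1.2, h2.1, h2.2, h3.1, h3.2]

theorem rowErr_eq (C : Fin n → Y × (Fin m → ℝ)) (v : Fin m) :
    S.rowErr obs u i C v = S.E ((C i).2 v) + (S.meanDiff u v - (S.F u (C i).1 - S.F v (C i).1)) +
      (diffMean obs (S.noisy C) u v - S.meanDiff u v) := by
  unfold rowErr noisy entry; ring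

theorem rowErr_eq' (C : Fin n → Y × (Fin m → ℝ)) (v : Fin m) :
    S.rowErr obs u i C v = S.E ((C i).2 u) +
      (diffMean obs (S.noisy C) u v - S.diff u v (C i)) := by
  unfold rowErr noisy diff entry; ring

/-- All sample means and second moments without column `i` are near their expectations. -/
def good (β t : ℝ) : Set (Fin n → Y × (Fin m → ℝ)) :=
  {C | ∀ v ∈ candidates β obs u i,
    |avg ((overlap obs u v).erase i) (fun j => (S.diff u v (C j) - S.meanDiff u v) ^ 2) -
      (S.varDiff u v + 2 * γ ^ 2)| < t ∧
    |avg ((overlap obs u v).erase i) (fun j => S.diff u v (C j)) - S.meanDiff u v| < t}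

theorem measurable_avg_sq (O : Finset (Fin n)) (v : Fin m) :
    Measurable fun C : Fin n → Y × (Fin m → ℝ) =>
      avg O fun j => (S.diff u v (C j) - S.meanDiff u v) ^ 2 :=
  (Finset.measurable_fun_sum O fun j _ =>
    (((S.measurable_diff u v).comp (measurable_pi_apply j)).sub_const _).pow_const 2).div_const _

theorem measurableSet_good (β t : ℝ) : MeasurableSet (S.good obs u i β t) := by
  have : S.good obs u i β t = ⋂ v ∈ candidates β obs u i,
    ({C | |avg ((overlap obs u v).erase i) (fun j => (S.diff u v (C j) - S.meanDiff u v) ^ 2) -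
      (S.varDiff u v + 2 * γ ^ 2)| < t} ∩
    {C | |avg ((overlap obs u v).erase i) (fun j => S.diff u v (C j)) - S.meanDiff u v| < t}) := by
    ext C; simp [good]
  rw [this]
  refine Finset.measurableSet_biInter _ fun v _ => MeasurableSet.inter ?_ ?_
  · exact measurableSet_lt ((S.measurable_avg_sq u _ v).sub_const _).abs measurable_const
  · exact measurableSet_lt ((S.measurable_avg_diff _ u v).sub_const _).abs measurable_const

theorem update_mem_good {β t : ℝ} {C : Fin n → Y × (Fin m → ℝ)} {c : Y × (Fin m → ℝ)}
    (h : Function.update C i c ∈ S.good obs u i β t) : C ∈ S.good obs u i β t := by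
  intro v hv
  have h1 : ∀ j ∈ (overlap obs u v).erase i, S.diff u v (Function.update C i c j) =
      S.diff u v (C j) := fun j hj => by
    rw [Function.update_of_ne (Finset.ne_of_mem_erase hj)]
  have h2 := h v hv
  have h3 : ∀ f : ℝ → ℝ,
      avg ((overlap obs u v).erase i) (fun j => f (S.diff u v (Function.update C i c j))) =
      avg ((overlap obs u v).erase i) (fun j => f (S.diff u v (C j))) := fun f => by
    unfold avg
    rw [Finset.sum_congr rfl fun j hj => congrArg f (h1 j hj)]
  rw [h3 fun w => (w - S.meanDiff u v) ^ 2, h3 fun w => w] at h2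
  exact h2

theorem law_compl_good_le {β t q : ℝ} (hB : 0 < Δ + 2 * Be) (ht : 0 < t) (hq : 0 < q)
    (hO : ∀ v ∈ candidates β obs u i, q ≤ (((overlap obs u v).erase i).card : ℝ)) :
    S.law (S.good obs u i β t)ᶜ ≤ ENNReal.ofReal (m *
      (2 * Real.exp (-(t ^ 2 * q / (8 * (Δ + 2 * Be) ^ 2))) +
        2 * Real.exp (-(t ^ 2 * q / (32 * (Δ + 2 * Be) ^ 4))))) := by
  classical
  have hsub : (S.good obs u i β t)ᶜ ⊆ ⋃ v ∈ candidates β obs u i,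
    ({C | t ≤ |avg ((overlap obs u v).erase i) (fun j => S.diff u v (C j)) - S.meanDiff u v|} ∪
    {C | t ≤ |avg ((overlap obs u v).erase i) (fun j => (S.diff u v (C j) - S.meanDiff u v) ^ 2) -
      (S.varDiff u v + 2 * γ ^ 2)|}) := by
    intro C hC
    simp only [good, Set.mem_compl_iff, Set.mem_ofPred_eq, not_forall] at hC
    obtain ⟨v, hv, h⟩ := hC
    simp only [Set.mem_iUnion]
    refine ⟨v, hv, ?_⟩
    rw [not_and_or, not_lt, not_lt] at h
    exact h.symm
  refine (measure_mono hsub).trans ((measure_biUnion_finset_le _ _).trans ?_)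
  calc _ ≤ ∑ _v ∈ candidates β obs u i, ENNReal.ofReal
        (2 * Real.exp (-(t ^ 2 * q / (8 * (Δ + 2 * Be) ^ 2))) +
          2 * Real.exp (-(t ^ 2 * q / (32 * (Δ + 2 * Be) ^ 4)))) := by
        refine Finset.sum_le_sum fun v hv => (measure_union_le _ _).trans ?_
        have hne : ((overlap obs u v).erase i).Nonempty := by
          rw [← Finset.card_pos]
          have := hq.trans_le (hO v hv)
          exact_mod_cast this
        have h1 := S.law_avg_le hne hB u v ht.le
        have h2 := S.law_sq_le hne hB (mem_candidates.1 hv).1.symm ht.le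
        rw [ENNReal.ofReal_add (by positivity) (by positivity)]
        refine add_le_add (h1.trans (ENNReal.ofReal_le_ofReal ?_))
          (h2.trans (ENNReal.ofReal_le_ofReal ?_))
        · gcongr; exact hO v hv
        · gcongr; exact hO v hv
    _ ≤ _ := by
        rw [Finset.sum_const, nsmul_eq_mul, ENNReal.ofReal_mul (Nat.cast_nonneg m),
          ENNReal.ofReal_natCast]
        gcongr
        simpa using Finset.card_le_univ (candidates β obs u i)

theorem abs_looKey_sub_le {β t q : ℝ} {C : Fin n → Y × (Fin m → ℝ)} (ht : t ≤ 1) (hq : 0 < q)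
    (hC : C ∈ S.good obs u i β t) {v : Fin m} (hv : v ∈ candidates β obs u i)
    (hO : q ≤ ((overlap obs u v).card : ℝ) - 1) :
    |S.looKey obs u i C v - (S.varDiff u v + 2 * γ ^ 2)| ≤
      2 * t + 4 * (Δ + 2 * Be) ^ 2 / q := by
  obtain ⟨h1, h2⟩ := hC v hv
  set s := S.varDiff u v + 2 * γ ^ 2
  have hc0 : 0 < ((overlap obs u v).card : ℝ) - 1 := hq.trans_le hO
  have hcard1 : ((overlap obs u v).card : ℝ) - 1 ≤ ((overlap obs u v).erase i).card := by
    have h2 := Finset.pred_card_le_card_erase (s := overlap obs u v) (a := i)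
    have h3 : ((overlap obs u v).card : ℝ) ≤ ((overlap obs u v).erase i).card + 1 := by
      exact_mod_cast Nat.sub_le_iff_le_add.1 h2
    linarith
  have hcard2 : (((overlap obs u v).erase i).card : ℝ) ≤ (overlap obs u v).card := by
    exact_mod_cast Finset.card_le_card (Finset.erase_subset _ _)
  have hne : ((overlap obs u v).erase i).Nonempty := by
    rw [← Finset.card_pos]
    have : (0 : ℝ) < ((overlap obs u v).erase i).card := by linarith
    exact_mod_cast this
  have hssd := ssd_eq ((overlap obs u v).erase i) (fun j => S.diff u v (C j)) (S.meanDiff u v)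
  rw [← card_mul_avg hne fun j => (S.diff u v (C j) - S.meanDiff u v) ^ 2] at hssd
  have hss0 := ssd_nonneg ((overlap obs u v).erase i) (fun j => S.diff u v (C j))
  have hVle : avg ((overlap obs u v).erase i) (fun j => (S.diff u v (C j) - S.meanDiff u v) ^ 2) ≤
      4 * (Δ + 2 * Be) ^ 2 := by
    refine avg_le (by positivity) fun j _ => ?_
    have := pow_le_pow_left₀ (abs_nonneg _) (S.abs_diff_sub_le u v (C j)) 2
    rw [sq_abs] at this
    linarith
  unfold looKey
  rw [hssd] at hss0 ⊢
  set V := avg ((overlap obs u v).erase i) (fun j => (S.diff u v (C j) - S.meanDiff u v) ^ 2)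
  set A := (avg ((overlap obs u v).erase i) (fun j => S.diff u v (C j)) - S.meanDiff u v) ^ 2
    with hA
  set q' : ℝ := (((overlap obs u v).erase i).card : ℝ)
  set c : ℝ := ((overlap obs u v).card : ℝ) - 1
  have hq'0 : 0 < q' := by linarith
  have hVA : 0 ≤ V - A := by
    rw [← mul_sub] at hss0
    exact nonneg_of_mul_nonneg_right hss0 hq'0
  have hA0 : 0 ≤ A := sq_nonneg _
  have hAt : A ≤ t := by
    have ht0 : 0 ≤ t := (abs_nonneg _).trans h2.le
    calc A ≤ t ^ 2 := by rw [hA, ← sq_abs]; exact pow_le_pow_left₀ (abs_nonneg _) h2.le 2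
      _ ≤ t := by nlinarith
  have e1 : (q' * V - q' * A) / c = (V - A) + (q' - c) / c * (V - A) := by
    field_simp; ring
  have h5 : 0 ≤ (q' - c) / c := div_nonneg (by linarith) hc0.le
  have h6 : (q' - c) / c ≤ 1 / q := by
    have : q' - c ≤ 1 := by simp only [c]; linarith
    exact div_le_div₀ zero_le_one this hq hO
  have h7 : (q' - c) / c * (V - A) ≤ 4 * (Δ + 2 * Be) ^ 2 / q := by
    calc (q' - c) / c * (V - A) ≤ 1 / q * (4 * (Δ + 2 * Be) ^ 2) :=
          mul_le_mul h6 (by linarith) hVA (by positivity)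
      _ = _ := by ring
  have h8 := mul_nonneg h5 hVA
  rw [e1]
  rw [abs_lt] at h1
  rw [abs_le]
  constructor <;> linarith [h1.1, h1.2]

theorem varDiff_le_of_mem_loo {β t q ε₀ : ℝ} {k : ℕ} {σ : Equiv.Perm (Fin m)}
    {C : Fin n → Y × (Fin m → ℝ)} (ht : t ≤ 1) (hq : 0 < q)
    (hC : C ∈ S.good obs u i β t)
    (hO : ∀ v ∈ candidates β obs u i, q ≤ ((overlap obs u v).card : ℝ) - 1)
    {G : Finset (Fin m)} (hG : G ⊆ candidates β obs u i) (hk : k ≤ G.card)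
    (hclose : ∀ w ∈ G, ∀ y, |S.F u y - S.F w y| ≤ ε₀) {v : Fin m}
    (hv : v ∈ S.loo obs u i β k σ C) :
    S.varDiff u v ≤ ε₀ ^ 2 + 2 * (2 * t + 4 * (Δ + 2 * Be) ^ 2 / q) := by
  obtain ⟨w, hw, hle⟩ := exists_le_of_mem_topk hG hk hv
  have hvc := topk_subset hv
  have h1 := abs_le.1 (S.abs_looKey_sub_le obs u i ht hq hC hvc (hO v hvc))
  have h2 := abs_le.1 (S.abs_looKey_sub_le obs u i ht hq hC (hG hw) (hO w (hG hw)))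
  have h3 := S.varDiff_le u w (hclose w hw)
  linarith [h1.1, h2.2]

/-- A column that is independent of a set of rows may be integrated out first. -/
theorem lintegral_column_le {G : Set (Fin n → Y × (Fin m → ℝ))} (hG : MeasurableSet G)
    (hG' : ∀ C c, Function.update C i c ∈ G → C ∈ G)
    {T : (Fin n → Y × (Fin m → ℝ)) → Finset (Fin m)} (hT : ∀ v, MeasurableSet {C | v ∈ T C})
    (hT' : ∀ C c, T (Function.update C i c) = T C)
    {Φ : Finset (Fin m) → Y × (Fin m → ℝ) → ℝ≥0∞} (hΦ : ∀ A, Measurable (Φ A)) {b : ℝ≥0∞}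
    (h : ∀ C ∈ G, ∫⁻ c, Φ (T C) c ∂(S.κ i) ≤ b) :
    ∫⁻ C, G.indicator (fun C => Φ (T C) (C i)) C ∂S.law ≤ b := by
  classical
  have hTA : ∀ A, MeasurableSet {C | T C = A} := fun A => by
    have : {C | T C = A} = ⋂ v, (if v ∈ A then {C | v ∈ T C} else {C | v ∈ T C}ᶜ) := by
      ext C
      simp only [Set.mem_ofPred_eq, Set.mem_iInter, Finset.ext_iff]
      refine forall_congr' fun v => ?_
      by_cases hv : v ∈ A <;> simp [hv]
    rw [this]
    refine MeasurableSet.iInter fun v => ?_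
    split_ifs
    · exact hT v
    · exact (hT v).compl
  have hm : Measurable (G.indicator fun C => Φ (T C) (C i)) := by
    have e : (fun C => Φ (T C) (C i)) = fun C =>
        ∑ A, {C | T C = A}.indicator (fun C : Fin n → Y × (Fin m → ℝ) => Φ A (C i)) C := by
      funext C
      rw [Finset.sum_eq_single (T C)]
      · rw [Set.indicator_of_mem (by exact rfl)]
      · exact fun A _ hA => Set.indicator_of_notMem (fun h => hA h.symm) _
      · exact fun h => absurd (Finset.mem_univ _) h
    rw [e]
    exact (Finset.measurable_fun_sum _ fun A _ =>
      ((hΦ A).comp (measurable_pi_apply i)).indicator (hTA A)).indicator hG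
  have hmp := measurePreserving_update S.κ i
  have := hmp.lintegral_comp hm
  unfold law
  rw [← this, lintegral_prod (fun p : (Fin n → Y × (Fin m → ℝ)) × Y × (Fin m → ℝ) =>
    G.indicator (fun C => Φ (T C) (C i)) (Function.update p.1 i p.2))
    (hm.comp hmp.measurable).aemeasurable]
  calc _ ≤ ∫⁻ C, b ∂(Measure.pi S.κ) := by
        refine lintegral_mono fun C => ?_
        by_cases hC : C ∈ G
        · refine (lintegral_mono fun c => ?_).trans (h C hC)
          refine (Set.indicator_le_self _ _ _).trans ?_
          simp only [hT', Function.update_self]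
          exact le_rfl
        · rw [lintegral_congr fun c => Set.indicator_of_notMem (fun h => hC (hG' C c h)) _]
          simp
    _ = b := by simp

theorem lintegral_sq_avg_noise (T : Finset (Fin m)) :
    ∫⁻ c, ENNReal.ofReal (avg T (fun v => S.E (c.2 v)) ^ 2) ∂(S.κ i) =
      ENNReal.ofReal (γ ^ 2 / T.card) := by
  have hm : Measurable fun h : Fin m → ℝ => ENNReal.ofReal (avg T (fun v => S.E (h v)) ^ 2) :=
    (((Finset.measurable_fun_sum T fun v _ => S.measurable_E.comp
      (measurable_pi_apply v)).div_const _).pow_const 2).ennreal_ofReal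
  unfold κ
  rw [(measurePreserving_snd (μ := S.P) (ν := Measure.pi fun v => S.ν v i)).lintegral_comp hm]
  have h := integral_sq_sum (fun v => S.ν v i) (g := fun _ => S.E) (fun _ => S.measurable_E)
    (fun _ => S.abs_E_le) (fun v => S.integral_E v i) (fun v => S.integral_E_sq v i) T
  simp only [avg, div_pow]
  rw [← ofReal_integral_eq_lintegral_ofReal (h.1.div_const _)
    (Filter.Eventually.of_forall fun c => by positivity), integral_div, h.2]
  congr 1
  rcases eq_or_ne (T.card : ℝ) 0 with h0 | h0
  · rw [h0]; simp
  · field_simp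

theorem lintegral_avg_le {T : Finset (Fin m)} {Ω : Type*} [MeasurableSpace Ω] {P : Measure Ω}
    {g : Fin m → Ω → ℝ} (hg : ∀ v, Measurable (g v)) (hg0 : ∀ v ω, 0 ≤ g v ω) {b : ℝ} (hb : 0 ≤ b)
    (h : ∀ v ∈ T, ∫⁻ ω, ENNReal.ofReal (g v ω) ∂P ≤ ENNReal.ofReal b) :
    ∫⁻ ω, ENNReal.ofReal (avg T fun v => g v ω) ∂P ≤ ENNReal.ofReal b := by
  rcases T.eq_empty_or_nonempty with rfl | hT
  · simp [avg]
  have hc : (0 : ℝ) < T.card := by exact_mod_cast hT.card_pos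
  have e : ∀ ω, ENNReal.ofReal (avg T fun v => g v ω) =
      (∑ v ∈ T, ENNReal.ofReal (g v ω)) * ENNReal.ofReal ((T.card : ℝ)⁻¹) := fun ω => by
    rw [avg, div_eq_mul_inv, ENNReal.ofReal_mul (Finset.sum_nonneg fun v _ => hg0 v ω),
      ENNReal.ofReal_sum_of_nonneg fun v _ => hg0 v ω]
  simp only [e]
  rw [lintegral_mul_const _ (Finset.measurable_fun_sum T fun v _ => (hg v).ennreal_ofReal),
    lintegral_finsetSum _ fun v _ => (hg v).ennreal_ofReal]
  calc _ ≤ (T.card • ENNReal.ofReal b) * ENNReal.ofReal ((T.card : ℝ)⁻¹) :=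
        mul_le_mul_left (Finset.sum_le_card_nsmul _ _ _ h) _
    _ = ENNReal.ofReal b := by
        rw [nsmul_eq_mul, ← ENNReal.ofReal_natCast, ← ENNReal.ofReal_mul hc.le,
          ← ENNReal.ofReal_mul (by positivity)]
        congr 1
        field_simp

end ColumnModel

theorem sq_avg_le_of_card_eq {α : Type*} [DecidableEq α] {A B : Finset α} (hAB : B.card = A.card)
    (hA : A.Nonempty) {z : α → ℝ} {K : ℝ} (hz : ∀ j, |z j| ≤ K) :
    avg A z ^ 2 ≤ 2 * avg B z ^ 2 + 8 * K ^ 2 / A.card * (A \ B).card := by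
  have hc : (0 : ℝ) < A.card := by exact_mod_cast hA.card_pos
  have hcard : (B \ A).card = (A \ B).card := by
    have h1 := Finset.card_sdiff_add_card_inter A B
    have h2 := Finset.card_sdiff_add_card_inter B A
    rw [Finset.inter_comm] at h2
    omega
  have hb : ∀ T : Finset α, |∑ j ∈ T, z j| ≤ T.card * K := fun T => by
    rw [← nsmul_eq_mul]
    exact (Finset.abs_sum_le_sum_abs _ _).trans (Finset.sum_le_card_nsmul _ _ _ fun j _ => hz j)
  have h1 := hb (A \ B)
  have h2 := hb (B \ A)
  rw [hcard] at h2
  have h3 := Finset.sum_inter_add_sum_sdiff A B z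
  have h4 := Finset.sum_inter_add_sum_sdiff B A z
  rw [Finset.inter_comm] at h4
  have h5 : avg A z - avg B z = (∑ j ∈ A \ B, z j - ∑ j ∈ B \ A, z j) / A.card := by
    unfold avg
    rw [hAB, ← h3, ← h4]
    ring
  set q : ℝ := ((A \ B).card : ℝ) with hq
  have hqA : q ≤ A.card := Nat.cast_le.2 (Finset.card_le_card Finset.sdiff_subset)
  have hq0 : 0 ≤ q := Nat.cast_nonneg _
  have h6 : |avg A z - avg B z| ≤ 2 * q * K / A.card := by
    rw [h5, abs_div, abs_of_pos hc]
    refine div_le_div_of_nonneg_right ((abs_sub _ _).trans ?_) hc.le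
    linarith
  have h7 : (avg A z - avg B z) ^ 2 ≤ 4 * K ^ 2 / A.card * q := by
    rw [← sq_abs]
    calc |avg A z - avg B z| ^ 2 ≤ (2 * q * K / A.card) ^ 2 :=
          pow_le_pow_left₀ (abs_nonneg _) h6 2
      _ = 4 * K ^ 2 / A.card * q * (q / A.card) := by field_simp; ring
      _ ≤ 4 * K ^ 2 / A.card * q * 1 :=
          mul_le_mul_of_nonneg_left ((div_le_one hc).2 hqA) (by positivity)
      _ = _ := mul_one _
  have e : 8 * K ^ 2 / (A.card : ℝ) * q = 2 * (4 * K ^ 2 / A.card * q) := by ring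
  rw [e]
  nlinarith [sq_nonneg (avg A z - 2 * avg B z)]

theorem measurable_card_finset {Ω : Type*} [MeasurableSpace Ω] {m : ℕ} {T : Ω → Finset (Fin m)}
    (hT : ∀ v, MeasurableSet {ω | v ∈ T ω}) : Measurable fun ω => ((T ω).card : ℝ≥0∞) := by
  classical
  have h : (fun ω => ((T ω).card : ℝ≥0∞)) =
      fun ω => ∑ v, {ω | v ∈ T ω}.indicator (fun _ => (1 : ℝ≥0∞)) ω := by
    funext ω
    simp [Set.indicator_apply]
  rw [h]
  exact Finset.measurable_fun_sum _ fun v _ => measurable_const.indicator (hT v)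

namespace ColumnModel

variable {m n : ℕ} {Y : Type u} [MeasurableSpace Y] {Δ Be γ : ℝ}
  (S : ColumnModel m n Y Δ Be γ) (obs : Fin m → Fin n → Bool) (u : Fin m) (i : Fin n)

theorem sq_estimate_sub_le {β : ℝ} {k : ℕ} {σ : Equiv.Perm (Fin m)} {C : Fin n → Y × (Fin m → ℝ)}
    (h : (nearest β k obs (S.noisy C) σ u i).Nonempty) :
    (estimate β k obs (S.noisy C) σ u i - S.F u (C i).1) ^ 2 ≤ 4 * (Δ + 2 * Be) ^ 2 := by
  have hB : 0 ≤ Δ + 2 * Be := by linarith [S.Δ_nonneg, S.Be_nonneg]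
  rw [estimate_sub_eq h, ← sq_abs]
  calc _ ≤ (2 * (Δ + 2 * Be)) ^ 2 := pow_le_pow_left₀ (abs_nonneg _)
        (abs_avg_le (by positivity) fun v _ => S.abs_rowErr_le obs u i C v) 2
    _ = _ := by ring

theorem abs_diffMean_sub_le {β t q : ℝ} {C : Fin n → Y × (Fin m → ℝ)} (hq : 0 < q)
    (hC : C ∈ S.good obs u i β t) {v : Fin m} (hv : v ∈ candidates β obs u i)
    (hO : q ≤ ((overlap obs u v).card : ℝ)) :
    |diffMean obs (S.noisy C) u v - S.meanDiff u v| ≤ t + 2 * (Δ + 2 * Be) / q := by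
  have hB : 0 ≤ Δ + 2 * Be := by linarith [S.Δ_nonneg, S.Be_nonneg]
  have h2 := (hC v hv).2
  rw [diffMean_noisy]
  by_cases hi : i ∈ overlap obs u v
  · have h1 := abs_avg_sub_avg_erase_le hi hB fun j _ => S.abs_diff_le u v (C j)
    have h3 : 2 * (Δ + 2 * Be) / (overlap obs u v).card ≤ 2 * (Δ + 2 * Be) / q := by gcongr
    have h4 := abs_sub_le (avg (overlap obs u v) fun j => S.diff u v (C j))
      (avg ((overlap obs u v).erase i) fun j => S.diff u v (C j)) (S.meanDiff u v)
    linarith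
  · rw [Finset.erase_eq_of_notMem hi] at h2
    have : 0 ≤ 2 * (Δ + 2 * Be) / q := by positivity
    linarith

theorem lintegral_sq_mean_sub (v : Fin m) :
    ∫⁻ c, ENNReal.ofReal ((S.meanDiff u v - (S.F u c.1 - S.F v c.1)) ^ 2) ∂(S.κ i) =
      ENNReal.ofReal (S.varDiff u v) := by
  have hm4 : Measurable fun y => ENNReal.ofReal ((S.F u y - S.F v y - S.meanDiff u v) ^ 2) :=
    ((((S.measurable_F u).sub (S.measurable_F v)).sub_const _).pow_const 2).ennreal_ofReal
  rw [← S.lintegral_F_sub_sq, ← (measurePreserving_fst (μ := S.P)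
    (ν := Measure.pi fun v => S.ν v i)).lintegral_comp hm4]
  unfold κ
  refine lintegral_congr fun c => ?_
  congr 1
  ring

theorem sq_avg_rowErr_le {β t q : ℝ} {C : Fin n → Y × (Fin m → ℝ)} (hq : 0 < q)
    (ht : 0 ≤ t) (hC : C ∈ S.good obs u i β t)
    (hO : ∀ v ∈ candidates β obs u i, q ≤ ((overlap obs u v).card : ℝ))
    {T : Finset (Fin m)} (hT : T ⊆ candidates β obs u i) :
    avg T (S.rowErr obs u i C) ^ 2 ≤ 3 * avg T (fun v => S.E ((C i).2 v)) ^ 2 +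
      3 * avg T (fun v => (S.meanDiff u v - (S.F u (C i).1 - S.F v (C i).1)) ^ 2) +
      3 * (t + 2 * (Δ + 2 * Be) / q) ^ 2 := by
  have hB : 0 ≤ Δ + 2 * Be := by linarith [S.Δ_nonneg, S.Be_nonneg]
  have e : avg T (S.rowErr obs u i C) = avg T (fun v => S.E ((C i).2 v)) +
      avg T (fun v => S.meanDiff u v - (S.F u (C i).1 - S.F v (C i).1)) +
      avg T (fun v => diffMean obs (S.noisy C) u v - S.meanDiff u v) := by
    rw [← avg_add, ← avg_add]
    congr 1
    funext v
    exact S.rowErr_eq obs u i C v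
  have h1 := sq_avg_le T fun v => S.meanDiff u v - (S.F u (C i).1 - S.F v (C i).1)
  have h2 : avg T (fun v => diffMean obs (S.noisy C) u v - S.meanDiff u v) ^ 2 ≤
      (t + 2 * (Δ + 2 * Be) / q) ^ 2 := by
    rw [← sq_abs]
    exact pow_le_pow_left₀ (abs_nonneg _) (abs_avg_le (by positivity) fun v hv =>
      S.abs_diffMean_sub_le obs u i hq hC (hT hv) (hO v (hT hv))) 2
  rw [e]
  set a := avg T (fun v => S.E ((C i).2 v))
  set b := avg T (fun v => S.meanDiff u v - (S.F u (C i).1 - S.F v (C i).1))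
  set c := avg T (fun v => diffMean obs (S.noisy C) u v - S.meanDiff u v)
  nlinarith [sq_nonneg (a - b), sq_nonneg (b - c), sq_nonneg (a - c)]

/-- The nearest rows are at most a constant factor worse in column `i` than the rows selected
without column `i`. -/
theorem sum_nearest_sq_le {β : ℝ} {k : ℕ} {σ : Equiv.Perm (Fin m)} {N : ℝ} (hN : 0 < N)
    (hi : obs u i = true)
    (hO : ∀ v ∈ candidates β obs u i, 1 < (overlap obs u v).card ∧
      N / 4 ≤ ((overlap obs u v).card : ℝ) - 1 ∧ ((overlap obs u v).card : ℝ) ≤ 8 * N)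
    (C : Fin n → Y × (Fin m → ℝ)) :
    ∑ v ∈ nearest β k obs (S.noisy C) σ u i,
        (S.diff u v (C i) - diffMean obs (S.noisy C) u v) ^ 2 ≤
      32 * ∑ v ∈ S.loo obs u i β k σ C, (S.diff u v (C i) -
        avg ((overlap obs u v).erase i) fun j => S.diff u v (C j)) ^ 2 := by
  have hS : nearest β k obs (S.noisy C) σ u i ⊆ candidates β obs u i := by
    rw [nearest_eq_topk]; exact topk_subset
  have hS' : S.loo obs u i β k σ C ⊆ candidates β obs u i := topk_subset
  have hmem : ∀ v ∈ candidates β obs u i, i ∈ overlap obs u v := fun v hv =>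
    mem_overlap.2 ⟨hi, (mem_candidates.1 hv).2.1⟩
  have hcard := S.card_loo_eq obs u i β k σ C
  have h1 : ∑ v ∈ nearest β k obs (S.noisy C) σ u i, diffVar obs (S.noisy C) u v ≤
      ∑ v ∈ S.loo obs u i β k σ C, diffVar obs (S.noisy C) u v := by
    rw [nearest_eq_topk] at hcard ⊢
    exact sum_topk_le hS' hcard
  have h2 : ∑ v ∈ S.loo obs u i β k σ C, S.looKey obs u i C v ≤
      ∑ v ∈ nearest β k obs (S.noisy C) σ u i, S.looKey obs u i C v :=
    sum_topk_le hS hcard.symm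
  calc _ ≤ ∑ v ∈ nearest β k obs (S.noisy C) σ u i,
        8 * N * (diffVar obs (S.noisy C) u v - S.looKey obs u i C v) := by
        refine Finset.sum_le_sum fun v hv => ?_
        have hvc := hS hv
        refine (S.sq_le_diffVar_sub obs u i (hO v hvc).1 (hmem v hvc)).trans
          (mul_le_mul_of_nonneg_right (by linarith [(hO v hvc).2.2]) ?_)
        linarith [S.looKey_le obs u i (C := C) (hO v hvc).1]
    _ ≤ ∑ v ∈ S.loo obs u i β k σ C,
        8 * N * (diffVar obs (S.noisy C) u v - S.looKey obs u i C v) := by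
        rw [← Finset.mul_sum, ← Finset.mul_sum, Finset.sum_sub_distrib, Finset.sum_sub_distrib]
        exact mul_le_mul_of_nonneg_left (by linarith) (by positivity)
    _ ≤ _ := by
        rw [Finset.mul_sum]
        refine Finset.sum_le_sum fun v hv => ?_
        have hvc := hS' hv
        obtain ⟨o1, o2, o3⟩ := hO v hvc
        have hc : 0 < ((overlap obs u v).card : ℝ) - 1 := by linarith [hN]
        have h4 := S.diffVar_sub_le_sq obs u i (C := C) o1 (hmem v hvc)
        set w := (S.diff u v (C i) - avg ((overlap obs u v).erase i) fun j => S.diff u v (C j)) ^ 2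
          with hw
        have hw0 : 0 ≤ w := sq_nonneg _
        calc _ ≤ 8 * N * (w / ((overlap obs u v).card - 1)) :=
              mul_le_mul_of_nonneg_left h4 (by positivity)
          _ ≤ 8 * N * (w / (N / 4)) := by gcongr
          _ = 32 * w := by field_simp; ring

theorem nearest_card_eq {β : ℝ} {k : ℕ} {σ : Equiv.Perm (Fin m)} {Z : Fin m → Fin n → ℝ}
    {G : Finset (Fin m)} (hG : G ⊆ candidates β obs u i) (hk : k ≤ G.card) :
    (nearest β k obs Z σ u i).card = k := by
  rw [nearest_eq_topk, card_topk, min_eq_left (hk.trans (Finset.card_le_card hG))]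

/-- The assumptions on the rows and the mask under which the estimate is accurate. -/
structure Favourable (k : ℕ) (x ε₀ : ℝ) : Prop where
  k_pos : 0 < k
  m_le : (m : ℝ) ≤ Real.exp x
  overlap_le : ∀ w ∈ candidates (x ^ 3 / 2) obs u i, ((overlap obs u w).card : ℝ) ≤ 8 * x ^ 3
  close : ∃ G ⊆ candidates (x ^ 3 / 2) obs u i, k ≤ G.card ∧
    ∀ w ∈ G, ∀ y, |S.F u y - S.F w y| ≤ ε₀

variable {S obs u i}

theorem Favourable.card {k : ℕ} {x ε₀ : ℝ} (h : S.Favourable obs u i k x ε₀) (hx : 2 ≤ x) :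
    ∀ v ∈ candidates (x ^ 3 / 2) obs u i, (1 < (overlap obs u v).card ∧
      x ^ 3 / 4 ≤ ((overlap obs u v).card : ℝ) - 1 ∧
      ((overlap obs u v).card : ℝ) ≤ 8 * x ^ 3) ∧
      x ^ 3 / 4 ≤ (((overlap obs u v).erase i).card : ℝ) := fun v hv => by
  have hx8 : 8 ≤ x ^ 3 := by nlinarith [sq_nonneg x]
  have h1 := (mem_candidates.1 hv).2.2
  have h2 := Finset.pred_card_le_card_erase (s := overlap obs u v) (a := i)
  have h3 : ((overlap obs u v).card : ℝ) ≤ ((overlap obs u v).erase i).card + 1 := by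
    exact_mod_cast Nat.sub_le_iff_le_add.1 h2
  refine ⟨⟨?_, by linarith, h.overlap_le v hv⟩, by linarith⟩
  have : (1 : ℝ) < (overlap obs u v).card := by linarith
  exact_mod_cast this

theorem Favourable.law_compl_good_le {k : ℕ} {x ε₀ : ℝ} (h : S.Favourable obs u i k x ε₀)
    (hx : 2 ≤ x) {B T : ℝ} (hBd : B = Δ + 2 * Be) (hB : 0 < B) (hT : T = 8 * B + 16 * B ^ 2) :
    S.law (S.good obs u i (x ^ 3 / 2) (T / x))ᶜ ≤ ENNReal.ofReal (4 / x) := by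
  have hx0 : 0 < x := by linarith
  have hT0 : 0 < T := by rw [hT]; positivity
  refine (S.law_compl_good_le obs u i (q := x ^ 3 / 4) (hBd ▸ hB) (by positivity) (by positivity)
    fun v hv => (h.card hx v hv).2).trans (ENNReal.ofReal_le_ofReal ?_)
  rw [← hBd]
  have e1 : (T / x) ^ 2 * (x ^ 3 / 4) = T ^ 2 * x / 4 := by field_simp
  have i1 : Real.exp (-((T / x) ^ 2 * (x ^ 3 / 4) / (8 * B ^ 2))) ≤ Real.exp (-(2 * x)) := by
    refine Real.exp_le_exp.2 (neg_le_neg ?_)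
    rw [e1, le_div_iff₀ (by positivity)]
    have : (8 * B) ^ 2 ≤ T ^ 2 := pow_le_pow_left₀ (by positivity) (by rw [hT]; nlinarith) 2
    nlinarith
  have i2 : Real.exp (-((T / x) ^ 2 * (x ^ 3 / 4) / (32 * B ^ 4))) ≤ Real.exp (-(2 * x)) := by
    refine Real.exp_le_exp.2 (neg_le_neg ?_)
    rw [e1, le_div_iff₀ (by positivity)]
    have : (16 * B ^ 2) ^ 2 ≤ T ^ 2 := pow_le_pow_left₀ (by positivity) (by rw [hT]; nlinarith) 2
    nlinarith
  have e0 : Real.exp x * Real.exp (-(2 * x)) ≤ 1 / x := by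
    rw [← Real.exp_add]
    have : x + -(2 * x) = -x := by ring
    rw [this, Real.exp_neg, ← one_div]
    exact one_div_le_one_div_of_le hx0 (by linarith [Real.add_one_le_exp x])
  calc _ ≤ Real.exp x * (2 * Real.exp (-(2 * x)) + 2 * Real.exp (-(2 * x))) :=
        mul_le_mul h.m_le (by linarith) (by positivity) (by positivity)
    _ = 4 * (Real.exp x * Real.exp (-(2 * x))) := by ring
    _ ≤ 4 * (1 / x) := mul_le_mul_of_nonneg_left e0 (by norm_num)
    _ = _ := by ring

theorem Favourable.nearest_card {k : ℕ} {x ε₀ : ℝ} (h : S.Favourable obs u i k x ε₀)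
    (σ : Equiv.Perm (Fin m)) (Z : Fin m → Fin n → ℝ) :
    (nearest (x ^ 3 / 2) k obs Z σ u i).card = k := by
  obtain ⟨G, hG, hk, -⟩ := h.close
  exact nearest_card_eq obs u i hG hk

theorem Favourable.nearest_nonempty {k : ℕ} {x ε₀ : ℝ} (h : S.Favourable obs u i k x ε₀)
    (σ : Equiv.Perm (Fin m)) (Z : Fin m → Fin n → ℝ) :
    (nearest (x ^ 3 / 2) k obs Z σ u i).Nonempty := by
  rw [← Finset.card_pos, h.nearest_card]; exact h.k_pos

theorem Favourable.varDiff_le {k : ℕ} {x ε₀ : ℝ} (h : S.Favourable obs u i k x ε₀)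
    (hx : 2 ≤ x) {B T : ℝ} (hBd : B = Δ + 2 * Be) (hTx : T ≤ x)
    {σ : Equiv.Perm (Fin m)} {C : Fin n → Y × (Fin m → ℝ)}
    (hC : C ∈ S.good obs u i (x ^ 3 / 2) (T / x)) {v : Fin m}
    (hv : v ∈ S.loo obs u i (x ^ 3 / 2) k σ C) :
    S.varDiff u v ≤ ε₀ ^ 2 + (4 * T + 32 * B ^ 2) / x := by
  have hx0 : 0 < x := by linarith
  obtain ⟨G, hG, hk, hc⟩ := h.close
  have h1 := S.varDiff_le_of_mem_loo obs u i (q := x ^ 3 / 4) ((div_le_one hx0).2 hTx)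
    (by positivity) hC (fun v hv => (h.card hx v hv).1.2.1) hG hk hc hv
  rw [← hBd] at h1
  have h2 : 4 * B ^ 2 / (x ^ 3 / 4) ≤ 16 * B ^ 2 / x := by
    rw [div_le_div_iff₀ (by positivity) hx0]
    have : x ≤ x ^ 3 := by nlinarith [sq_nonneg x]
    have := mul_le_mul_of_nonneg_left this (sq_nonneg B)
    linarith
  have e : (4 * T + 32 * B ^ 2) / x = 2 * (2 * (T / x) + 16 * B ^ 2 / x) := by ring
  rw [e]
  linarith

/-- Splitting the error into a part that is controlled on the good event, a part controlled by the
influence of column `i`, and the bad event. -/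
theorem Favourable.lintegral_sq_err_le {k : ℕ} {x ε₀ : ℝ} (h : S.Favourable obs u i k x ε₀)
    (hx : 2 ≤ x) {B T : ℝ} (hBd : B = Δ + 2 * Be) (hB : 0 < B) (hT : T = 8 * B + 16 * B ^ 2)
    (σ : Equiv.Perm (Fin m)) {Φ : Finset (Fin m) → Y × (Fin m → ℝ) → ℝ} (hΦ : ∀ A, Measurable (Φ A))
    {a b : ℝ} (ha : 0 ≤ a)
    (hpt : ∀ C ∈ S.good obs u i (x ^ 3 / 2) (T / x),
      (estimate (x ^ 3 / 2) k obs (S.noisy C) σ u i - S.F u (C i).1) ^ 2 ≤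
      Φ (S.loo obs u i (x ^ 3 / 2) k σ C) (C i) +
        a * (nearest (x ^ 3 / 2) k obs (S.noisy C) σ u i \
          S.loo obs u i (x ^ 3 / 2) k σ C).card)
    (hint : ∀ C ∈ S.good obs u i (x ^ 3 / 2) (T / x),
      ∫⁻ c, ENNReal.ofReal (Φ (S.loo obs u i (x ^ 3 / 2) k σ C) c) ∂(S.κ i) ≤ ENNReal.ofReal b) :
    ∫⁻ C, ENNReal.ofReal ((estimate (x ^ 3 / 2) k obs (S.noisy C) σ u i - S.F u (C i).1) ^ 2)
      ∂S.law ≤ ENNReal.ofReal b + ENNReal.ofReal a *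
        ∫⁻ C, ((nearest (x ^ 3 / 2) k obs (S.noisy C) σ u i \
          S.loo obs u i (x ^ 3 / 2) k σ C).card : ℝ≥0∞) ∂S.law +
      ENNReal.ofReal (16 * B ^ 2 / x) := by
  set G := S.good obs u i (x ^ 3 / 2) (T / x) with hG
  have hGm : MeasurableSet G := S.measurableSet_good obs u i _ _
  have hcm : Measurable fun C => ((nearest (x ^ 3 / 2) k obs (S.noisy C) σ u i \
      S.loo obs u i (x ^ 3 / 2) k σ C).card : ℝ≥0∞) := by
    refine measurable_card_finset fun v => ?_
    simp only [Finset.mem_sdiff]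
    exact (S.measurableSet_mem_nearest obs u i _ k σ v).inter
      (S.measurableSet_mem_loo obs u i _ k σ v).compl
  have hle : ∀ C, ENNReal.ofReal
      ((estimate (x ^ 3 / 2) k obs (S.noisy C) σ u i - S.F u (C i).1) ^ 2) ≤
      G.indicator (fun C => ENNReal.ofReal (Φ (S.loo obs u i (x ^ 3 / 2) k σ C) (C i))) C +
      ENNReal.ofReal a * ((nearest (x ^ 3 / 2) k obs (S.noisy C) σ u i \
          S.loo obs u i (x ^ 3 / 2) k σ C).card : ℝ≥0∞) +
      Gᶜ.indicator (fun _ => ENNReal.ofReal (4 * B ^ 2)) C := fun C => by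
    by_cases hC : C ∈ G
    · rw [Set.indicator_of_mem hC]
      refine le_add_right ((ENNReal.ofReal_le_ofReal (hpt C hC)).trans
        (ENNReal.ofReal_add_le.trans ?_))
      rw [ENNReal.ofReal_mul ha, ENNReal.ofReal_natCast]
    · rw [Set.indicator_of_mem (s := Gᶜ) hC]
      refine le_add_left (ENNReal.ofReal_le_ofReal ?_)
      rw [hBd]
      exact S.sq_estimate_sub_le obs u i (h.nearest_nonempty σ _)
  refine (lintegral_mono hle).trans ?_
  rw [lintegral_add_right _ (measurable_const.indicator hGm.compl),
    lintegral_add_right _ (hcm.const_mul _), lintegral_const_mul _ hcm,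
    lintegral_indicator hGm.compl, setLIntegral_const]
  refine add_le_add (add_le_add_left ?_ _) ?_
  · exact S.lintegral_column_le i hGm (fun C c hC => S.update_mem_good obs u i hC)
      (S.measurableSet_mem_loo obs u i _ k σ) (S.loo_update obs u i _ k σ)
      (fun A => (hΦ A).ennreal_ofReal) hint
  · calc _ ≤ ENNReal.ofReal (4 * B ^ 2) * ENNReal.ofReal (4 / x) :=
          mul_le_mul_right (h.law_compl_good_le hx hBd hB hT) _
      _ = _ := by rw [← ENNReal.ofReal_mul (by positivity)]; congr 1; ring

theorem exists_lintegral_sq_err_le_of_ne (Δ Be γ : ℝ) (hB : 0 < Δ + 2 * Be) (hγ : γ ≠ 0) :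
    ∃ x₀ K : ℝ, 0 ≤ K ∧ ∀ {m n : ℕ} {Y : Type u} [MeasurableSpace Y]
      (S : ColumnModel m n Y Δ Be γ) (obs : Fin m → Fin n → Bool) (u : Fin m) (i : Fin n) (k : ℕ)
      (σ : Equiv.Perm (Fin m)) (x ε₀ : ℝ), x₀ ≤ x → S.Favourable obs u i k x ε₀ →
      ∫⁻ C, ENNReal.ofReal ((estimate (x ^ 3 / 2) k obs (S.noisy C) σ u i - S.F u (C i).1) ^ 2)
        ∂S.law ≤ ENNReal.ofReal (K * (ε₀ ^ 2 + 1 / x + 1 / k)) := by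
  obtain ⟨x₁, K₁, hK₁, hmain⟩ := exists_lintegral_card_nearest_sdiff_le.{u} Δ Be γ hγ
  generalize hBd : Δ + 2 * Be = B at hB
  obtain ⟨T, hT⟩ : ∃ T, T = 8 * B + 16 * B ^ 2 := ⟨_, rfl⟩
  have hT0 : 0 < T := by rw [hT]; positivity
  refine ⟨max (max x₁ 2) T, 6 * γ ^ 2 + 6 + (24 * T + 192 * B ^ 2) + 6 * (T + 8 * B) ^ 2 +
    32 * B ^ 2 * K₁ + 16 * B ^ 2, by positivity, ?_⟩
  intro m n Y _ S obs u i k σ x ε₀ hx hF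
  have hxT : T ≤ x := (le_max_right _ _).trans hx
  have hx2 : 2 ≤ x := ((le_max_right _ _).trans (le_max_left _ _)).trans hx
  have hx1 : x₁ ≤ x := ((le_max_left _ _).trans (le_max_left _ _)).trans hx
  have hx0 : 0 < x := by linarith
  have hk0 : (0 : ℝ) < k := by exact_mod_cast hF.k_pos
  obtain ⟨b, hb⟩ : ∃ b, b = ε₀ ^ 2 + (4 * T + 32 * B ^ 2) / x := ⟨_, rfl⟩
  have hb0 : 0 ≤ b := by rw [hb]; positivity
  obtain ⟨g, hg⟩ : ∃ g, g = T / x + 2 * B / (x ^ 3 / 4) := ⟨_, rfl⟩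
  have hE : ∀ A : Finset (Fin m), Measurable fun c : Y × (Fin m → ℝ) =>
      avg A (fun v => S.E (c.2 v)) ^ 2 := fun A =>
    ((Finset.measurable_fun_sum A fun v _ => S.measurable_E.comp
      ((measurable_pi_apply v).comp measurable_snd)).div_const _).pow_const 2
  have hM : ∀ v, Measurable fun c : Y × (Fin m → ℝ) =>
      (S.meanDiff u v - (S.F u c.1 - S.F v c.1)) ^ 2 := fun v =>
    ((((S.measurable_F u).sub (S.measurable_F v)).comp measurable_fst).const_sub _).pow_const 2
  have hMa : ∀ A : Finset (Fin m), Measurable fun c : Y × (Fin m → ℝ) =>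
      avg A (fun v => (S.meanDiff u v - (S.F u c.1 - S.F v c.1)) ^ 2) := fun A =>
    (Finset.measurable_fun_sum A fun v _ => hM v).div_const _
  have hmain2 := hF.lintegral_sq_err_le hx2 hBd.symm hB hT σ
    (Φ := fun A c => 6 * avg A (fun v => S.E (c.2 v)) ^ 2 +
      6 * avg A (fun v => (S.meanDiff u v - (S.F u c.1 - S.F v c.1)) ^ 2) + 6 * g ^ 2)
    (fun A => (((hE A).const_mul 6).add ((hMa A).const_mul 6)).add_const _)
    (a := 32 * B ^ 2 / k) (b := 6 * (γ ^ 2 / k) + 6 * b + 6 * g ^ 2) (by positivity)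
    (fun C hC => ?_) (fun C hC => ?_)
  · refine hmain2.trans ?_
    have h1 := hmain S obs u i k σ x hx1 hF.k_pos hF.m_le hF.overlap_le
    refine (add_le_add_left (add_le_add_right (mul_le_mul_right h1 _) _) _).trans ?_
    rw [← ENNReal.ofReal_mul (by positivity), ← ENNReal.ofReal_add (by positivity) (by positivity),
      ← ENNReal.ofReal_add (by positivity) (by positivity)]
    refine ENNReal.ofReal_le_ofReal ?_
    have hg2 : g ^ 2 ≤ (T + 8 * B) ^ 2 / x := by
      have hg0 : 0 ≤ g := by rw [hg]; positivity
      have : g ≤ (T + 8 * B) / x := by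
        rw [hg, add_div]
        refine add_le_add_right ?_ _
        rw [div_le_div_iff₀ (by positivity) hx0]
        have : x ≤ x ^ 3 := by nlinarith [sq_nonneg x]
        have := mul_le_mul_of_nonneg_left this hB.le
        linarith
      calc g ^ 2 ≤ ((T + 8 * B) / x) ^ 2 := pow_le_pow_left₀ hg0 this 2
        _ = (T + 8 * B) ^ 2 / x * (1 / x) := by field_simp
        _ ≤ (T + 8 * B) ^ 2 / x * 1 := mul_le_mul_of_nonneg_left
          ((div_le_one hx0).2 (by linarith)) (by positivity)
        _ = _ := mul_one _
    have e1 : 32 * B ^ 2 / (k : ℝ) * (K₁ / x * k) = 32 * B ^ 2 * K₁ / x := by field_simp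
    rw [e1, hb]
    have j1 : 0 ≤ 6 * γ ^ 2 * (ε₀ ^ 2 + 1 / x) := by positivity
    have j2 : 0 ≤ 6 * (1 / x + 1 / (k : ℝ)) := by positivity
    have j3 : 0 ≤ ((24 * T + 192 * B ^ 2) + 6 * (T + 8 * B) ^ 2 +
      32 * B ^ 2 * K₁ + 16 * B ^ 2) * (ε₀ ^ 2 + 1 / (k : ℝ)) := by positivity
    have e2 : (6 * γ ^ 2 + 6 + (24 * T + 192 * B ^ 2) + 6 * (T + 8 * B) ^ 2 +
      32 * B ^ 2 * K₁ + 16 * B ^ 2) * (ε₀ ^ 2 + 1 / x + 1 / (k : ℝ)) =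
      6 * (γ ^ 2 / k) + 6 * (ε₀ ^ 2 + (4 * T + 32 * B ^ 2) / x) + 6 * ((T + 8 * B) ^ 2 / x) +
      32 * B ^ 2 * K₁ / x + 16 * B ^ 2 / x + (6 * γ ^ 2 * (ε₀ ^ 2 + 1 / x) +
        6 * (1 / x + 1 / (k : ℝ)) + ((24 * T + 192 * B ^ 2) + 6 * (T + 8 * B) ^ 2 +
      32 * B ^ 2 * K₁ + 16 * B ^ 2) * (ε₀ ^ 2 + 1 / (k : ℝ))) := by ring
    rw [e2]
    linarith
  · have hne := hF.nearest_nonempty σ (S.noisy C)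
    rw [estimate_sub_eq hne]
    have h1 := sq_avg_le_of_card_eq (S.card_loo_eq obs u i (x ^ 3 / 2) k σ C) hne
      (S.abs_rowErr_le obs u i C)
    have h2 := S.sq_avg_rowErr_le obs u i (T := S.loo obs u i (x ^ 3 / 2) k σ C)
      (q := x ^ 3 / 4) (by positivity) (by positivity) hC
      (fun v hv => by linarith [(hF.card hx2 v hv).1.2.1]) topk_subset
    rw [hBd] at h1 h2
    rw [hF.nearest_card] at h1
    have e : 8 * (2 * B) ^ 2 / (k : ℝ) = 32 * B ^ 2 / k := by ring
    rw [e] at h1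
    rw [hg]
    refine h1.trans ?_
    linarith
  · rw [lintegral_congr fun c => ENNReal.ofReal_add (by
        have := avg_nonneg (O := S.loo obs u i (x ^ 3 / 2) k σ C) fun v _ =>
          sq_nonneg (S.meanDiff u v - (S.F u c.1 - S.F v c.1))
        positivity) (by positivity),
      lintegral_add_right _ measurable_const, lintegral_const, measure_univ, mul_one]
    rw [ENNReal.ofReal_add (by positivity) (by positivity)]
    refine add_le_add_left ?_ _
    rw [lintegral_congr fun c => ENNReal.ofReal_add (by positivity) (by
        have := avg_nonneg (O := S.loo obs u i (x ^ 3 / 2) k σ C) fun v _ =>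
          sq_nonneg (S.meanDiff u v - (S.F u c.1 - S.F v c.1))
        positivity), lintegral_add_right _ ((hMa _).const_mul 6).ennreal_ofReal,
      ENNReal.ofReal_add (by positivity) (by positivity)]
    refine add_le_add ?_ ?_
    · simp only [ENNReal.ofReal_mul (show (0 : ℝ) ≤ 6 by norm_num)]
      rw [lintegral_const_mul _ (hE _).ennreal_ofReal, S.lintegral_sq_avg_noise i,
        S.card_loo_eq, hF.nearest_card]
    · simp only [ENNReal.ofReal_mul (show (0 : ℝ) ≤ 6 by norm_num)]
      rw [lintegral_const_mul _ (hMa _).ennreal_ofReal]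
      refine mul_le_mul_right (lintegral_avg_le hM (fun v c => sq_nonneg _) hb0 fun v hv => ?_) _
      rw [S.lintegral_sq_mean_sub u i]
      refine ENNReal.ofReal_le_ofReal ?_
      rw [hb]
      exact hF.varDiff_le hx2 hBd.symm hxT hC hv

theorem exists_lintegral_sq_err_le_of_eq (Δ Be : ℝ) (hB : 0 < Δ + 2 * Be) :
    ∃ x₀ K : ℝ, 0 ≤ K ∧ ∀ {m n : ℕ} {Y : Type u} [MeasurableSpace Y]
      (S : ColumnModel m n Y Δ Be 0) (obs : Fin m → Fin n → Bool) (u : Fin m) (i : Fin n) (k : ℕ)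
      (σ : Equiv.Perm (Fin m)) (x ε₀ : ℝ), x₀ ≤ x → S.Favourable obs u i k x ε₀ →
      ∫⁻ C, ENNReal.ofReal ((estimate (x ^ 3 / 2) k obs (S.noisy C) σ u i - S.F u (C i).1) ^ 2)
        ∂S.law ≤ ENNReal.ofReal (K * (ε₀ ^ 2 + 1 / x + 1 / k)) := by
  generalize hBd : Δ + 2 * Be = B at hB
  obtain ⟨T, hT⟩ : ∃ T, T = 8 * B + 16 * B ^ 2 := ⟨_, rfl⟩
  have hT0 : 0 < T := by rw [hT]; positivity
  refine ⟨max 2 T, 128 + 128 * (4 * T + 32 * B ^ 2) + 128 * T ^ 2 + 16 * B ^ 2,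
    by positivity, ?_⟩
  intro m n Y _ S obs u i k σ x ε₀ hx hF
  have hxT : T ≤ x := (le_max_right _ _).trans hx
  have hx2 : 2 ≤ x := (le_max_left _ _).trans hx
  have hx0 : 0 < x := by linarith
  have hk0 : (0 : ℝ) < k := by exact_mod_cast hF.k_pos
  obtain ⟨b, hb⟩ : ∃ b, b = ε₀ ^ 2 + (4 * T + 32 * B ^ 2) / x := ⟨_, rfl⟩
  have hb0 : 0 ≤ b := by rw [hb]; positivity
  have hE : Measurable fun c : Y × (Fin m → ℝ) => S.E (c.2 u) ^ 2 :=
    (S.measurable_E.comp ((measurable_pi_apply u).comp measurable_snd)).pow_const 2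
  have hM : ∀ v, Measurable fun c => (S.diff u v c - S.meanDiff u v) ^ 2 := fun v =>
    ((S.measurable_diff u v).sub_const _).pow_const 2
  have hMa : ∀ A : Finset (Fin m), Measurable fun c =>
      avg A (fun v => (S.diff u v c - S.meanDiff u v) ^ 2) := fun A =>
    (Finset.measurable_fun_sum A fun v _ => hM v).div_const _
  have hmain2 := hF.lintegral_sq_err_le hx2 hBd.symm hB hT σ
    (Φ := fun A c => 2 * S.E (c.2 u) ^ 2 +
      128 * avg A (fun v => (S.diff u v c - S.meanDiff u v) ^ 2) + 128 * (T / x) ^ 2)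
    (fun A => ((hE.const_mul 2).add ((hMa A).const_mul 128)).add_const _)
    (a := 0) (b := 128 * b + 128 * (T / x) ^ 2) le_rfl
    (fun C hC => ?_) (fun C hC => ?_)
  · refine hmain2.trans ?_
    rw [ENNReal.ofReal_zero, zero_mul, add_zero, ← ENNReal.ofReal_add (by positivity) (by positivity)]
    refine ENNReal.ofReal_le_ofReal ?_
    have hg2 : (T / x) ^ 2 ≤ T ^ 2 / x := by
      calc (T / x) ^ 2 = T ^ 2 / x * (1 / x) := by field_simp
        _ ≤ T ^ 2 / x * 1 := mul_le_mul_of_nonneg_left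
          ((div_le_one hx0).2 (by linarith)) (by positivity)
        _ = _ := mul_one _
    rw [hb]
    have j2 : 0 ≤ 128 * (1 / x + 1 / (k : ℝ)) := by positivity
    have j3 : 0 ≤ (128 * (4 * T + 32 * B ^ 2) + 128 * T ^ 2 + 16 * B ^ 2) *
      (ε₀ ^ 2 + 1 / (k : ℝ)) := by positivity
    have e2 : (128 + 128 * (4 * T + 32 * B ^ 2) + 128 * T ^ 2 + 16 * B ^ 2) *
      (ε₀ ^ 2 + 1 / x + 1 / (k : ℝ)) =
      128 * (ε₀ ^ 2 + (4 * T + 32 * B ^ 2) / x) + 128 * (T ^ 2 / x) + 16 * B ^ 2 / x +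
      (128 * (1 / x + 1 / (k : ℝ)) + (128 * (4 * T + 32 * B ^ 2) + 128 * T ^ 2 + 16 * B ^ 2) *
      (ε₀ ^ 2 + 1 / (k : ℝ))) := by ring
    rw [e2]
    linarith
  · have hne := hF.nearest_nonempty σ (S.noisy C)
    rw [estimate_sub_eq hne, zero_mul, add_zero]
    have hcc : (0 : ℝ) < (nearest (x ^ 3 / 2) k obs (S.noisy C) σ u i).card := by
      exact_mod_cast hne.card_pos
    have hcard := S.card_loo_eq obs u i (x ^ 3 / 2) k σ C
    have h1 : avg (nearest (x ^ 3 / 2) k obs (S.noisy C) σ u i)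
        (fun v => S.rowErr obs u i C v ^ 2) ≤ 2 * S.E ((C i).2 u) ^ 2 +
        2 * avg (nearest (x ^ 3 / 2) k obs (S.noisy C) σ u i)
          (fun v => (S.diff u v (C i) - diffMean obs (S.noisy C) u v) ^ 2) := by
      have e : 2 * S.E ((C i).2 u) ^ 2 =
          avg (nearest (x ^ 3 / 2) k obs (S.noisy C) σ u i) fun _ => 2 * S.E ((C i).2 u) ^ 2 := by
        unfold avg
        rw [Finset.sum_const, nsmul_eq_mul, mul_div_cancel_left₀ _ hcc.ne']
      rw [e, ← avg_const_mul, ← avg_add]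
      refine avg_mono fun v _ => ?_
      rw [S.rowErr_eq' obs u i C v]
      nlinarith [sq_nonneg (S.E ((C i).2 u) - (diffMean obs (S.noisy C) u v - S.diff u v (C i)))]
    have h2 : avg (S.loo obs u i (x ^ 3 / 2) k σ C) (fun v => (S.diff u v (C i) -
        avg ((overlap obs u v).erase i) fun j => S.diff u v (C j)) ^ 2) ≤
        2 * avg (S.loo obs u i (x ^ 3 / 2) k σ C)
          (fun v => (S.diff u v (C i) - S.meanDiff u v) ^ 2) + 2 * (T / x) ^ 2 := by
      have e : 2 * (T / x) ^ 2 = avg (S.loo obs u i (x ^ 3 / 2) k σ C)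
          fun _ => 2 * (T / x) ^ 2 := by
        unfold avg
        rw [Finset.sum_const, nsmul_eq_mul, mul_div_cancel_left₀]
        rw [hcard]; exact hcc.ne'
      rw [e, ← avg_const_mul, ← avg_add]
      refine avg_mono fun v hv => ?_
      have h3 := (hC v (topk_subset hv)).2
      set w := avg ((overlap obs u v).erase i) fun j => S.diff u v (C j)
      have h4 : (w - S.meanDiff u v) ^ 2 ≤ (T / x) ^ 2 := by
        rw [← sq_abs]; exact pow_le_pow_left₀ (abs_nonneg _) h3.le 2
      nlinarith [sq_nonneg ((S.diff u v (C i) - S.meanDiff u v) + (w - S.meanDiff u v))]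
    have h3 : avg (nearest (x ^ 3 / 2) k obs (S.noisy C) σ u i)
          (fun v => (S.diff u v (C i) - diffMean obs (S.noisy C) u v) ^ 2) ≤
        32 * avg (S.loo obs u i (x ^ 3 / 2) k σ C) (fun v => (S.diff u v (C i) -
          avg ((overlap obs u v).erase i) fun j => S.diff u v (C j)) ^ 2) := by
      have hsum : ∑ v ∈ nearest (x ^ 3 / 2) k obs (S.noisy C) σ u i,
          (S.diff u v (C i) - diffMean obs (S.noisy C) u v) ^ 2 ≤
          32 * ∑ v ∈ S.loo obs u i (x ^ 3 / 2) k σ C, (S.diff u v (C i) -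
          avg ((overlap obs u v).erase i) fun j => S.diff u v (C j)) ^ 2 := by
        by_cases hi : obs u i = true
        · exact S.sum_nearest_sq_le obs u i (by positivity) hi
            (fun v hv => (hF.card hx2 v hv).1) C
        · rw [Bool.not_eq_true] at hi
          rw [S.loo_eq_nearest_of_not_obs obs u i _ k σ C hi]
          have e : ∀ v, (overlap obs u v).erase i = overlap obs u v := fun v =>
            Finset.erase_eq_of_notMem (by simp [mem_overlap, hi])
          simp only [e, ← S.diffMean_noisy]
          have := Finset.sum_nonneg (s := nearest (x ^ 3 / 2) k obs (S.noisy C) σ u i) fun v _ =>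
            sq_nonneg (S.diff u v (C i) - diffMean obs (S.noisy C) u v)
          linarith
      unfold avg
      rw [hcard, ← mul_div_assoc]
      exact div_le_div_of_nonneg_right hsum hcc.le
    refine (sq_avg_le _ _).trans (h1.trans ?_)
    linarith
  · have hnn : ∀ c, 0 ≤ avg (S.loo obs u i (x ^ 3 / 2) k σ C)
        fun v => (S.diff u v c - S.meanDiff u v) ^ 2 := fun c => avg_nonneg fun v _ => sq_nonneg _
    rw [lintegral_congr fun c => ENNReal.ofReal_add (by
        have := hnn c
        positivity) (by positivity),
      lintegral_add_right _ measurable_const, lintegral_const, measure_univ, mul_one]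
    rw [ENNReal.ofReal_add (by positivity) (by positivity)]
    refine add_le_add_left ?_ _
    rw [lintegral_congr fun c => ENNReal.ofReal_add (by positivity) (by
        have := hnn c
        positivity), lintegral_add_right _ ((hMa _).const_mul 128).ennreal_ofReal]
    have hE0 : ∫⁻ c, ENNReal.ofReal (2 * S.E (c.2 u) ^ 2) ∂(S.κ i) = 0 := by
      simp only [ENNReal.ofReal_mul (show (0 : ℝ) ≤ 2 by norm_num)]
      rw [lintegral_const_mul _ hE.ennreal_ofReal]
      have := S.lintegral_sq_avg_noise i {u}
      simp only [avg, Finset.sum_singleton, Finset.card_singleton, Nat.cast_one, div_one] at this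
      rw [this]
      simp
    rw [hE0, zero_add]
    simp only [ENNReal.ofReal_mul (show (0 : ℝ) ≤ 128 by norm_num)]
    rw [lintegral_const_mul _ (hMa _).ennreal_ofReal]
    refine mul_le_mul_right (lintegral_avg_le hM (fun v c => sq_nonneg _) hb0 fun v hv => ?_) _
    rw [S.lintegral_diff_sub_sq (mem_candidates.1 (topk_subset hv)).1.symm i]
    refine ENNReal.ofReal_le_ofReal ?_
    have := hF.varDiff_le hx2 hBd.symm hxT hC hv
    rw [hb]
    linarith

theorem exists_lintegral_sq_err_le (Δ Be γ : ℝ) :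
    ∃ x₀ K : ℝ, 0 ≤ K ∧ ∀ {m n : ℕ} {Y : Type u} [MeasurableSpace Y]
      (S : ColumnModel m n Y Δ Be γ) (obs : Fin m → Fin n → Bool) (u : Fin m) (i : Fin n) (k : ℕ)
      (σ : Equiv.Perm (Fin m)) (x ε₀ : ℝ), x₀ ≤ x → S.Favourable obs u i k x ε₀ →
      ∫⁻ C, ENNReal.ofReal ((estimate (x ^ 3 / 2) k obs (S.noisy C) σ u i - S.F u (C i).1) ^ 2)
        ∂S.law ≤ ENNReal.ofReal (K * (ε₀ ^ 2 + 1 / x + 1 / k)) := by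
  rcases lt_or_ge 0 (Δ + 2 * Be) with hB | hB
  · rcases eq_or_ne γ 0 with rfl | hγ
    · exact exists_lintegral_sq_err_le_of_eq Δ Be hB
    · exact exists_lintegral_sq_err_le_of_ne Δ Be γ hB hγ
  · refine ⟨0, 0, le_rfl, fun S obs u i k σ x ε₀ _ hF => ?_⟩
    obtain ⟨G, hG, hk, -⟩ := hF.close
    have hB0 : Δ + 2 * Be = 0 := le_antisymm hB (by linarith [S.Δ_nonneg, S.Be_nonneg])
    rw [zero_mul, ENNReal.ofReal_zero, nonpos_iff_eq_zero]
    refine (lintegral_congr fun C => ?_).trans lintegral_zero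
    have hne : (nearest (x ^ 3 / 2) k obs (S.noisy C) σ u i).Nonempty := by
      rw [← Finset.card_pos, nearest_card_eq obs u i hG hk]
      exact hF.k_pos
    have := S.sq_estimate_sub_le obs u i hne
    rw [hB0] at this
    exact ENNReal.ofReal_of_nonpos (by linarith)

end ColumnModel

/-! ### Random rows and masks -/

theorem measure_pi_le_of_update {ι : Type*} [Fintype ι] [DecidableEq ι] {α : ι → Type*}
    [∀ i, MeasurableSpace (α i)] (μ : ∀ i, Measure (α i)) [∀ i, IsProbabilityMeasure (μ i)]
    (i : ι) {A : Set (∀ i, α i)} (hA : MeasurableSet A) {bad : Set (α i)}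
    (hbad : MeasurableSet bad) {a b : ℝ≥0∞} (ha : μ i bad ≤ a)
    (hb : ∀ r, r ∉ bad → Measure.pi μ {c | Function.update c i r ∈ A} ≤ b) :
    Measure.pi μ A ≤ a + b := by
  have hmp := measurePreserving_update μ i
  rw [← hmp.measure_preimage hA.nullMeasurableSet, Measure.prod_apply_symm (hmp.measurable hA)]
  calc _ ≤ ∫⁻ r, (bad.indicator 1 r + b) ∂(μ i) := by
        refine lintegral_mono fun r => ?_
        by_cases hr : r ∈ bad
        · rw [Set.indicator_of_mem hr]
          exact le_add_right prob_le_one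
        · exact le_add_left (hb r hr)
    _ = μ i bad + b := by
        rw [lintegral_add_right _ measurable_const, lintegral_indicator_one hbad, lintegral_const,
          measure_univ, mul_one]
    _ ≤ a + b := add_le_add_left ha _

section Mask

theorem measureReal_true_eq {n : ℕ} (ρ : Fin n → Measure Bool) {p : ℝ} (hp0 : 0 ≤ p)
    (hρ : ∀ j, ρ j {true} = ENNReal.ofReal p) (j : Fin n) : (ρ j).real {true} = p := by
  rw [measureReal_def, hρ, ENNReal.toReal_ofReal hp0]

/-- The mask that is recorded in the row data. -/
def maskOf {m n : ℕ} {X : Type*} (R : Fin m → X × (Fin n → Bool)) (v : Fin m) (j : Fin n) : Bool :=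
  (R v).2 j

theorem overlap_maskOf_update {m n : ℕ} {X : Type*} {R : Fin m → X × (Fin n → Bool)} {u v : Fin m}
    (huv : v ≠ u) (r : X × (Fin n → Bool)) :
    overlap (maskOf (Function.update R u r)) u v =
      (Finset.univ.filter fun j => r.2 j = true).filter fun j => (R v).2 j = true := by
  unfold overlap maskOf
  rw [Finset.filter_filter]
  simp [huv]

variable {n : ℕ} (ρ : Fin n → Measure Bool) [∀ j, IsProbabilityMeasure (ρ j)] {p : ℝ}

theorem sum_indicator_true {n : ℕ} (s : Finset (Fin n)) (o : Fin n → Bool) :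
    ∑ j ∈ s, ({true} : Set Bool).indicator (1 : Bool → ℝ) (o j) =
      ((s.filter fun j => o j = true).card : ℝ) := by
  rw [Finset.card_filter]
  push_cast
  refine Finset.sum_congr rfl fun j _ => ?_
  by_cases h : o j = true <;> simp [h]

theorem mask_count_le (hp0 : 0 ≤ p) (hρ : ∀ j, ρ j {true} = ENNReal.ofReal p) (s : Finset (Fin n))
    {q : ℝ} (hq : 0 < q) (hqs : q ≤ s.card * p) :
    Measure.pi ρ {o | ((s.filter fun j => o j = true).card : ℝ) ≤ 3 / 4 * q} ≤
      ENNReal.ofReal (16 / q) := by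
  have := measure_count_le ρ (E := fun _ => {true}) (fun _ => MeasurableSet.singleton _) s hq
    (by simpa [measureReal_true_eq ρ hp0 hρ] using hqs)
  simpa only [sum_indicator_true] using this

theorem mask_count_ge (hp0 : 0 ≤ p) (hρ : ∀ j, ρ j {true} = ENNReal.ofReal p) (s : Finset (Fin n))
    {q K : ℝ} (hqs : s.card * p ≤ q) :
    Measure.pi ρ {o | K ≤ ((s.filter fun j => o j = true).card : ℝ)} ≤
      ENNReal.ofReal (Real.exp (2 * q - K)) := by
  have := measure_count_ge ρ (E := fun _ => {true}) (fun _ => MeasurableSet.singleton _) s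
    (K := K) (q := q) (by simpa [measureReal_true_eq ρ hp0 hρ] using hqs)
  simpa only [sum_indicator_true] using this

/-- With probability at least `p / 2`, column `i` is observed and the mask meets a given large set
of columns sufficiently often. -/
theorem le_mask_overlap (hp0 : 0 < p) (hρ : ∀ j, ρ j {true} = ENNReal.ofReal p)
    (i : Fin n) (s : Finset (Fin n)) (hi : i ∉ s) {q : ℝ} (hq : 32 ≤ q) (hqs : q ≤ s.card * p) :
    p / 2 ≤ (Measure.pi ρ).real
      {o | o i = true ∧ 3 / 4 * q < ((s.filter fun j => o j = true).card : ℝ)} := by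
  set F : Set (Fin n → Bool) := {o | 3 / 4 * q < ((s.filter fun j => o j = true).card : ℝ)} with hF
  have hmeas : ∀ A : Set (Fin n → Bool), MeasurableSet A := fun A => A.to_countable.measurableSet
  have h1 : 1 / 2 ≤ (Measure.pi ρ).real F := by
    have h2 := mask_count_le ρ hp0.le hρ s (by linarith) hqs
    have h3 : (Measure.pi ρ).real Fᶜ ≤ 1 / 2 := by
      have e : Fᶜ = {o | ((s.filter fun j => o j = true).card : ℝ) ≤ 3 / 4 * q} := by
        ext o; simp [hF]
      rw [e, measureReal_def]
      refine (ENNReal.toReal_mono ENNReal.ofReal_ne_top h2).trans ?_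
      rw [ENNReal.toReal_ofReal (by positivity), div_le_div_iff₀ (by linarith) (by norm_num)]
      linarith
    rw [probReal_compl_eq_one_sub (hmeas F)] at h3
    linarith
  have hmp := measurePreserving_update ρ i
  have h4 : (Measure.pi ρ).real (F ∩ {o | o i = true}) = (Measure.pi ρ).real F * p := by
    rw [measureReal_def, ← hmp.measure_preimage (hmeas _).nullMeasurableSet]
    have e : (fun c : (Fin n → Bool) × Bool => Function.update c.1 i c.2) ⁻¹'
        (F ∩ {o | o i = true}) = F ×ˢ {true} := by
      ext ⟨o, b⟩
      have : ∀ b', (s.filter fun j => Function.update o i b' j = true) =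
          s.filter fun j => o j = true := fun b' => Finset.filter_congr fun j hj => by
        rw [Function.update_of_ne (by rintro rfl; exact hi hj)]
      simp [hF, this]
    rw [e, Measure.prod_prod, hρ, ENNReal.toReal_mul, ENNReal.toReal_ofReal hp0.le]
    rfl
  have e : {o : Fin n → Bool | o i = true ∧ 3 / 4 * q < ((s.filter fun j => o j = true).card : ℝ)} =
      F ∩ {o | o i = true} := by
    ext o; simp [hF, and_comm]
  rw [e, h4]
  nlinarith

end Mask

/-- In a cube with the uniform measure, every ball of relative radius `l` has mass at least
`l ^ d`. -/
theorem le_cond_cube_ball {d : ℕ} (a : Fin d → ℝ) {s : ℝ} (hs : 0 < s)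
    (N : Seminorm ℝ (Fin d → ℝ)) {D : ℝ}
    (hD : ∀ x ∈ cube a s, ∀ x' ∈ cube a s, N (x - x') ≤ D) {l : ℝ} (hl : 0 ≤ l) (hl1 : l ≤ 1)
    {z : Fin d → ℝ} (hz : z ∈ cube a s) :
    l ^ d ≤ (ProbabilityTheory.cond volume (cube a s)).real {y | N (z - y) ≤ l * D} := by
  have hconv : Convex ℝ (cube a s) := convex_Icc _ _
  have hQm : MeasurableSet (cube a s) := measurableSet_Icc
  have hvol : volume (cube a s) = ENNReal.ofReal (s ^ d) := by
    rw [cube, Real.volume_Icc_pi]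
    simp [ENNReal.ofReal_pow hs.le]
  have hsub : AffineMap.homothety z l '' cube a s ⊆ cube a s ∩ {y | N (z - y) ≤ l * D} := by
    rintro _ ⟨y, hy, rfl⟩
    have e : AffineMap.homothety z l y = (1 - l) • z + l • y := by
      rw [AffineMap.homothety_apply, vsub_eq_sub, vadd_eq_add, smul_sub, sub_smul, one_smul]
      abel
    refine ⟨?_, ?_⟩
    · rw [e]
      exact hconv hz hy (by linarith) hl (by ring)
    · rw [Set.mem_ofPred_eq, e]
      have e2 : z - ((1 - l) • z + l • y) = l • (z - y) := by
        rw [smul_sub, sub_smul, one_smul]; abel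
      rw [e2, map_smul_eq_mul, Real.norm_eq_abs, abs_of_nonneg hl]
      exact mul_le_mul_of_nonneg_left (hD z hz y hy) hl
  have hle := measure_mono (μ := volume) hsub
  rw [Measure.addHaar_image_homothety, Module.finrank_fin_fun, abs_of_nonneg (by positivity)] at hle
  rw [measureReal_def, ProbabilityTheory.cond_apply hQm]
  have hfin : (volume (cube a s))⁻¹ * volume (cube a s ∩ {y | N (z - y) ≤ l * D}) ≠ ⊤ := by
    refine ENNReal.mul_ne_top (ENNReal.inv_ne_top.2 ?_) (measure_ne_top_of_subset
      Set.inter_subset_left ?_)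
    · rw [hvol]; simpa using pow_pos hs d
    · rw [hvol]; exact ENNReal.ofReal_ne_top
  have h2 : ENNReal.ofReal (l ^ d) ≤
      (volume (cube a s))⁻¹ * volume (cube a s ∩ {y | N (z - y) ≤ l * D}) := by
    calc ENNReal.ofReal (l ^ d) =
          (volume (cube a s))⁻¹ * (ENNReal.ofReal (l ^ d) * volume (cube a s)) := by
          rw [mul_left_comm, ENNReal.inv_mul_cancel, mul_one]
          · rw [hvol]; simpa using pow_pos hs d
          · rw [hvol]; exact ENNReal.ofReal_ne_top
      _ ≤ _ := mul_le_mul_right hle _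
  have := ENNReal.toReal_mono hfin h2
  rwa [ENNReal.toReal_ofReal (by positivity)] at this

section Rows

variable {m n : ℕ} {X : Type*} [MeasurableSpace X] (P₁ : Measure X) [IsProbabilityMeasure P₁]
  (ρ : Fin m → Fin n → Measure Bool) [∀ v j, IsProbabilityMeasure (ρ v j)] {p : ℝ}

/-- The law of all row data. -/
noncomputable def rowLaw : Measure (Fin m → X × (Fin n → Bool)) :=
  Measure.pi fun v => P₁.prod (Measure.pi (ρ v))

instance : IsProbabilityMeasure (rowLaw P₁ ρ) := by
  unfold rowLaw; infer_instance

theorem measurable_maskOf : Measurable (maskOf : (Fin m → X × (Fin n → Bool)) → _) :=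
  measurable_pi_iff.2 fun v => measurable_snd.comp (measurable_pi_apply v)

theorem measurableSet_mask (A : Set (Fin m → Fin n → Bool)) :
    MeasurableSet {R : Fin m → X × (Fin n → Bool) | maskOf R ∈ A} :=
  measurable_maskOf A.to_countable.measurableSet

theorem rowLaw_overlap_gt_le (hp0 : 0 ≤ p) (hρ : ∀ v j, ρ v j {true} = ENNReal.ofReal p)
    (u : Fin m) :
    rowLaw P₁ ρ {R | ∃ v, v ≠ u ∧ 8 * (n * p ^ 2) < ((overlap (maskOf R) u v).card : ℝ)} ≤
      ENNReal.ofReal (Real.exp (-(n * p))) + ENNReal.ofReal (m * Real.exp (-(2 * (n * p ^ 2)))) := by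
  refine measure_pi_le_of_update _ u
    (measurableSet_mask {o | ∃ v, v ≠ u ∧ 8 * (n * p ^ 2) < ((overlap o u v).card : ℝ)})
    (bad := {r | 3 * (n * p) ≤ ((Finset.univ.filter fun j => r.2 j = true).card : ℝ)}) ?_ ?_ ?_
  · exact measurable_snd (Set.to_countable {o : Fin n → Bool |
      3 * (n * p) ≤ ((Finset.univ.filter fun j => o j = true).card : ℝ)}).measurableSet
  · have h := mask_count_ge (ρ u) hp0 (hρ u) Finset.univ (q := n * p) (K := 3 * (n * p)) (by simp)
    have e : 2 * (n * p) - 3 * (n * p) = -(n * p) := by ring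
    rw [e] at h
    refine le_trans (le_of_eq ?_) h
    exact (measurePreserving_snd (μ := P₁) (ν := Measure.pi (ρ u))).measure_preimage
      (Set.to_countable {o : Fin n → Bool | 3 * (n * p) ≤
        ((Finset.univ.filter fun j => o j = true).card : ℝ)}).measurableSet.nullMeasurableSet
  · intro r hr
    rw [Set.mem_ofPred_eq, not_le] at hr
    have hsub : {R : Fin m → X × (Fin n → Bool) | Function.update R u r ∈ {R | maskOf R ∈ {o |
        ∃ v, v ≠ u ∧ 8 * (n * p ^ 2) < ((overlap o u v).card : ℝ)}}} ⊆
        ⋃ v ∈ (Finset.univ : Finset (Fin m)), (fun R => (R v).2) ⁻¹' {o | 8 * (n * p ^ 2) ≤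
          (((Finset.univ.filter fun j => r.2 j = true).filter fun j => o j = true).card : ℝ)} := by
      rintro R ⟨v, hvu, hlt⟩
      rw [overlap_maskOf_update hvu] at hlt
      simp only [Set.mem_iUnion]
      exact ⟨v, Finset.mem_univ v, hlt.le⟩
    refine (measure_mono hsub).trans ((measure_biUnion_finset_le _ _).trans ?_)
    calc _ ≤ ∑ _v : Fin m, ENNReal.ofReal (Real.exp (-(2 * (n * p ^ 2)))) := by
          refine Finset.sum_le_sum fun v _ => ?_
          have h := mask_count_ge (ρ v) hp0 (hρ v) (Finset.univ.filter fun j => r.2 j = true)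
            (q := 3 * (n * p ^ 2)) (K := 8 * (n * p ^ 2)) (by nlinarith)
          have e : 2 * (3 * (n * p ^ 2)) - 8 * (n * p ^ 2) = -(2 * (n * p ^ 2)) := by ring
          rw [e] at h
          refine le_trans (le_of_eq ?_) h
          have hmp : MeasurePreserving (fun R : Fin m → X × (Fin n → Bool) => (R v).2)
              (Measure.pi fun v => P₁.prod (Measure.pi (ρ v))) (Measure.pi (ρ v)) :=
            measurePreserving_snd.comp (measurePreserving_eval _ v)
          exact hmp.measure_preimage (Set.to_countable _).measurableSet.nullMeasurableSet
      _ = _ := by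
          rw [Finset.sum_const, nsmul_eq_mul, ENNReal.ofReal_mul (Nat.cast_nonneg m),
            ENNReal.ofReal_natCast, Finset.card_univ, Fintype.card_fin]

open Classical in
/-- The candidates whose row feature is close to that of row `u`. -/
noncomputable def closeCandidates (β : ℝ) (Cl : Set (X × X)) (R : Fin m → X × (Fin n → Bool))
    (u : Fin m) (i : Fin n) : Finset (Fin m) :=
  (candidates β (maskOf R) u i).filter fun v => ((R u).1, (R v).1) ∈ Cl

theorem rowLaw_few_close_le (hp0 : 0 < p) (hp1 : p ≤ 1)
    (hρ : ∀ v j, ρ v j {true} = ENNReal.ofReal p)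
    {Cl : Set (X × X)} (hCl : MeasurableSet Cl) {Q : Set X} (hQ : MeasurableSet Q)
    (hQ1 : P₁ Qᶜ = 0) {x : ℝ} (hx : 8 ≤ x) (hx3 : x ^ 3 = m * p)
    (hmass : ∀ z ∈ Q, 1 / x ^ 2 ≤ P₁.real {y | (z, y) ∈ Cl}) (hN : 64 ≤ n * p ^ 2)
    {k : ℕ} (hk : (k : ℝ) ≤ x / 8 + 1) (u : Fin m) (i : Fin n) :
    rowLaw P₁ ρ {R | (closeCandidates (n * p ^ 2 / 2) Cl R u i).card < k} ≤
      ENNReal.ofReal (32 / (n * p ^ 2)) + ENNReal.ofReal (48 / x) := by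
  classical
  have hx0 : 0 < x := by linarith
  have hn : (64 : ℝ) ≤ n := by nlinarith [sq_nonneg (1 - p), (Nat.cast_nonneg n : (0 : ℝ) ≤ n)]
  have hm : (3 : ℝ) ≤ m := by
    have : (512 : ℝ) ≤ x ^ 3 := by nlinarith [sq_nonneg x]
    nlinarith [(Nat.cast_nonneg m : (0 : ℝ) ≤ m)]
  have hAm : MeasurableSet {R : Fin m → X × (Fin n → Bool) |
      (closeCandidates (n * p ^ 2 / 2) Cl R u i).card < k} := by
    refine measurableSet_lt ?_ measurable_const
    simp only [closeCandidates, Finset.card_filter, candidates, Finset.sum_filter]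
    refine Finset.measurable_fun_sum _ fun v _ => Measurable.ite ?_ (Measurable.ite ?_
      measurable_const measurable_const) measurable_const
    · exact measurableSet_mask {o | v ≠ u ∧ o v i = true ∧
        n * p ^ 2 / 2 ≤ ((overlap o u v).card : ℝ)}
    · exact ((measurable_fst.comp (measurable_pi_apply u)).prodMk
        (measurable_fst.comp (measurable_pi_apply v))) hCl
  have hcardi : ((Finset.univ.erase i).card : ℝ) = n - 1 := by
    rw [Finset.card_erase_of_mem (Finset.mem_univ i), Finset.card_univ, Fintype.card_fin,
      Nat.cast_pred]
    have : (0 : ℝ) < n := by linarith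
    exact_mod_cast this
  set sO : (Fin n → Bool) → Finset (Fin n) := fun o =>
    (Finset.univ.erase i).filter fun j => o j = true with hsO
  refine measure_pi_le_of_update _ u hAm
    (bad := {r | r.1 ∉ Q ∨ ((sO r.2).card : ℝ) ≤ 3 / 4 * ((n - 1) * p)}) ?_ ?_ ?_
  · exact (measurable_fst hQ.compl).union (measurable_snd (Set.to_countable {o : Fin n → Bool |
      ((sO o).card : ℝ) ≤ 3 / 4 * ((n - 1) * p)}).measurableSet)
  · have h1 := mask_count_le (ρ u) hp0.le (hρ u) (Finset.univ.erase i) (q := (n - 1) * p)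
      (mul_pos (by linarith) hp0) (by rw [hcardi])
    have h2 : (P₁.prod (Measure.pi (ρ u))) (Prod.fst ⁻¹' Qᶜ) = 0 := by
      rw [(measurePreserving_fst (μ := P₁) (ν := Measure.pi (ρ u))).measure_preimage
        hQ.compl.nullMeasurableSet, hQ1]
    have h3 : (P₁.prod (Measure.pi (ρ u))) (Prod.snd ⁻¹' {o | ((sO o).card : ℝ) ≤
        3 / 4 * ((n - 1) * p)}) ≤ ENNReal.ofReal (16 / ((n - 1) * p)) := by
      rw [(measurePreserving_snd (μ := P₁) (ν := Measure.pi (ρ u))).measure_preimage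
        (Set.to_countable _).measurableSet.nullMeasurableSet]
      exact h1
    refine (measure_union_le (Prod.fst ⁻¹' Qᶜ) (Prod.snd ⁻¹' {o | ((sO o).card : ℝ) ≤
        3 / 4 * ((n - 1) * p)})).trans ?_
    rw [h2, zero_add]
    refine h3.trans (ENNReal.ofReal_le_ofReal ?_)
    rw [div_le_div_iff₀ (mul_pos (by linarith) hp0) (by linarith)]
    have : n * p ^ 2 ≤ n * p := by
      have := mul_le_mul_of_nonneg_left hp1 (by positivity : 0 ≤ (n : ℝ) * p)
      linarith
    nlinarith
  · rintro ⟨z, o⟩ hr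
    simp only [Set.mem_ofPred_eq, not_or, not_not, not_le] at hr
    obtain ⟨hz, ho⟩ := hr
    set q : ℝ := (sO o).card * p with hq
    have hq1 : 2 / 3 * (n * p ^ 2) ≤ q := by
      have h1 : 2 / 3 * (n * p) ≤ 3 / 4 * ((n - 1) * p) := by nlinarith
      have h2 : 2 / 3 * (n * p) * p ≤ q := mul_le_mul_of_nonneg_right (h1.trans ho.le) hp0.le
      calc _ = 2 / 3 * (n * p) * p := by ring
        _ ≤ _ := h2
    have hover := fun v => le_mask_overlap (ρ v) hp0 (hρ v) i (sO o) (by simp [hsO]) (q := q)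
      (by linarith) le_rfl
    set E : Set (X × (Fin n → Bool)) := {y | (z, y) ∈ Cl} ×ˢ
      {o' | o' i = true ∧ 3 / 4 * q < (((sO o).filter fun j => o' j = true).card : ℝ)} with hE
    have hEm : MeasurableSet E :=
      (measurable_prodMk_left hCl).prod (Set.to_countable _).measurableSet
    have hEp : ∀ v, 1 / x ^ 2 * (p / 2) ≤ (P₁.prod (Measure.pi (ρ v))).real E := fun v => by
      rw [hE, measureReal_prod_prod]
      exact mul_le_mul (hmass z hz) (hover v) (by positivity) measureReal_nonneg
    have hcardu : ((Finset.univ.erase u).card : ℝ) = m - 1 := by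
      rw [Finset.card_erase_of_mem (Finset.mem_univ u), Finset.card_univ, Fintype.card_fin,
        Nat.cast_pred]
      have : (0 : ℝ) < m := by linarith
      exact_mod_cast this
    have hsum : x / 3 ≤ ∑ v ∈ Finset.univ.erase u, (P₁.prod (Measure.pi (ρ v))).real E := by
      calc x / 3 = 2 / 3 * (m * p) * (1 / x ^ 2 * (1 / 2)) := by
            rw [← hx3]; field_simp
        _ ≤ (m - 1) * p * (1 / x ^ 2 * (1 / 2)) :=
            mul_le_mul_of_nonneg_right (by nlinarith) (by positivity)
        _ = (Finset.univ.erase u).card • (1 / x ^ 2 * (p / 2)) := by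
            rw [nsmul_eq_mul, hcardu]; ring
        _ ≤ _ := Finset.card_nsmul_le_sum _ _ _ fun v _ => hEp v
    have hcount := measure_count_le (fun v => P₁.prod (Measure.pi (ρ v))) (E := fun _ => E)
      (fun _ => hEm) (Finset.univ.erase u) (by positivity) hsum
    have e48 : 16 / (x / 3) = 48 / x := by field_simp; norm_num
    rw [e48] at hcount
    refine (measure_mono fun R hR => ?_).trans hcount
    rw [Set.mem_ofPred_eq] at hR ⊢
    have hsub : (Finset.univ.erase u).filter (fun v => R v ∈ E) ⊆
        closeCandidates (n * p ^ 2 / 2) Cl (Function.update R u (z, o)) u i := fun v hv => by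
      rw [Finset.mem_filter, Finset.mem_erase] at hv
      obtain ⟨⟨hvu, -⟩, hv1, hv2, hv3⟩ := hv
      rw [closeCandidates, Finset.mem_filter, mem_candidates, overlap_maskOf_update hvu]
      refine ⟨⟨hvu, ?_, ?_⟩, ?_⟩
      · simpa [maskOf, hvu] using hv2
      · have h1 : (((sO o).filter fun j => (R v).2 j = true).card : ℝ) ≤
            (((Finset.univ.filter fun j => o j = true).filter fun j => (R v).2 j = true).card : ℝ) :=
          Nat.cast_le.2 (Finset.card_le_card (Finset.filter_subset_filter _
            (Finset.filter_subset_filter _ (Finset.subset_univ _))))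
        linarith
      · simpa [hvu] using hv1
    have h1 : ∑ v ∈ Finset.univ.erase u, E.indicator (1 : X × (Fin n → Bool) → ℝ) (R v) =
        (((Finset.univ.erase u).filter fun v => R v ∈ E).card : ℝ) := by
      rw [Finset.card_filter]
      push_cast
      exact Finset.sum_congr rfl fun v _ => by simp [Set.indicator_apply]
    have h2 : (((Finset.univ.erase u).filter fun v => R v ∈ E).card : ℝ) + 1 ≤ k := by
      exact_mod_cast (Finset.card_le_card hsub).trans_lt hR
    rw [h1]
    linarith

end Rows

/-! ### Joint laws of groups of independent variables -/

section Grouping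

variable {ι : Type*} {Ω : Type*} {mΩ : MeasurableSpace Ω} {𝓕 : ι → MeasurableSpace Ω}
  {μ : Measure Ω} [IsProbabilityMeasure μ]

theorem biSup_mono_set {S T : Set ι} (h : S ⊆ T) : ⨆ i ∈ S, 𝓕 i ≤ ⨆ i ∈ T, 𝓕 i :=
  iSup₂_le fun i hi => le_iSup₂_of_le i (h hi) le_rfl

theorem map_prod_eq_of_disjoint (hle : ∀ i, 𝓕 i ≤ mΩ) (hind : iIndep 𝓕 μ) {S T : Set ι}
    (hST : Disjoint S T) {α β : Type*} [MeasurableSpace α] [MeasurableSpace β] {f : Ω → α}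
    {g : Ω → β} (hf : Measurable[⨆ i ∈ S, 𝓕 i] f) (hg : Measurable[⨆ i ∈ T, 𝓕 i] g) :
    μ.map (fun ω => (f ω, g ω)) = (μ.map f).prod (μ.map g) := by
  have h1 := indep_iSup_of_disjoint hle hind hST
  have h2 : IndepFun f g μ := by
    rw [IndepFun_iff_Indep]
    exact indep_of_indep_of_le_left (indep_of_indep_of_le_right h1 hg.comap_le) hf.comap_le
  exact (indepFun_iff_map_prod_eq_prod_map_map
    (hf.mono (iSup₂_le fun i _ => hle i) le_rfl).aemeasurable
    (hg.mono (iSup₂_le fun i _ => hle i) le_rfl).aemeasurable).1 h2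

theorem map_pi_eq_of_disjoint (hle : ∀ i, 𝓕 i ≤ mΩ) (hind : iIndep 𝓕 μ) {κ : Type*} [Fintype κ]
    {S : κ → Set ι} (hS : ∀ k l, k ≠ l → Disjoint (S k) (S l)) {β : κ → Type*}
    [∀ k, MeasurableSpace (β k)] {f : ∀ k, Ω → β k}
    (hf : ∀ k, Measurable[⨆ i ∈ S k, 𝓕 i] (f k)) :
    μ.map (fun ω k => f k ω) = Measure.pi fun k => μ.map (f k) := by
  classical
  have hfm : ∀ k, Measurable (f k) := fun k => (hf k).mono (iSup₂_le fun i _ => hle i) le_rfl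
  have : ∀ k, IsProbabilityMeasure (μ.map (f k)) := fun k =>
    Measure.isProbabilityMeasure_map (hfm k).aemeasurable
  refine (Measure.pi_eq fun s hs => ?_).symm
  have key : ∀ K : Finset κ, μ (⋂ k ∈ K, f k ⁻¹' s k) = ∏ k ∈ K, μ (f k ⁻¹' s k) := fun K => by
    induction K using Finset.induction_on with
    | empty => simp
    | insert a K ha ih =>
      have hdis : Disjoint (S a) (⋃ k ∈ K, S k) := by
        rw [Set.disjoint_iUnion₂_right]
        exact fun k hk => hS a k fun h => ha (h ▸ hk)
      have h1 := indep_iSup_of_disjoint hle hind hdis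
      have hm1 : MeasurableSet[⨆ i ∈ S a, 𝓕 i] (f a ⁻¹' s a) := hf a (hs a)
      have hm2 : MeasurableSet[⨆ i ∈ ⋃ k ∈ K, S k, 𝓕 i] (⋂ k ∈ K, f k ⁻¹' s k) :=
        @Finset.measurableSet_biInter _ _ (⨆ i ∈ ⋃ k ∈ K, S k, 𝓕 i) _ K fun k hk =>
          biSup_mono_set (𝓕 := 𝓕) (Set.subset_biUnion_of_mem (u := S) hk) _ (hf k (hs k))
      rw [Finset.set_biInter_insert, Finset.prod_insert ha, ← ih]
      exact (Indep_iff _ _ _).1 h1 _ _ hm1 hm2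
  rw [Measure.map_apply (measurable_pi_iff.2 hfm) (MeasurableSet.univ_pi hs)]
  have e : (fun ω k => f k ω) ⁻¹' Set.univ.pi s = ⋂ k ∈ Finset.univ, f k ⁻¹' s k := by
    ext ω; simp
  rw [e, key]
  exact Finset.prod_congr rfl fun k _ => (Measure.map_apply (hfm k) (hs k)).symm

end Grouping

namespace LatentModel

variable {L D Be γ M : ℝ} (𝓜 : LatentModel.{u, v} L D Be γ M)

/-- The index set of the independent variables. -/
abbrev Index : Type := Fin 𝓜.m ⊕ (Fin 𝓜.n ⊕ (Fin 𝓜.m × Fin 𝓜.n ⊕ Fin 𝓜.m × Fin 𝓜.n))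

/-- The σ-algebras that are independent. -/
abbrev sigmas : 𝓜.Index → MeasurableSpace 𝓜.Ω :=
  Sum.elim (fun u => MeasurableSpace.comap (𝓜.x₁ u) inferInstance)
      (Sum.elim (fun i => MeasurableSpace.comap (𝓜.x₂ i) inferInstance)
        (Sum.elim
          (fun e : Fin 𝓜.m × Fin 𝓜.n => MeasurableSpace.comap (𝓜.η e.1 e.2) inferInstance)
          (fun e : Fin 𝓜.m × Fin 𝓜.n => MeasurableSpace.comap (𝓜.obs e.1 e.2) inferInstance)))

theorem sigmas_le (t : 𝓜.Index) : 𝓜.sigmas t ≤ 𝓜.measurableΩ := by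
  rcases t with u | i | e | e
  · exact (𝓜.measurable_x₁ u).comap_le
  · exact (𝓜.measurable_x₂ i).comap_le
  · exact (𝓜.measurable_η e.1 e.2).comap_le
  · exact (𝓜.measurable_obs e.1 e.2).comap_le

theorem iIndep_sigmas : iIndep 𝓜.sigmas 𝓜.μ := 𝓜.indep

/-- The features of the rows together with the mask. -/
def rowData (ω : 𝓜.Ω) (v : Fin 𝓜.m) : (Fin 𝓜.d → ℝ) × (Fin 𝓜.n → Bool) :=
  (𝓜.x₁ v ω, fun j => 𝓜.obs v j ω)

/-- The features of the columns together with the noise. -/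
def colData (ω : 𝓜.Ω) (j : Fin 𝓜.n) : 𝓜.X₂ × (Fin 𝓜.m → ℝ) :=
  (𝓜.x₂ j ω, fun v => 𝓜.η v j ω)

/-- The law of the indicator that an entry is observed. -/
noncomputable def obsLaw (v : Fin 𝓜.m) (j : Fin 𝓜.n) : Measure Bool := 𝓜.μ.map (𝓜.obs v j)

/-- The law of a noise variable. -/
noncomputable def noiseLaw (v : Fin 𝓜.m) (j : Fin 𝓜.n) : Measure ℝ := 𝓜.μ.map (𝓜.η v j)

instance (v : Fin 𝓜.m) (j : Fin 𝓜.n) : IsProbabilityMeasure (𝓜.obsLaw v j) :=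
  Measure.isProbabilityMeasure_map (𝓜.measurable_obs v j).aemeasurable

instance (v : Fin 𝓜.m) (j : Fin 𝓜.n) : IsProbabilityMeasure (𝓜.noiseLaw v j) :=
  Measure.isProbabilityMeasure_map (𝓜.measurable_η v j).aemeasurable

/-- The law of a row feature. -/
noncomputable def featureLaw : Measure (Fin 𝓜.d → ℝ) :=
  ProbabilityTheory.cond volume (cube 𝓜.corner 𝓜.side)

theorem map_x₁ (v : Fin 𝓜.m) : 𝓜.μ.map (𝓜.x₁ v) = 𝓜.featureLaw := 𝓜.law_x₁ v

instance : IsProbabilityMeasure 𝓜.featureLaw := by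
  rw [← 𝓜.map_x₁ ⟨0, 𝓜.m_pos⟩]
  exact Measure.isProbabilityMeasure_map (𝓜.measurable_x₁ _).aemeasurable

theorem measurable_sigmas {α : Type*} [mα : MeasurableSpace α] {f : 𝓜.Ω → α} {t : 𝓜.Index}
    {S : Set 𝓜.Index} (ht : t ∈ S) (hf : Measurable[𝓜.sigmas t] f) :
    Measurable[⨆ t ∈ S, 𝓜.sigmas t] f :=
  hf.mono (le_iSup₂_of_le t ht le_rfl) le_rfl

theorem measurable_x₁_sigmas (v : Fin 𝓜.m) : Measurable[𝓜.sigmas (.inl v)] (𝓜.x₁ v) :=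
  comap_measurable _

theorem measurable_x₂_sigmas (j : Fin 𝓜.n) : Measurable[𝓜.sigmas (.inr (.inl j))] (𝓜.x₂ j) :=
  comap_measurable _

theorem measurable_η_sigmas (v : Fin 𝓜.m) (j : Fin 𝓜.n) :
    Measurable[𝓜.sigmas (.inr (.inr (.inl (v, j))))] (𝓜.η v j) :=
  comap_measurable _

theorem measurable_obs_sigmas (v : Fin 𝓜.m) (j : Fin 𝓜.n) :
    Measurable[𝓜.sigmas (.inr (.inr (.inr (v, j))))] (𝓜.obs v j) :=
  comap_measurable _

/-- The indices of the mask in row `v`. -/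
def maskIndex (v : Fin 𝓜.m) : Set 𝓜.Index := {t | ∃ j, t = .inr (.inr (.inr (v, j)))}

/-- The indices of the noise in column `j`. -/
def noiseIndex (j : Fin 𝓜.n) : Set 𝓜.Index := {t | ∃ v, t = .inr (.inr (.inl (v, j)))}

/-- The indices that belong to row `v`. -/
def rowIndex (v : Fin 𝓜.m) : Set 𝓜.Index := {.inl v} ∪ 𝓜.maskIndex v

/-- The indices that belong to column `j`. -/
def colIndex (j : Fin 𝓜.n) : Set 𝓜.Index := {.inr (.inl j)} ∪ 𝓜.noiseIndex j

theorem measurable_mask_sigmas (v : Fin 𝓜.m) :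
    Measurable[⨆ t ∈ 𝓜.maskIndex v, 𝓜.sigmas t] fun ω j => 𝓜.obs v j ω :=
  @measurable_pi_iff _ _ _ (⨆ t ∈ 𝓜.maskIndex v, 𝓜.sigmas t) _ _ |>.2 fun j =>
    𝓜.measurable_sigmas ⟨j, rfl⟩ (𝓜.measurable_obs_sigmas v j)

theorem measurable_noise_sigmas (j : Fin 𝓜.n) :
    Measurable[⨆ t ∈ 𝓜.noiseIndex j, 𝓜.sigmas t] fun ω v => 𝓜.η v j ω :=
  @measurable_pi_iff _ _ _ (⨆ t ∈ 𝓜.noiseIndex j, 𝓜.sigmas t) _ _ |>.2 fun v =>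
    𝓜.measurable_sigmas ⟨v, rfl⟩ (𝓜.measurable_η_sigmas v j)

theorem measurable_rowData_sigmas (v : Fin 𝓜.m) :
    Measurable[⨆ t ∈ 𝓜.rowIndex v, 𝓜.sigmas t] fun ω => 𝓜.rowData ω v := by
  have h1 : Measurable[⨆ t ∈ 𝓜.rowIndex v, 𝓜.sigmas t] (𝓜.x₁ v) :=
    𝓜.measurable_sigmas (Or.inl rfl) (𝓜.measurable_x₁_sigmas v)
  have h2 : Measurable[⨆ t ∈ 𝓜.rowIndex v, 𝓜.sigmas t] fun ω j => 𝓜.obs v j ω :=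
    (𝓜.measurable_mask_sigmas v).mono (biSup_mono_set fun _ h => Or.inr h) le_rfl
  exact h1.prodMk h2

theorem measurable_colData_sigmas (j : Fin 𝓜.n) :
    Measurable[⨆ t ∈ 𝓜.colIndex j, 𝓜.sigmas t] fun ω => 𝓜.colData ω j := by
  have h1 : Measurable[⨆ t ∈ 𝓜.colIndex j, 𝓜.sigmas t] (𝓜.x₂ j) :=
    𝓜.measurable_sigmas (Or.inl rfl) (𝓜.measurable_x₂_sigmas j)
  have h2 : Measurable[⨆ t ∈ 𝓜.colIndex j, 𝓜.sigmas t] fun ω v => 𝓜.η v j ω :=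
    (𝓜.measurable_noise_sigmas j).mono (biSup_mono_set fun _ h => Or.inr h) le_rfl
  exact h1.prodMk h2

theorem map_rowData_apply (v : Fin 𝓜.m) : 𝓜.μ.map (fun ω => 𝓜.rowData ω v) =
    𝓜.featureLaw.prod (Measure.pi (𝓜.obsLaw v)) := by
  have h1 := map_prod_eq_of_disjoint 𝓜.sigmas_le 𝓜.iIndep_sigmas
    (S := {.inl v}) (T := 𝓜.maskIndex v) (by
      rw [Set.disjoint_singleton_left]; rintro ⟨j, h⟩; simp at h)
    (𝓜.measurable_sigmas rfl (𝓜.measurable_x₁_sigmas v)) (𝓜.measurable_mask_sigmas v)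
  have h2 := map_pi_eq_of_disjoint 𝓜.sigmas_le 𝓜.iIndep_sigmas
    (S := fun j : Fin 𝓜.n => {.inr (.inr (.inr (v, j)))}) (f := fun j => 𝓜.obs v j)
    (fun k l hkl => by
      rw [Set.disjoint_singleton]; simpa using hkl)
    (fun j => 𝓜.measurable_sigmas rfl (𝓜.measurable_obs_sigmas v j))
  rw [h2, 𝓜.map_x₁] at h1
  exact h1

theorem map_colData_apply (j : Fin 𝓜.n) : 𝓜.μ.map (fun ω => 𝓜.colData ω j) =
    𝓜.P₂.prod (Measure.pi fun v => 𝓜.noiseLaw v j) := by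
  have h1 := map_prod_eq_of_disjoint 𝓜.sigmas_le 𝓜.iIndep_sigmas
    (S := {.inr (.inl j)}) (T := 𝓜.noiseIndex j) (by
      rw [Set.disjoint_singleton_left]; rintro ⟨v, h⟩; simp at h)
    (𝓜.measurable_sigmas rfl (𝓜.measurable_x₂_sigmas j)) (𝓜.measurable_noise_sigmas j)
  have h2 := map_pi_eq_of_disjoint 𝓜.sigmas_le 𝓜.iIndep_sigmas
    (S := fun v : Fin 𝓜.m => {.inr (.inr (.inl (v, j)))}) (f := fun v => 𝓜.η v j)
    (fun k l hkl => by
      rw [Set.disjoint_singleton]; simpa using hkl)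
    (fun v => 𝓜.measurable_sigmas rfl (𝓜.measurable_η_sigmas v j))
  rw [h2, 𝓜.law_x₂] at h1
  exact h1

/-- The row data and the column data are independent, with product laws. -/
theorem map_data : 𝓜.μ.map (fun ω => (𝓜.rowData ω, 𝓜.colData ω)) =
    (rowLaw 𝓜.featureLaw 𝓜.obsLaw).prod
      (Measure.pi fun j => 𝓜.P₂.prod (Measure.pi fun v => 𝓜.noiseLaw v j)) := by
  have h1 := map_prod_eq_of_disjoint 𝓜.sigmas_le 𝓜.iIndep_sigmas
    (S := ⋃ v, 𝓜.rowIndex v) (T := ⋃ j, 𝓜.colIndex j) (f := 𝓜.rowData) (g := 𝓜.colData) (by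
      rw [Set.disjoint_iUnion_left]
      intro v
      rw [Set.disjoint_iUnion_right]
      intro j
      rw [Set.disjoint_left]
      rintro t (rfl | ⟨j', rfl⟩) (h | ⟨v', h⟩) <;> simp at h)
    (@measurable_pi_iff _ _ _ (⨆ t ∈ ⋃ v, 𝓜.rowIndex v, 𝓜.sigmas t) _ _ |>.2 fun v =>
      (𝓜.measurable_rowData_sigmas v).mono
        (biSup_mono_set (Set.subset_iUnion 𝓜.rowIndex v)) le_rfl)
    (@measurable_pi_iff _ _ _ (⨆ t ∈ ⋃ j, 𝓜.colIndex j, 𝓜.sigmas t) _ _ |>.2 fun j =>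
      (𝓜.measurable_colData_sigmas j).mono
        (biSup_mono_set (Set.subset_iUnion 𝓜.colIndex j)) le_rfl)
  have h2 := map_pi_eq_of_disjoint 𝓜.sigmas_le 𝓜.iIndep_sigmas
    (S := 𝓜.rowIndex) (f := fun v ω => 𝓜.rowData ω v) (fun v w hvw => by
      rw [Set.disjoint_left]
      rintro t (rfl | ⟨j', rfl⟩) (h | ⟨v', h⟩) <;> simp at h
      · exact hvw h
      · exact hvw h.1) 𝓜.measurable_rowData_sigmas
  have h3 := map_pi_eq_of_disjoint 𝓜.sigmas_le 𝓜.iIndep_sigmas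
    (S := 𝓜.colIndex) (f := fun j ω => 𝓜.colData ω j) (fun v w hvw => by
      rw [Set.disjoint_left]
      rintro t (rfl | ⟨j', rfl⟩) (h | ⟨v', h⟩) <;> simp at h
      · exact hvw h
      · exact hvw h.2) 𝓜.measurable_colData_sigmas
  rw [h1]
  congr 1
  · refine h2.trans ?_
    unfold rowLaw
    congr 1
    funext v
    exact 𝓜.map_rowData_apply v
  · refine h3.trans ?_
    congr 1
    funext j
    exact 𝓜.map_colData_apply j

end LatentModel

/-! ### From the latent variable model to the product model -/

theorem measurable_estimate {m n : ℕ} (β : ℝ) (k : ℕ) (obs : Fin m → Fin n → Bool)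
    (σ : Equiv.Perm (Fin m)) (u : Fin m) (i : Fin n) :
    Measurable fun Z : Fin m → Fin n → ℝ => estimate β k obs Z σ u i := by
  classical
  have hZ : ∀ v j, Measurable fun Z : Fin m → Fin n → ℝ => Z v j := fun v j =>
    (measurable_pi_apply j).comp (measurable_pi_apply v)
  have hmean : ∀ v, Measurable fun Z : Fin m → Fin n → ℝ => diffMean obs Z u v := fun v =>
    (Finset.measurable_fun_sum _ fun j _ => (hZ u j).sub (hZ v j)).div_const _
  have hvar : ∀ v, Measurable fun Z : Fin m → Fin n → ℝ => diffVar obs Z u v := fun v =>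
    (Finset.measurable_fun_sum _ fun j _ =>
      (((hZ u j).sub (hZ v j)).sub (hmean v)).pow_const 2).div_const _
  have hmem : ∀ v, MeasurableSet {Z : Fin m → Fin n → ℝ | v ∈ nearest β k obs Z σ u i} := fun v => by
    simp only [nearest_eq_topk]
    exact measurableSet_mem_topk _ hvar σ k v
  have e : (fun Z : Fin m → Fin n → ℝ => estimate β k obs Z σ u i) = fun Z =>
      (∑ v, if v ∈ nearest β k obs Z σ u i then Z v i + diffMean obs Z u v else 0) /
        ∑ v, if v ∈ nearest β k obs Z σ u i then (1 : ℝ) else 0 := by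
    funext Z
    simp [estimate]
  rw [e]
  exact (Finset.measurable_fun_sum _ fun v _ => Measurable.ite (hmem v) ((hZ v i).add (hmean v))
    measurable_const).div (Finset.measurable_fun_sum _ fun v _ => Measurable.ite (hmem v)
    measurable_const measurable_const)

theorem lintegral_le_of_forall_notMem {Ω : Type*} [MeasurableSpace Ω] {μ : Measure Ω}
    [IsProbabilityMeasure μ] {f : Ω → ℝ≥0∞} {A : Set Ω} {a b : ℝ≥0∞} (h1 : ∀ ω, ω ∉ A → f ω ≤ a)
    (h2 : ∀ ω, f ω ≤ a + b) : ∫⁻ ω, f ω ∂μ ≤ a + b * μ A := by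
  calc ∫⁻ ω, f ω ∂μ ≤ ∫⁻ ω, (a + (toMeasurable μ A).indicator (fun _ => b) ω) ∂μ := by
        refine lintegral_mono fun ω => ?_
        by_cases h : ω ∈ toMeasurable μ A
        · rw [Set.indicator_of_mem h]; exact h2 ω
        · rw [Set.indicator_of_notMem h, add_zero]
          exact h1 ω fun hA => h (subset_toMeasurable μ A hA)
    _ = _ := by
        rw [lintegral_add_left measurable_const, lintegral_const, measure_univ, mul_one,
          lintegral_indicator (measurableSet_toMeasurable _ _), setLIntegral_const,
          measure_toMeasurable]

/-- The nearest point of a cube. -/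
def toCube {d : ℕ} (a : Fin d → ℝ) (s : ℝ) (x : Fin d → ℝ) : Fin d → ℝ :=
  fun c => max (a c) (min (a c + s) (x c))

theorem toCube_mem {d : ℕ} (a : Fin d → ℝ) {s : ℝ} (hs : 0 ≤ s) (x : Fin d → ℝ) :
    toCube a s x ∈ cube a s :=
  ⟨fun c => le_max_left _ _, fun c => max_le (by simpa using hs) (min_le_left _ _)⟩

theorem toCube_of_mem {d : ℕ} {a : Fin d → ℝ} {s : ℝ} {x : Fin d → ℝ} (hx : x ∈ cube a s) :
    toCube a s x = x := by
  funext c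
  unfold toCube
  rw [min_eq_right (hx.2 c), max_eq_right (hx.1 c)]

theorem continuous_toCube {d : ℕ} (a : Fin d → ℝ) (s : ℝ) : Continuous (toCube a s) := by
  unfold toCube; fun_prop

theorem continuous_seminorm {d : ℕ} (N : Seminorm ℝ (Fin d → ℝ)) : Continuous N :=
  (ConvexOn.locallyLipschitz N.convexOn).continuous

namespace LatentModel

variable {L D Be γ M : ℝ} (𝓜 : LatentModel.{u, v} L D Be γ M)

theorem ae_mem_cube (v : Fin 𝓜.m) : ∀ᵐ ω ∂𝓜.μ, 𝓜.x₁ v ω ∈ cube 𝓜.corner 𝓜.side := by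
  have hm : MeasurableSet (cube 𝓜.corner 𝓜.side) := measurableSet_Icc
  have h : 𝓜.μ.map (𝓜.x₁ v) (cube 𝓜.corner 𝓜.side)ᶜ = 0 := by
    rw [𝓜.law_x₁, ProbabilityTheory.cond_apply hm]
    simp
  rw [Measure.map_apply (𝓜.measurable_x₁ v) hm.compl] at h
  exact measure_eq_zero_iff_ae_notMem.1 h |>.mono fun ω hω => by simpa using hω

theorem featureLaw_compl_cube : 𝓜.featureLaw (cube 𝓜.corner 𝓜.side)ᶜ = 0 := by
  have hm : MeasurableSet (cube 𝓜.corner 𝓜.side) := measurableSet_Icc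
  rw [featureLaw, ProbabilityTheory.cond_apply hm]
  simp

theorem Be_nonneg (𝓜 : LatentModel.{u, v} L D Be γ M) : 0 ≤ Be := by
  obtain ⟨ω, hω⟩ := (𝓜.noise_bound ⟨0, 𝓜.m_pos⟩ ⟨0, 𝓜.n_pos⟩).exists
  exact (abs_nonneg _).trans hω

theorem corner_mem : 𝓜.corner ∈ cube 𝓜.corner 𝓜.side :=
  ⟨le_rfl, fun c => by have := 𝓜.side_pos; simp; linarith⟩

theorem D_nonneg (𝓜 : LatentModel.{u, v} L D Be γ M) : 0 ≤ D := by
  have := 𝓜.diam_le _ 𝓜.corner_mem _ 𝓜.corner_mem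
  rwa [sub_self, map_zero] at this

/-- Truncation of the noise. -/
def trunc (b t : ℝ) : ℝ := max (-b) (min b t)

theorem trunc_of_abs_le {b t : ℝ} (h : |t| ≤ b) : trunc b t = t := by
  rw [abs_le] at h
  unfold trunc
  rw [min_eq_right h.2, max_eq_right h.1]

theorem continuous_trunc (b : ℝ) : Continuous (trunc b) := by
  unfold trunc; fun_prop

theorem abs_trunc_le {b : ℝ} (hb : 0 ≤ b) (t : ℝ) : |trunc b t| ≤ b :=
  abs_le.2 ⟨le_max_left _ _, max_le (by linarith) (min_le_left _ _)⟩

/-- The latent function, extended from the cube to the whole space. -/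
def fExt (x : Fin 𝓜.d → ℝ) (y : 𝓜.X₂) : ℝ := 𝓜.f (toCube 𝓜.corner 𝓜.side x) y

theorem fExt_of_mem {x : Fin 𝓜.d → ℝ} (hx : x ∈ cube 𝓜.corner 𝓜.side) (y : 𝓜.X₂) :
    𝓜.fExt x y = 𝓜.f x y := by
  rw [fExt, toCube_of_mem hx]

theorem abs_fExt_sub_le (x x' : Fin 𝓜.d → ℝ) (y y' : 𝓜.X₂) : |𝓜.fExt x y - 𝓜.fExt x' y'| ≤
    L * max (𝓜.rowNorm (toCube 𝓜.corner 𝓜.side x - toCube 𝓜.corner 𝓜.side x')) (dist y y') :=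
  𝓜.lipschitz _ (toCube_mem _ 𝓜.side_pos.le _) _ (toCube_mem _ 𝓜.side_pos.le _) y y'

theorem continuous_fExt : Continuous fun z : (Fin 𝓜.d → ℝ) × 𝓜.X₂ => 𝓜.fExt z.1 z.2 := by
  rw [continuous_iff_continuousAt]
  intro z
  rw [ContinuousAt, tendsto_iff_dist_tendsto_zero]
  have h1 : Continuous fun z' : (Fin 𝓜.d → ℝ) × 𝓜.X₂ => L * max (𝓜.rowNorm
      (toCube 𝓜.corner 𝓜.side z'.1 - toCube 𝓜.corner 𝓜.side z.1)) (dist z'.2 z.2) := by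
    have h2 := continuous_toCube 𝓜.corner 𝓜.side
    have h3 := continuous_seminorm 𝓜.rowNorm
    have h4 : Continuous fun z' : (Fin 𝓜.d → ℝ) × 𝓜.X₂ => 𝓜.rowNorm
      (toCube 𝓜.corner 𝓜.side z'.1 - toCube 𝓜.corner 𝓜.side z.1) :=
      h3.comp ((h2.comp continuous_fst).sub continuous_const)
    exact continuous_const.mul (h4.max (continuous_snd.dist continuous_const))
  have h5 := h1.tendsto z
  simp only [sub_self, map_zero, dist_self, max_self, mul_zero] at h5
  exact squeeze_zero (fun _ => dist_nonneg) (fun z' => 𝓜.abs_fExt_sub_le _ _ _ _) h5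

theorem measurable_fExt : Measurable fun z : (Fin 𝓜.d → ℝ) × 𝓜.X₂ => 𝓜.fExt z.1 z.2 :=
  𝓜.continuous_fExt.measurable

theorem integral_trunc_η (v : Fin 𝓜.m) (j : Fin 𝓜.n) (q : ℕ) :
    ∫ t, trunc Be t ^ q ∂(𝓜.noiseLaw v j) = ∫ ω, 𝓜.η v j ω ^ q ∂𝓜.μ := by
  rw [noiseLaw, integral_map (𝓜.measurable_η v j).aemeasurable
    ((continuous_trunc Be).measurable.pow_const q).aestronglyMeasurable]
  exact integral_congr_ae ((𝓜.noise_bound v j).mono fun ω hω => by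
    simp only [trunc_of_abs_le hω])

/-- The model for given row features. -/
noncomputable def colModel (hL : 0 ≤ L) (X : Fin 𝓜.m → Fin 𝓜.d → ℝ) :
    ColumnModel 𝓜.m 𝓜.n 𝓜.X₂ (L * D) Be γ where
  P := 𝓜.P₂
  ν := 𝓜.noiseLaw
  E := trunc Be
  measurable_E := (continuous_trunc Be).measurable
  abs_E_le := abs_trunc_le 𝓜.Be_nonneg
  integral_E v j := by
    have := 𝓜.integral_trunc_η v j 1
    simpa [𝓜.noise_mean] using this
  integral_E_sq v j := by
    rw [𝓜.integral_trunc_η v j 2, ← variance_of_integral_eq_zero (𝓜.measurable_η v j).aemeasurable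
      (𝓜.noise_mean v j), 𝓜.noise_var]
  F v := 𝓜.fExt (X v)
  measurable_F v := 𝓜.measurable_fExt.comp (measurable_const.prodMk measurable_id)
  abs_F_sub_le v w y := by
    refine (𝓜.abs_fExt_sub_le _ _ _ _).trans (mul_le_mul_of_nonneg_left ?_ hL)
    rw [dist_self]
    exact max_le (𝓜.diam_le _ (toCube_mem _ 𝓜.side_pos.le _) _ (toCube_mem _ 𝓜.side_pos.le _))
      𝓜.D_nonneg
  Δ_nonneg := mul_nonneg hL 𝓜.D_nonneg

theorem law_colModel (hL : 0 ≤ L) (X : Fin 𝓜.m → Fin 𝓜.d → ℝ) : (𝓜.colModel hL X).law =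
    Measure.pi fun j => 𝓜.P₂.prod (Measure.pi fun v => 𝓜.noiseLaw v j) := rfl

/-- The squared error as a function of the row data and the column data. -/
noncomputable def sqErr (hL : 0 ≤ L) (β : ℝ) (k : ℕ) (σ : Equiv.Perm (Fin 𝓜.m)) (u : Fin 𝓜.m)
    (i : Fin 𝓜.n)
    (R : Fin 𝓜.m → (Fin 𝓜.d → ℝ) × (Fin 𝓜.n → Bool)) (C : Fin 𝓜.n → 𝓜.X₂ × (Fin 𝓜.m → ℝ)) : ℝ :=
  (estimate β k (maskOf R) ((𝓜.colModel hL fun v => (R v).1).noisy C) σ u i -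
    (𝓜.colModel hL fun v => (R v).1).F u (C i).1) ^ 2

theorem measurable_sqErr (hL : 0 ≤ L) (β : ℝ) (k : ℕ) (σ : Equiv.Perm (Fin 𝓜.m)) (u : Fin 𝓜.m)
    (i : Fin 𝓜.n) : Measurable fun z : (Fin 𝓜.m → (Fin 𝓜.d → ℝ) × (Fin 𝓜.n → Bool)) ×
      (Fin 𝓜.n → 𝓜.X₂ × (Fin 𝓜.m → ℝ)) => 𝓜.sqErr hL β k σ u i z.1 z.2 := by
  have h1 : Measurable fun z : (Fin 𝓜.m → Fin 𝓜.n → Bool) × (Fin 𝓜.m → Fin 𝓜.n → ℝ) =>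
      estimate β k z.1 z.2 σ u i :=
    measurable_from_prod_countable_right fun o => measurable_estimate β k o σ u i
  have hF : ∀ v j, Measurable fun z : (Fin 𝓜.m → (Fin 𝓜.d → ℝ) × (Fin 𝓜.n → Bool)) ×
      (Fin 𝓜.n → 𝓜.X₂ × (Fin 𝓜.m → ℝ)) => 𝓜.fExt (z.1 v).1 (z.2 j).1 := fun v j =>
    𝓜.measurable_fExt.comp
      ((measurable_fst.comp ((measurable_pi_apply v).comp measurable_fst)).prodMk
        (measurable_fst.comp ((measurable_pi_apply j).comp measurable_snd)))
  have hE : ∀ v j, Measurable fun z : (Fin 𝓜.m → (Fin 𝓜.d → ℝ) × (Fin 𝓜.n → Bool)) ×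
      (Fin 𝓜.n → 𝓜.X₂ × (Fin 𝓜.m → ℝ)) => trunc Be ((z.2 j).2 v) := fun v j =>
    (continuous_trunc Be).measurable.comp ((measurable_pi_apply v).comp
      (measurable_snd.comp ((measurable_pi_apply j).comp measurable_snd)))
  have h2 : Measurable fun z : (Fin 𝓜.m → (Fin 𝓜.d → ℝ) × (Fin 𝓜.n → Bool)) ×
      (Fin 𝓜.n → 𝓜.X₂ × (Fin 𝓜.m → ℝ)) => (maskOf z.1, fun v j =>
        𝓜.fExt (z.1 v).1 (z.2 j).1 + trunc Be ((z.2 j).2 v)) :=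
    (measurable_maskOf.comp measurable_fst).prodMk (measurable_pi_iff.2 fun v =>
      measurable_pi_iff.2 fun j => (hF v j).add (hE v j))
  exact ((h1.comp h2).sub (hF u i)).pow_const 2

theorem measurable_data : Measurable fun ω => (𝓜.rowData ω, 𝓜.colData ω) := by
  have hrow : Measurable 𝓜.rowData := measurable_pi_iff.2 fun v =>
    (𝓜.measurable_x₁ v).prodMk (measurable_pi_iff.2 fun j => 𝓜.measurable_obs v j)
  have hcol : Measurable 𝓜.colData := measurable_pi_iff.2 fun j =>
    (𝓜.measurable_x₂ j).prodMk (measurable_pi_iff.2 fun v => 𝓜.measurable_η v j)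
  exact hrow.prodMk hcol

theorem measurable_sqErr_data (hL : 0 ≤ L) (β : ℝ) (k : ℕ) (σ : Equiv.Perm (Fin 𝓜.m))
    (u : Fin 𝓜.m) (i : Fin 𝓜.n) : Measurable fun ω =>
      ENNReal.ofReal (𝓜.sqErr hL β k σ u i (𝓜.rowData ω) (𝓜.colData ω)) :=
  ((𝓜.measurable_sqErr hL β k σ u i).comp 𝓜.measurable_data).ennreal_ofReal

theorem ae_sq_estimate_sub_eq (hL : 0 ≤ L) (β : ℝ) (k : ℕ)
    (σ : Fin 𝓜.m → Fin 𝓜.n → Equiv.Perm (Fin 𝓜.m)) : ∀ᵐ ω ∂𝓜.μ, ∀ u i,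
    (estimate β k (fun u' i' => 𝓜.obs u' i' ω) (𝓜.Z ω) (σ u i) u i - 𝓜.A ω u i) ^ 2 =
      𝓜.sqErr hL β k (σ u i) u i (𝓜.rowData ω) (𝓜.colData ω) := by
  have hae : ∀ᵐ ω ∂𝓜.μ, ∀ v, 𝓜.x₁ v ω ∈ cube 𝓜.corner 𝓜.side ∧ ∀ j, |𝓜.η v j ω| ≤ Be :=
    ae_all_iff.2 fun v => (𝓜.ae_mem_cube v).and (ae_all_iff.2 fun j => 𝓜.noise_bound v j)
  filter_upwards [hae] with ω hω u i
  have hA : ∀ v j, 𝓜.A ω v j = 𝓜.fExt (𝓜.x₁ v ω) (𝓜.x₂ j ω) := fun v j =>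
    (𝓜.fExt_of_mem (hω v).1 _).symm
  have hZ : 𝓜.Z ω = (𝓜.colModel hL fun v => (𝓜.rowData ω v).1).noisy (𝓜.colData ω) := by
    funext v j
    change 𝓜.A ω v j + 𝓜.η v j ω = 𝓜.fExt (𝓜.x₁ v ω) (𝓜.x₂ j ω) + trunc Be (𝓜.η v j ω)
    rw [hA, trunc_of_abs_le ((hω v).2 j)]
  have hmask : maskOf (𝓜.rowData ω) = fun u' i' => 𝓜.obs u' i' ω := rfl
  have hF : (𝓜.colModel hL fun v => (𝓜.rowData ω v).1).F u (𝓜.colData ω i).1 =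
    𝓜.fExt (𝓜.x₁ u ω) (𝓜.x₂ i ω) := rfl
  rw [sqErr, hmask, hF, ← hZ, hA]

theorem lintegral_sqErr_data (hL : 0 ≤ L) (β : ℝ) (k : ℕ) (σ : Equiv.Perm (Fin 𝓜.m))
    (u : Fin 𝓜.m) (i : Fin 𝓜.n) :
    ∫⁻ ω, ENNReal.ofReal (𝓜.sqErr hL β k σ u i (𝓜.rowData ω) (𝓜.colData ω)) ∂𝓜.μ =
    ∫⁻ R, ∫⁻ C, ENNReal.ofReal (𝓜.sqErr hL β k σ u i R C)
      ∂(𝓜.colModel hL fun v => (R v).1).law ∂(rowLaw 𝓜.featureLaw 𝓜.obsLaw) := by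
  have hS := (𝓜.measurable_sqErr hL β k σ u i).ennreal_ofReal
  have h1 := lintegral_map (μ := 𝓜.μ) hS 𝓜.measurable_data
  simp only [𝓜.law_colModel hL]
  rw [← h1, 𝓜.map_data]
  exact lintegral_prod _ hS.aemeasurable

theorem mse_le (hL : 0 ≤ L) {β : ℝ} {k : ℕ} {σ : Fin 𝓜.m → Fin 𝓜.n → Equiv.Perm (Fin 𝓜.m)}
    {b : ℝ≥0∞} (h : ∀ u i, ∫⁻ R, ∫⁻ C, ENNReal.ofReal (𝓜.sqErr hL β k (σ u i) u i R C)
      ∂(𝓜.colModel hL fun v => (R v).1).law ∂(rowLaw 𝓜.featureLaw 𝓜.obsLaw) ≤ b) :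
    𝓜.mse β k σ ≤ b := by
  have hm : (0 : ℝ) < 𝓜.m := by exact_mod_cast 𝓜.m_pos
  have hn : (0 : ℝ) < 𝓜.n := by exact_mod_cast 𝓜.n_pos
  set w := ENNReal.ofReal (1 / ((𝓜.m : ℝ) * (𝓜.n : ℝ))) with hw
  have e1 : 𝓜.mse β k σ = ∫⁻ ω, ∑ u, ∑ i, w *
      ENNReal.ofReal (𝓜.sqErr hL β k (σ u i) u i (𝓜.rowData ω) (𝓜.colData ω)) ∂𝓜.μ := by
    refine lintegral_congr_ae ((𝓜.ae_sq_estimate_sub_eq hL β k σ).mono fun ω hω => ?_)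
    simp only [hω]
    have h0 : ∀ u i, 0 ≤ 𝓜.sqErr hL β k (σ u i) u i (𝓜.rowData ω) (𝓜.colData ω) :=
      fun u i => sq_nonneg _
    rw [ENNReal.ofReal_mul (by positivity),
      ENNReal.ofReal_sum_of_nonneg fun u _ => Finset.sum_nonneg fun i _ => h0 u i, Finset.mul_sum]
    refine Finset.sum_congr rfl fun u _ => ?_
    rw [ENNReal.ofReal_sum_of_nonneg fun i _ => h0 u i, Finset.mul_sum]
  have hSd : ∀ u i, Measurable fun ω => w *
      ENNReal.ofReal (𝓜.sqErr hL β k (σ u i) u i (𝓜.rowData ω) (𝓜.colData ω)) :=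
    fun u i => (𝓜.measurable_sqErr_data hL β k (σ u i) u i).const_mul _
  have e2 : ∀ u, ∫⁻ ω, ∑ i, w *
      ENNReal.ofReal (𝓜.sqErr hL β k (σ u i) u i (𝓜.rowData ω) (𝓜.colData ω)) ∂𝓜.μ ≤
      ∑ _i : Fin 𝓜.n, w * b := fun u => by
    rw [lintegral_finsetSum _ fun i _ => hSd u i]
    refine Finset.sum_le_sum fun i _ => ?_
    rw [lintegral_const_mul _ (𝓜.measurable_sqErr_data hL β k (σ u i) u i),
      𝓜.lintegral_sqErr_data]
    exact mul_le_mul_right (h u i) _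
  rw [e1, lintegral_finsetSum _ fun u _ => Finset.measurable_fun_sum _ fun i _ => hSd u i]
  refine (Finset.sum_le_sum fun u _ => e2 u).trans (le_of_eq ?_)
  simp only [Finset.sum_const, Finset.card_univ, Fintype.card_fin, nsmul_eq_mul]
  rw [← mul_assoc, ← mul_assoc, ← ENNReal.ofReal_natCast, ← ENNReal.ofReal_natCast,
    ← ENNReal.ofReal_mul hm.le, hw, ← ENNReal.ofReal_mul (by positivity)]
  have : (𝓜.m : ℝ) * 𝓜.n * (1 / (𝓜.m * 𝓜.n)) = 1 := by field_simp
  rw [this, ENNReal.ofReal_one, one_mul]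

end LatentModel
namespace LatentModel

variable {L D Be γ M : ℝ} (𝓜 : LatentModel.{u, v} L D Be γ M)

theorem obsLaw_true (v : Fin 𝓜.m) (j : Fin 𝓜.n) : 𝓜.obsLaw v j {true} = ENNReal.ofReal 𝓜.p := by
  rw [obsLaw, Measure.map_apply (𝓜.measurable_obs v j) (MeasurableSet.singleton _), ← 𝓜.law_obs v j]
  rfl

/-- Pairs of row features at relative distance at most `l`. -/
def closePairs (l : ℝ) : Set ((Fin 𝓜.d → ℝ) × (Fin 𝓜.d → ℝ)) :=
  {z | 𝓜.rowNorm (toCube 𝓜.corner 𝓜.side z.1 - toCube 𝓜.corner 𝓜.side z.2) ≤ l * D}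

theorem measurableSet_closePairs (l : ℝ) : MeasurableSet (𝓜.closePairs l) := by
  have h2 := continuous_toCube 𝓜.corner 𝓜.side
  have h : Continuous fun z : (Fin 𝓜.d → ℝ) × (Fin 𝓜.d → ℝ) =>
      𝓜.rowNorm (toCube 𝓜.corner 𝓜.side z.1 - toCube 𝓜.corner 𝓜.side z.2) :=
    (continuous_seminorm 𝓜.rowNorm).comp ((h2.comp continuous_fst).sub (h2.comp continuous_snd))
  exact measurableSet_le h.measurable measurable_const

theorem le_featureLaw_closePairs {l : ℝ} (hl : 0 ≤ l) (hl1 : l ≤ 1) {z : Fin 𝓜.d → ℝ}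
    (hz : z ∈ cube 𝓜.corner 𝓜.side) :
    l ^ 𝓜.d ≤ 𝓜.featureLaw.real {y | (z, y) ∈ 𝓜.closePairs l} := by
  refine (le_cond_cube_ball 𝓜.corner 𝓜.side_pos 𝓜.rowNorm 𝓜.diam_le hl hl1 hz).trans ?_
  rw [← featureLaw, measureReal_def, measureReal_def]
  refine ENNReal.toReal_mono (measure_ne_top _ _) (measure_mono_ae ?_)
  have h : ∀ᵐ y ∂𝓜.featureLaw, y ∈ cube 𝓜.corner 𝓜.side := by
    rw [ae_iff]; exact 𝓜.featureLaw_compl_cube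
  filter_upwards [h] with y hy hyz
  change 𝓜.rowNorm (toCube 𝓜.corner 𝓜.side z - toCube 𝓜.corner 𝓜.side y) ≤ l * D
  rw [toCube_of_mem hz, toCube_of_mem hy]
  exact hyz

variable (hL : 0 ≤ L) (k : ℕ) (σ : Equiv.Perm (Fin 𝓜.m)) (u : Fin 𝓜.m) (i : Fin 𝓜.n)
  {R : Fin 𝓜.m → (Fin 𝓜.d → ℝ) × (Fin 𝓜.n → Bool)}

theorem nearest_nonempty_of_le_card {β l : ℝ} (hk : 0 < k)
    (h : k ≤ (closeCandidates β (𝓜.closePairs l) R u i).card) (Z : Fin 𝓜.m → Fin 𝓜.n → ℝ) :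
    (nearest β k (maskOf R) Z σ u i).Nonempty := by
  classical
  rw [← Finset.card_pos, ColumnModel.nearest_card_eq (maskOf R) u i
    (Finset.filter_subset _ _ : closeCandidates β (𝓜.closePairs l) R u i ⊆ _) h]
  exact hk

theorem sqErr_le_of_nonempty {β : ℝ} {C : Fin 𝓜.n → 𝓜.X₂ × (Fin 𝓜.m → ℝ)}
    (h : (nearest β k (maskOf R) ((𝓜.colModel hL fun v => (R v).1).noisy C) σ u i).Nonempty) :
    𝓜.sqErr hL β k σ u i R C ≤ 4 * (L * D + 2 * Be) ^ 2 :=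
  (𝓜.colModel hL fun v => (R v).1).sq_estimate_sub_le (maskOf R) u i h

theorem sqErr_le (β : ℝ) (R : Fin 𝓜.m → (Fin 𝓜.d → ℝ) × (Fin 𝓜.n → Bool))
    (C : Fin 𝓜.n → 𝓜.X₂ × (Fin 𝓜.m → ℝ)) :
    𝓜.sqErr hL β k σ u i R C ≤ 4 * (L * D + 2 * Be) ^ 2 + M ^ 2 := by
  rcases (nearest β k (maskOf R)
    ((𝓜.colModel hL fun v => (R v).1).noisy C) σ u i).eq_empty_or_nonempty with h | h
  · have e : 𝓜.sqErr hL β k σ u i R C = 𝓜.fExt (R u).1 (C i).1 ^ 2 := by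
      rw [sqErr, estimate, h]
      simp only [Finset.sum_empty, zero_div, zero_sub, neg_sq]
      rfl
    have h1 : |𝓜.fExt (R u).1 (C i).1| ≤ M := 𝓜.bounded _ (toCube_mem _ 𝓜.side_pos.le _) _
    rw [e, ← sq_abs]
    have h2 := pow_le_pow_left₀ (abs_nonneg _) h1 2
    linarith [sq_nonneg (L * D + 2 * Be)]
  · have := 𝓜.sqErr_le_of_nonempty hL k σ u i h
    linarith [sq_nonneg M]

theorem favourable {x l : ℝ} (hx3 : x ^ 3 = 𝓜.n * 𝓜.p ^ 2) (hk : 0 < k)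
    (hm : (𝓜.m : ℝ) ≤ Real.exp x)
    (h1 : k ≤ (closeCandidates (𝓜.n * 𝓜.p ^ 2 / 2) (𝓜.closePairs l) R u i).card)
    (h2 : ∀ v, v ≠ u → ((overlap (maskOf R) u v).card : ℝ) ≤ 8 * (𝓜.n * 𝓜.p ^ 2)) :
    (𝓜.colModel hL fun v => (R v).1).Favourable (maskOf R) u i k x (L * (l * D)) := by
  classical
  refine ⟨hk, hm, fun w hw => ?_, _, ?_, h1, fun w hw y => ?_⟩
  · rw [hx3]
    exact h2 w (mem_candidates.1 hw).1
  · rw [hx3]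
    exact Finset.filter_subset _ _
  · have hcl : 𝓜.rowNorm (toCube 𝓜.corner 𝓜.side (R u).1 - toCube 𝓜.corner 𝓜.side (R w).1) ≤
        l * D := (Finset.mem_filter.1 hw).2
    refine (𝓜.abs_fExt_sub_le _ _ _ _).trans (mul_le_mul_of_nonneg_left ?_ hL)
    rw [dist_self]
    exact max_le hcl ((apply_nonneg _ _).trans hcl)

theorem rowLaw_few_le {x X l : ℝ} (hx : 4 ≤ x) (hx3 : x ^ 3 = 𝓜.n * 𝓜.p ^ 2) (hX : 16 ≤ X)
    (hX3 : X ^ 3 = 𝓜.m * 𝓜.p) (hl : 0 ≤ l) (hl1 : l ≤ 1) (hld : 1 / X ^ 2 ≤ l ^ 𝓜.d)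
    (hk : (k : ℝ) ≤ X / 8 + 1) :
    rowLaw 𝓜.featureLaw 𝓜.obsLaw {R |
      (closeCandidates (𝓜.n * 𝓜.p ^ 2 / 2) (𝓜.closePairs l) R u i).card < k} ≤
      ENNReal.ofReal (32 / x + 48 / X) := by
  have hx64 : 64 ≤ x ^ 3 := by nlinarith [sq_nonneg x]
  have hp0 : 0 < 𝓜.p := lt_of_le_of_ne 𝓜.p_mem.1 fun h => by
    rw [← h] at hx3; norm_num at hx3; rw [hx3] at hx; norm_num at hx
  have h := rowLaw_few_close_le 𝓜.featureLaw 𝓜.obsLaw hp0 𝓜.p_mem.2 𝓜.obsLaw_true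
    (𝓜.measurableSet_closePairs l) (measurableSet_Icc : MeasurableSet (cube 𝓜.corner 𝓜.side))
    𝓜.featureLaw_compl_cube (by linarith) hX3
    (fun z hz => hld.trans (𝓜.le_featureLaw_closePairs hl hl1 hz)) (by rw [← hx3]; exact hx64) hk u i
  refine h.trans ?_
  rw [← ENNReal.ofReal_add (by positivity) (by positivity)]
  refine ENNReal.ofReal_le_ofReal (add_le_add_left ?_ _)
  rw [← hx3]
  have : x ≤ x ^ 3 := by nlinarith [sq_nonneg x]
  gcongr

theorem rowLaw_long_le {x : ℝ} (hx : 4 ≤ x) (hx3 : x ^ 3 = 𝓜.n * 𝓜.p ^ 2)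
    (hm : (𝓜.m : ℝ) ≤ Real.exp x) :
    rowLaw 𝓜.featureLaw 𝓜.obsLaw {R | ∃ v, v ≠ u ∧
      8 * (𝓜.n * 𝓜.p ^ 2) < ((overlap (maskOf R) u v).card : ℝ)} ≤ ENNReal.ofReal (2 / x) := by
  refine (rowLaw_overlap_gt_le 𝓜.featureLaw 𝓜.obsLaw 𝓜.p_mem.1 𝓜.obsLaw_true u).trans ?_
  have hx0 : 0 < x := by linarith
  have hxx : x ≤ x ^ 3 := by nlinarith [sq_nonneg x]
  have hexp : Real.exp (-x) ≤ 1 / x := by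
    rw [Real.exp_neg, ← one_div]
    exact one_div_le_one_div_of_le hx0 (by linarith [Real.add_one_le_exp x])
  rw [← ENNReal.ofReal_add (by positivity) (by positivity)]
  refine ENNReal.ofReal_le_ofReal ?_
  have h1 : Real.exp (-(𝓜.n * 𝓜.p)) ≤ Real.exp (-x) := by
    refine Real.exp_le_exp.2 (neg_le_neg (hxx.trans ?_))
    rw [hx3]
    have : 𝓜.p ^ 2 ≤ 𝓜.p := by nlinarith [𝓜.p_mem.1, 𝓜.p_mem.2]
    exact mul_le_mul_of_nonneg_left this (Nat.cast_nonneg _)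
  have h2 : 𝓜.m * Real.exp (-(2 * (𝓜.n * 𝓜.p ^ 2))) ≤ Real.exp (-x) := by
    rw [← hx3]
    calc 𝓜.m * Real.exp (-(2 * x ^ 3)) ≤ Real.exp x * Real.exp (-(2 * x ^ 3)) :=
          mul_le_mul_of_nonneg_right hm (Real.exp_pos _).le
      _ = Real.exp (x + -(2 * x ^ 3)) := (Real.exp_add _ _).symm
      _ ≤ _ := Real.exp_le_exp.2 (by linarith)
  have e : 2 / x = 1 / x + 1 / x := by ring
  rw [e]
  linarith

/-- The bound that holds for arbitrarily many rows. -/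
theorem lintegral_sqErr_le {x X l : ℝ} (hx : 4 ≤ x) (hx3 : x ^ 3 = 𝓜.n * 𝓜.p ^ 2) (hX : 16 ≤ X)
    (hX3 : X ^ 3 = 𝓜.m * 𝓜.p) (hl : 0 ≤ l) (hl1 : l ≤ 1) (hld : 1 / X ^ 2 ≤ l ^ 𝓜.d)
    (hk : |(k : ℝ) - X / 8| < 1) :
    ∫⁻ R, ∫⁻ C, ENNReal.ofReal (𝓜.sqErr hL (𝓜.n * 𝓜.p ^ 2 / 2) k σ u i R C)
      ∂(𝓜.colModel hL fun v => (R v).1).law ∂(rowLaw 𝓜.featureLaw 𝓜.obsLaw) ≤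
      ENNReal.ofReal (4 * (L * D + 2 * Be) ^ 2 + M ^ 2 * (32 / x + 48 / X)) := by
  rw [abs_lt] at hk
  have hk0 : 0 < k := by
    have : (0 : ℝ) < k := by linarith [hk.1]
    exact_mod_cast this
  refine (lintegral_le_of_forall_notMem (A := {R | (closeCandidates (𝓜.n * 𝓜.p ^ 2 / 2)
    (𝓜.closePairs l) R u i).card < k}) (a := ENNReal.ofReal (4 * (L * D + 2 * Be) ^ 2))
    (b := ENNReal.ofReal (M ^ 2)) (fun R hR => ?_) (fun R => ?_)).trans ?_
  · rw [Set.mem_ofPred_eq, not_lt] at hR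
    calc _ ≤ ∫⁻ C, ENNReal.ofReal (4 * (L * D + 2 * Be) ^ 2)
          ∂(𝓜.colModel hL fun v => (R v).1).law :=
          lintegral_mono fun C => ENNReal.ofReal_le_ofReal (𝓜.sqErr_le_of_nonempty hL k σ u i
            (𝓜.nearest_nonempty_of_le_card k σ u i hk0 hR _))
      _ = _ := by rw [lintegral_const, measure_univ, mul_one]
  · rw [← ENNReal.ofReal_add (by positivity) (by positivity)]
    calc _ ≤ ∫⁻ C, ENNReal.ofReal (4 * (L * D + 2 * Be) ^ 2 + M ^ 2)
          ∂(𝓜.colModel hL fun v => (R v).1).law :=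
          lintegral_mono fun C => ENNReal.ofReal_le_ofReal (𝓜.sqErr_le hL k σ u i _ R C)
      _ = _ := by rw [lintegral_const, measure_univ, mul_one]
  · rw [ENNReal.ofReal_add (by positivity) (by positivity), ENNReal.ofReal_mul (sq_nonneg M)]
    gcongr
    exact 𝓜.rowLaw_few_le k u i hx hx3 hX hX3 hl hl1 hld (by linarith [hk.2])

/-- The mean squared error in terms of the typical number `x ^ 3` of common columns, the typical
number `X ^ 3` of rows that are observed in a column, and the relative distance `l` within which
sufficiently many row features are found. -/
theorem exists_mse_le (L D Be γ M : ℝ) (hL : 0 ≤ L) :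
    ∃ x₀ K : ℝ, 4 ≤ x₀ ∧ 0 ≤ K ∧ ∀ (𝓜 : LatentModel.{u, v} L D Be γ M) (k : ℕ)
      (σ : Fin 𝓜.m → Fin 𝓜.n → Equiv.Perm (Fin 𝓜.m)) (x X l : ℝ), x₀ ≤ x →
      x ^ 3 = 𝓜.n * 𝓜.p ^ 2 → 16 ≤ X → X ^ 3 = 𝓜.m * 𝓜.p → 0 ≤ l → l ≤ 1 → 1 / X ^ 2 ≤ l ^ 𝓜.d →
      |(k : ℝ) - X / 8| < 1 →
      ((𝓜.m : ℝ) ≤ Real.exp x → 𝓜.mse (𝓜.n * 𝓜.p ^ 2 / 2) k σ ≤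
        ENNReal.ofReal (K * (l ^ 2 + 1 / x + 1 / X))) ∧
      𝓜.mse (𝓜.n * 𝓜.p ^ 2 / 2) k σ ≤
        ENNReal.ofReal (4 * (L * D + 2 * Be) ^ 2 + K * (1 / x + 1 / X)) := by
  obtain ⟨x₀, K, hK, hcore⟩ := ColumnModel.exists_lintegral_sq_err_le.{u} (L * D) Be γ
  obtain ⟨b, hb⟩ : ∃ b, b = 4 * (L * D + 2 * Be) ^ 2 + M ^ 2 := ⟨_, rfl⟩
  have hb0 : 0 ≤ b := by rw [hb]; positivity
  refine ⟨max x₀ 4, K * (L ^ 2 * D ^ 2) + 17 * K + 48 * b + 48 * M ^ 2, le_max_right _ _,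
    by positivity, ?_⟩
  intro 𝓜 k σ x X l hx hx3 hX hX3 hl hl1 hld hk
  have hx4 : 4 ≤ x := (le_max_right _ _).trans hx
  have hx0 : 0 < x := by linarith
  have hX0 : 0 < X := by linarith
  have hk' := abs_lt.1 hk
  have hkX : X / 16 ≤ k := by linarith [hk'.1]
  have hk0R : (0 : ℝ) < k := by linarith
  have hk0 : 0 < k := by exact_mod_cast hk0R
  refine ⟨fun hm => 𝓜.mse_le hL fun u i => ?_, (𝓜.mse_le hL fun u i =>
    𝓜.lintegral_sqErr_le hL k (σ u i) u i hx4 hx3 hX hX3 hl hl1 hld hk).trans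
    (ENNReal.ofReal_le_ofReal ?_)⟩
  · refine (lintegral_le_of_forall_notMem (A := {R | (closeCandidates (𝓜.n * 𝓜.p ^ 2 / 2)
      (𝓜.closePairs l) R u i).card < k} ∪ {R | ∃ v, v ≠ u ∧
      8 * (𝓜.n * 𝓜.p ^ 2) < ((overlap (maskOf R) u v).card : ℝ)})
      (a := ENNReal.ofReal (K * ((L * (l * D)) ^ 2 + 1 / x + 1 / k)))
      (b := ENNReal.ofReal b) (fun R hR => ?_) (fun R => ?_)).trans ?_
    · simp only [Set.mem_union, Set.mem_ofPred_eq, not_or, not_lt, not_exists, not_and] at hR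
      have hfav := 𝓜.favourable hL k u i hx3 hk0 hm hR.1 hR.2
      have := hcore _ (maskOf R) u i k (σ u i) x _ ((le_max_left _ _).trans hx) hfav
      rw [hx3] at this
      exact this
    · refine le_add_left ?_
      rw [hb]
      calc _ ≤ ∫⁻ C, ENNReal.ofReal (4 * (L * D + 2 * Be) ^ 2 + M ^ 2)
            ∂(𝓜.colModel hL fun v => (R v).1).law :=
            lintegral_mono fun C => ENNReal.ofReal_le_ofReal (𝓜.sqErr_le hL k (σ u i) u i _ R C)
        _ = _ := by rw [lintegral_const, measure_univ, mul_one]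
    · have h1 := 𝓜.rowLaw_few_le k u i hx4 hx3 hX hX3 hl hl1 hld (by linarith [hk'.2])
      have h2 := 𝓜.rowLaw_long_le u hx4 hx3 hm
      calc _ ≤ ENNReal.ofReal (K * ((L * (l * D)) ^ 2 + 1 / x + 1 / k)) + ENNReal.ofReal b *
            (ENNReal.ofReal (32 / x + 48 / X) + ENNReal.ofReal (2 / x)) := by
            gcongr
            exact (measure_union_le _ _).trans (add_le_add h1 h2)
        _ = ENNReal.ofReal (K * ((L * (l * D)) ^ 2 + 1 / x + 1 / k) +
            b * (32 / x + 48 / X + 2 / x)) := by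
            rw [← ENNReal.ofReal_add (by positivity) (by positivity), ← ENNReal.ofReal_mul hb0,
              ← ENNReal.ofReal_add (by positivity) (by positivity)]
        _ ≤ _ := by
            refine ENNReal.ofReal_le_ofReal ?_
            have i1 : 1 / (k : ℝ) ≤ 16 * (1 / X) := by
              rw [mul_one_div, div_le_div_iff₀ hk0R hX0]; linarith
            have i2 : K * (1 / (k : ℝ)) ≤ K * (16 * (1 / X)) := mul_le_mul_of_nonneg_left i1 hK
            have j1 : 0 ≤ (17 * K + 48 * b + 48 * M ^ 2) * l ^ 2 := by positivity
            have j2 : 0 ≤ (K * (L ^ 2 * D ^ 2) + 16 * K + 14 * b + 48 * M ^ 2) * (1 / x) := by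
              positivity
            have j3 : 0 ≤ (K * (L ^ 2 * D ^ 2) + K + 48 * M ^ 2) * (1 / X) := by
              positivity
            have e : (K * (L ^ 2 * D ^ 2) + 17 * K + 48 * b + 48 * M ^ 2) *
              (l ^ 2 + 1 / x + 1 / X) = (K * (L * (l * D)) ^ 2 + K * (1 / x) + K * (16 * (1 / X)) +
              b * (32 / x + 48 / X + 2 / x)) + ((17 * K + 48 * b + 48 * M ^ 2) * l ^ 2 +
              (K * (L ^ 2 * D ^ 2) + 16 * K + 14 * b + 48 * M ^ 2) * (1 / x) +
              (K * (L ^ 2 * D ^ 2) + K + 48 * M ^ 2) * (1 / X)) := by ring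
            rw [e, mul_add, mul_add]
            linarith
  · have j1 : 0 ≤ (K * (L ^ 2 * D ^ 2) + 17 * K + 48 * b) * (1 / x + 1 / X) := by positivity
    have j2 : 0 ≤ 16 * M ^ 2 * (1 / x) := by positivity
    have e : (K * (L ^ 2 * D ^ 2) + 17 * K + 48 * b + 48 * M ^ 2) * (1 / x + 1 / X) =
      M ^ 2 * (32 / x + 48 / X) + ((K * (L ^ 2 * D ^ 2) + 17 * K + 48 * b) * (1 / x + 1 / X) +
        16 * M ^ 2 * (1 / x)) := by ring
    rw [e]
    linarith

end LatentModel

theorem rpow_le_mul_of_rpow_le {m p δ : ℝ} (hm : 1 ≤ m) (h : m ^ (-1 + δ) ≤ p) :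
    m ^ δ ≤ m * p := by
  have hm0 : 0 < m := by linarith
  calc m ^ δ = m * m ^ (-1 + δ) := by
        rw [Real.rpow_add hm0, Real.rpow_neg_one, mul_inv_cancel_left₀ hm0.ne']
    _ ≤ m * p := by gcongr

theorem rpow_le_mul_sq_of_rpow_le {n p δ : ℝ} (hn : 1 ≤ n) (h : n ^ (-(1 / 2 : ℝ) + δ) ≤ p) :
    n ^ (2 * δ) ≤ n * p ^ 2 := by
  have hn0 : 0 < n := by linarith
  calc n ^ (2 * δ) = n * (n ^ (-(1 / 2 : ℝ) + δ)) ^ 2 := by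
        rw [← Real.rpow_natCast, ← Real.rpow_mul hn0.le]
        nth_rw 2 [← Real.rpow_one n]
        rw [← Real.rpow_add hn0]
        congr 1
        push_cast
        ring
    _ ≤ n * p ^ 2 := by gcongr

theorem rpow_one_third_pow_three {a : ℝ} (ha : 0 ≤ a) : (a ^ (1 / 3 : ℝ)) ^ 3 = a := by
  rw [← Real.rpow_natCast, ← Real.rpow_mul ha]
  norm_num

theorem one_div_rpow_one_third {a : ℝ} (ha : 0 ≤ a) :
    1 / a ^ (1 / 3 : ℝ) = a ^ (-(1 / 3 : ℝ)) := by
  rw [Real.rpow_neg ha, one_div]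

theorem rpow_two_thirds_div_pow {a : ℝ} (ha : 0 ≤ a) {d : ℕ} (hd : 0 < d) :
    (a ^ (-(2 / (3 * (d : ℝ))))) ^ d = 1 / (a ^ (1 / 3 : ℝ)) ^ 2 := by
  have hd' : (d : ℝ) ≠ 0 := by positivity
  rw [one_div, ← Real.rpow_natCast, ← Real.rpow_natCast, ← Real.rpow_mul ha, ← Real.rpow_mul ha,
    ← Real.rpow_neg ha]
  congr 1
  push_cast
  field_simp

theorem rpow_two_thirds_div_sq {a : ℝ} (ha : 0 ≤ a) (d : ℕ) :
    (a ^ (-(2 / (3 * (d : ℝ))))) ^ 2 = a ^ (-(4 / (3 * (d : ℝ)))) := by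
  rw [← Real.rpow_natCast, ← Real.rpow_mul ha]
  congr 1
  push_cast
  ring

namespace LatentModel

variable {L D Be γ M : ℝ}

/-- The bounds on the mean squared error in terms of `m`, `n`, `p` and `d`. -/
theorem exists_mse_le_rpow (L D Be γ M : ℝ) (hL : 0 ≤ L) :
    ∃ x₀ K : ℝ, 16 ≤ x₀ ∧ 0 ≤ K ∧ ∀ (𝓜 : LatentModel.{u, v} L D Be γ M) (k : ℕ)
      (σ : Fin 𝓜.m → Fin 𝓜.n → Equiv.Perm (Fin 𝓜.m)),
      1 ≤ (𝓜.m : ℝ) * 𝓜.p → 1 ≤ (𝓜.n : ℝ) * 𝓜.p ^ 2 →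
      x₀ ≤ ((𝓜.n : ℝ) * 𝓜.p ^ 2) ^ (1 / 3 : ℝ) → x₀ ≤ ((𝓜.m : ℝ) * 𝓜.p) ^ (1 / 3 : ℝ) →
      |(k : ℝ) - (1 / 8) * ((𝓜.m : ℝ) * 𝓜.p) ^ (1 / 3 : ℝ)| < 1 →
      ((𝓜.m : ℝ) ≤ Real.exp (((𝓜.n : ℝ) * 𝓜.p ^ 2) ^ (1 / 3 : ℝ)) →
        𝓜.mse (𝓜.n * 𝓜.p ^ 2 / 2) k σ ≤ ENNReal.ofReal (K *
          (((𝓜.m : ℝ) * 𝓜.p) ^ (-(4 / (3 * (𝓜.d : ℝ)))) +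
            ((𝓜.n : ℝ) * 𝓜.p ^ 2) ^ (-(1 / 3 : ℝ)) + ((𝓜.m : ℝ) * 𝓜.p) ^ (-(1 / 3 : ℝ))))) ∧
      𝓜.mse (𝓜.n * 𝓜.p ^ 2 / 2) k σ ≤ ENNReal.ofReal (4 * (L * D + 2 * Be) ^ 2 + K *
        (((𝓜.n : ℝ) * 𝓜.p ^ 2) ^ (-(1 / 3 : ℝ)) + ((𝓜.m : ℝ) * 𝓜.p) ^ (-(1 / 3 : ℝ)))) := by
  obtain ⟨x₀, K, -, hK, h⟩ := exists_mse_le.{u, v} L D Be γ M hL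
  refine ⟨max x₀ 16, K, le_max_right _ _, hK, fun 𝓜 k σ ha hb hx hX hk => ?_⟩
  have ha0 : 0 ≤ (𝓜.m : ℝ) * 𝓜.p := by linarith
  have hb0 : 0 ≤ (𝓜.n : ℝ) * 𝓜.p ^ 2 := by linarith
  have := h 𝓜 k σ _ _ (((𝓜.m : ℝ) * 𝓜.p) ^ (-(2 / (3 * (𝓜.d : ℝ)))))
    ((le_max_left _ _).trans hx) (rpow_one_third_pow_three hb0)
    ((le_max_right _ _).trans hX) (rpow_one_third_pow_three ha0)
    (by positivity) (Real.rpow_le_one_of_one_le_of_nonpos ha (neg_nonpos.2 (by positivity)))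
    (rpow_two_thirds_div_pow ha0 𝓜.d_pos).ge (by convert hk using 3; ring)
  rwa [rpow_two_thirds_div_sq ha0, one_div_rpow_one_third ha0, one_div_rpow_one_third hb0] at this

theorem one_le_m (𝓜 : LatentModel.{u, v} L D Be γ M) : (1 : ℝ) ≤ 𝓜.m := by
  exact_mod_cast 𝓜.m_pos

theorem one_le_n (𝓜 : LatentModel.{u, v} L D Be γ M) : (1 : ℝ) ≤ 𝓜.n := by
  exact_mod_cast 𝓜.n_pos

/-- The bound on the mean squared error, with both rate constants of `F₂` equal to `1`. -/
theorem exists_mse_le_F₁_F₂ (L D Be γ M : ℝ) (hL : 0 ≤ L) (hB : 0 < L * D + 2 * Be) :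
    ∃ C : ℝ, 0 < C ∧ ∀ (𝓜 : LatentModel.{u, v} L D Be γ M) (δ : ℝ) (k : ℕ)
      (σ : Fin 𝓜.m → Fin 𝓜.n → Equiv.Perm (Fin 𝓜.m)), 0 < δ →
      max ((𝓜.m : ℝ) ^ (-1 + δ)) ((𝓜.n : ℝ) ^ (-(1 / 2 : ℝ) + δ)) ≤ 𝓜.p →
      |(k : ℝ) - (1 / 8) * ((𝓜.m : ℝ) * 𝓜.p) ^ (1 / 3 : ℝ)| < 1 →
      F₁ C 𝓜.d 𝓜.m 𝓜.n 𝓜.p ≤ min (1 / 2) (L * D + 2 * Be) →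
      𝓜.mse ((𝓜.n : ℝ) * 𝓜.p ^ 2 / 2) k σ ≤ ENNReal.ofReal
        ((21 / 4) * F₁ C 𝓜.d 𝓜.m 𝓜.n 𝓜.p *
          Real.log (2 * (L * D + 2 * Be) / F₁ C 𝓜.d 𝓜.m 𝓜.n 𝓜.p) +
          4 * (L * D + 2 * Be) ^ 2 * F₂ 1 1 𝓜.m 𝓜.n 𝓜.p) := by
  obtain ⟨x₀, K, hx₀, hK, h⟩ := exists_mse_le_rpow.{u, v} L D Be γ M hL
  refine ⟨x₀ + K, by positivity, fun 𝓜 δ k σ hδ hp hk hF => ?_⟩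
  have ha : 1 ≤ (𝓜.m : ℝ) * 𝓜.p := (Real.one_le_rpow 𝓜.one_le_m hδ.le).trans
    (rpow_le_mul_of_rpow_le 𝓜.one_le_m ((le_max_left _ _).trans hp))
  have hb : 1 ≤ (𝓜.n : ℝ) * 𝓜.p ^ 2 := (Real.one_le_rpow 𝓜.one_le_n (by positivity)).trans
    (rpow_le_mul_sq_of_rpow_le 𝓜.one_le_n ((le_max_right _ _).trans hp))
  have h := h 𝓜 k σ ha hb
  set B := L * D + 2 * Be
  unfold F₁ at hF ⊢
  unfold F₂
  have ha0 : 0 < (𝓜.m : ℝ) * 𝓜.p := by linarith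
  have hb0 : 0 < (𝓜.n : ℝ) * 𝓜.p ^ 2 := by linarith
  generalize (𝓜.m : ℝ) * 𝓜.p = a at *
  generalize (𝓜.n : ℝ) * 𝓜.p ^ 2 = b at *
  set y₁ := a ^ (-(4 / (3 * (𝓜.d : ℝ))))
  have e₂ := one_div_rpow_one_third hb0.le
  have e₃ := one_div_rpow_one_third ha0.le
  set y₂ := b ^ (-(1 / 3 : ℝ))
  set y₃ := a ^ (-(1 / 3 : ℝ))
  set Φ := max (max y₁ y₂) y₃
  set F := (x₀ + K) * Φ with hFdef
  have hy₁ : y₁ ≤ Φ := (le_max_left _ _).trans (le_max_left _ _)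
  have hy₂ : y₂ ≤ Φ := (le_max_right _ _).trans (le_max_left _ _)
  have hy₃ : y₃ ≤ Φ := le_max_right _ _
  have hy₃0 : 0 < y₃ := Real.rpow_pos_of_pos ha0 _
  have hy₂0 : 0 < y₂ := Real.rpow_pos_of_pos hb0 _
  have hΦ : 0 < Φ := hy₃0.trans_le hy₃
  have hF0 : 0 < F := by positivity
  have hF1 : F ≤ 1 / 2 := hF.trans (min_le_left _ _)
  have hFB : F ≤ B := hF.trans (min_le_right _ _)
  have hKF : K * Φ ≤ F := by rw [hFdef, add_mul]; nlinarith
  have hxF : x₀ * Φ ≤ 1 := by rw [hFdef, add_mul] at hF1; nlinarith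
  have hlarge : ∀ {z y : ℝ}, 0 < z → 1 / z = y → y ≤ Φ → x₀ ≤ z := by
    intro z y hz hzy hy
    have : x₀ * (1 / z) ≤ 1 := by rw [hzy]; nlinarith
    rwa [mul_one_div, div_le_one hz] at this
  obtain ⟨h₁, h₂⟩ := h (hlarge (Real.rpow_pos_of_pos hb0 _) e₂ hy₂)
    (hlarge (Real.rpow_pos_of_pos ha0 _) e₃ hy₃) hk
  have hlog : 0.6 ≤ Real.log (2 * B / F) := by
    have : Real.log 2 ≤ Real.log (2 * B / F) := by
      refine Real.log_le_log two_pos ?_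
      rw [le_div_iff₀ hF0]
      linarith
    linarith [Real.log_two_gt_d9]
  have hmain : 3 * F ≤ 21 / 4 * F * Real.log (2 * B / F) := by
    nlinarith [mul_le_mul_of_nonneg_left hlog hF0.le]
  rcases le_or_gt (𝓜.m : ℝ) (Real.exp (b ^ (1 / 3 : ℝ))) with hm | hm
  · refine (h₁ hm).trans (ENNReal.ofReal_le_ofReal ?_)
    have : K * (y₁ + y₂ + y₃) ≤ 3 * F := by
      calc K * (y₁ + y₂ + y₃) ≤ K * (Φ + Φ + Φ) := by gcongr
        _ ≤ 3 * F := by linarith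
    have : 0 ≤ 4 * B ^ 2 * (3 * Real.exp (-(1 * a ^ (1 / 3 : ℝ))) +
      6 * (𝓜.m : ℝ) * Real.exp (-(1 * b ^ (1 / 3 : ℝ)))) := by positivity
    linarith
  · refine h₂.trans (ENNReal.ofReal_le_ofReal ?_)
    have i₁ : K * (y₂ + y₃) ≤ 3 * F := by
      calc K * (y₂ + y₃) ≤ K * (Φ + Φ) := by gcongr
        _ ≤ 3 * F := by linarith
    have i₂ : 1 ≤ (𝓜.m : ℝ) * Real.exp (-(1 * b ^ (1 / 3 : ℝ))) := by
      rw [one_mul, Real.exp_neg, ← div_eq_mul_inv, one_le_div (Real.exp_pos _)]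
      exact hm.le
    have i₃ : 1 ≤ 3 * Real.exp (-(1 * a ^ (1 / 3 : ℝ))) +
        6 * (𝓜.m : ℝ) * Real.exp (-(1 * b ^ (1 / 3 : ℝ))) := by
      have := Real.exp_pos (-(1 * a ^ (1 / 3 : ℝ)))
      linarith
    have i₄ := mul_le_mul_of_nonneg_left i₃ (by positivity : 0 ≤ 4 * B ^ 2)
    linarith

theorem tendsto_rpow_neg_div_of_isLittleO {a m : ℕ → ℝ} {d : ℕ → ℕ} {δ : ℝ} (hδ : 0 < δ)
    (hm : ∀ t, 1 ≤ m t) (hma : ∀ t, m t ^ δ ≤ a t) (hd : ∀ t, 0 < d t)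
    (h : (fun t => (d t : ℝ)) =o[atTop] fun t => Real.log (m t)) :
    Tendsto (fun t => a t ^ (-(4 / (3 * (d t : ℝ))))) atTop (𝓝 0) := by
  have hm0 : ∀ t, 0 < m t := fun t => zero_lt_one.trans_le (hm t)
  have ha0 : ∀ t, 0 < a t := fun t => (Real.rpow_pos_of_pos (hm0 t) δ).trans_le (hma t)
  rw [Metric.tendsto_atTop']
  intro ε hε
  set c := max 1 (-Real.log ε) with hc
  have hc0 : 0 < c := lt_max_of_lt_left one_pos
  obtain ⟨N, hN⟩ := eventually_atTop.1 (h.def (by positivity : 0 < δ / c))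
  refine ⟨N, fun t ht => ?_⟩
  have h₁ := hN t ht.le
  have hd0 : (0 : ℝ) < d t := by exact_mod_cast hd t
  rw [Real.norm_of_nonneg hd0.le, Real.norm_of_nonneg (Real.log_nonneg (hm t)), div_mul_eq_mul_div,
    le_div_iff₀ hc0] at h₁
  have h₂ : δ * Real.log (m t) ≤ Real.log (a t) := by
    rw [← Real.log_rpow (hm0 t)]
    exact Real.log_le_log (Real.rpow_pos_of_pos (hm0 t) _) (hma t)
  rw [Real.dist_0_eq_abs, abs_of_pos (Real.rpow_pos_of_pos (ha0 t) _),
    Real.rpow_def_of_pos (ha0 t), ← Real.lt_log_iff_exp_lt hε]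
  have h₃ : c ≤ Real.log (a t) / d t := by
    rw [le_div_iff₀ hd0]
    linarith
  have h₄ : Real.log (a t) * -(4 / (3 * (d t : ℝ))) = -(4 / 3 * (Real.log (a t) / d t)) := by
    field_simp
  have h₅ : -Real.log ε ≤ c := le_max_right _ _
  rw [h₄]
  linarith

/-- Consistency of the estimator along a sequence of models of moderately growing dimension. -/
theorem tendsto_mse (hL : 0 ≤ L) {δ δ' : ℝ} (𝓜 : ℕ → LatentModel.{u, v} L D Be γ M) (k : ℕ → ℕ)
    (σ : ∀ t, Fin (𝓜 t).m → Fin (𝓜 t).n → Equiv.Perm (Fin (𝓜 t).m)) (hδ : 0 < δ) (hδ' : δ' < 1)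
    (hm : Tendsto (fun t => (𝓜 t).m) atTop atTop) (hn : Tendsto (fun t => (𝓜 t).n) atTop atTop)
    (hp : ∀ t, max (((𝓜 t).m : ℝ) ^ (-1 + δ)) (((𝓜 t).n : ℝ) ^ (-(1 / 2 : ℝ) + δ)) ≤ (𝓜 t).p)
    (hk : ∀ t, |(k t : ℝ) - (1 / 8) * (((𝓜 t).m : ℝ) * (𝓜 t).p) ^ (1 / 3 : ℝ)| < 1)
    (hd : (fun t => ((𝓜 t).d : ℝ)) =o[atTop] fun t => Real.log ((𝓜 t).m : ℝ))
    (hlog : ∀ t, Real.log ((𝓜 t).m : ℝ) < (((𝓜 t).n : ℝ) * (𝓜 t).p ^ 2) ^ (δ' / 3)) :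
    Tendsto (fun t => (𝓜 t).mse (((𝓜 t).n : ℝ) * (𝓜 t).p ^ 2 / 2) (k t) (σ t)) atTop (𝓝 0) := by
  obtain ⟨x₀, K, hx₀, hK, h⟩ := exists_mse_le_rpow.{u, v} L D Be γ M hL
  have ha : ∀ t, ((𝓜 t).m : ℝ) ^ δ ≤ (𝓜 t).m * (𝓜 t).p := fun t =>
    rpow_le_mul_of_rpow_le (𝓜 t).one_le_m ((le_max_left _ _).trans (hp t))
  have hb : ∀ t, ((𝓜 t).n : ℝ) ^ (2 * δ) ≤ (𝓜 t).n * (𝓜 t).p ^ 2 := fun t =>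
    rpow_le_mul_sq_of_rpow_le (𝓜 t).one_le_n ((le_max_right _ _).trans (hp t))
  have ha1 : ∀ t, 1 ≤ ((𝓜 t).m : ℝ) * (𝓜 t).p := fun t =>
    (Real.one_le_rpow (𝓜 t).one_le_m hδ.le).trans (ha t)
  have hb1 : ∀ t, 1 ≤ ((𝓜 t).n : ℝ) * (𝓜 t).p ^ 2 := fun t =>
    (Real.one_le_rpow (𝓜 t).one_le_n (by positivity)).trans (hb t)
  have hat : Tendsto (fun t => ((𝓜 t).m : ℝ) * (𝓜 t).p) atTop atTop :=
    tendsto_atTop_mono ha ((tendsto_rpow_atTop hδ).comp (tendsto_natCast_atTop_atTop.comp hm))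
  have hbt : Tendsto (fun t => ((𝓜 t).n : ℝ) * (𝓜 t).p ^ 2) atTop atTop :=
    tendsto_atTop_mono hb ((tendsto_rpow_atTop (by positivity : 0 < 2 * δ)).comp
      (tendsto_natCast_atTop_atTop.comp hn))
  have h3 : (0 : ℝ) < 1 / 3 := by norm_num
  have hlim := ((tendsto_rpow_neg_div_of_isLittleO hδ (fun t => (𝓜 t).one_le_m) ha
    (fun t => (𝓜 t).d_pos) hd).add ((tendsto_rpow_neg_atTop h3).comp hbt)).add
    ((tendsto_rpow_neg_atTop h3).comp hat)
  have hlim' := ENNReal.tendsto_ofReal (hlim.const_mul K)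
  rw [add_zero, add_zero, mul_zero, ENNReal.ofReal_zero] at hlim'
  refine tendsto_of_tendsto_of_tendsto_of_le_of_le' tendsto_const_nhds hlim'
    (Eventually.of_forall fun t => zero_le) ?_
  filter_upwards [((tendsto_rpow_atTop h3).comp hat).eventually_ge_atTop x₀,
    ((tendsto_rpow_atTop h3).comp hbt).eventually_ge_atTop x₀] with t hta htb
  refine (h (𝓜 t) (k t) (σ t) (ha1 t) (hb1 t) htb hta (hk t)).1 ?_
  rw [← Real.log_le_iff_le_exp (zero_lt_one.trans_le (𝓜 t).one_le_m)]
  exact (hlog t).le.trans (Real.rpow_le_rpow_of_exponent_le (hb1 t) (by linarith))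

end LatentModel
end BlindRegression

theorem corollary4p3 :
    -- the bound: `c₁` is numerical, `c₂` depends on `B₀` only, and none of the constants depends
    -- on `d, m, n, p, δ`, the cube, its norm, the column space, `f`, or the laws of the noise
    (∃ c₁ : ℝ, 0 < c₁ ∧ ∀ B₀ : ℝ, 0 < B₀ → ∃ c₂ : ℝ, 0 < c₂ ∧
      ∀ L D Be γ M : ℝ, 0 ≤ L → B₀ = L * D + 2 * Be → ∃ C : ℝ, 0 < C ∧
        ∀ (𝓜 : BlindRegression.LatentModel.{u, v} L D Be γ M) (δ : ℝ) (k : ℕ)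
          (σ : Fin 𝓜.m → Fin 𝓜.n → Equiv.Perm (Fin 𝓜.m)),
          0 < δ →
          max ((𝓜.m : ℝ) ^ (-1 + δ)) ((𝓜.n : ℝ) ^ (-(1 / 2 : ℝ) + δ)) ≤ 𝓜.p →
          |(k : ℝ) - (1 / 8) * ((𝓜.m : ℝ) * 𝓜.p) ^ (1 / 3 : ℝ)| < 1 →
          BlindRegression.F₁ C 𝓜.d 𝓜.m 𝓜.n 𝓜.p ≤ min (1 / 2) B₀ →
          𝓜.mse ((𝓜.n : ℝ) * 𝓜.p ^ 2 / 2) k σ ≤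
            ENNReal.ofReal
              ((21 / 4) * BlindRegression.F₁ C 𝓜.d 𝓜.m 𝓜.n 𝓜.p *
                  Real.log (2 * B₀ / BlindRegression.F₁ C 𝓜.d 𝓜.m 𝓜.n 𝓜.p) +
                4 * B₀ ^ 2 * BlindRegression.F₂ c₁ c₂ 𝓜.m 𝓜.n 𝓜.p)) ∧
    -- consistency
    (∀ (L D Be γ M : ℝ), 0 ≤ L →
      ∀ (δ δ' : ℝ) (𝓜 : ℕ → BlindRegression.LatentModel.{u, v} L D Be γ M) (k : ℕ → ℕ)
        (σ : ∀ t, Fin (𝓜 t).m → Fin (𝓜 t).n → Equiv.Perm (Fin (𝓜 t).m)),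
        0 < δ → 0 < δ' → δ' < 1 →
        Tendsto (fun t => (𝓜 t).m) atTop atTop →
        Tendsto (fun t => (𝓜 t).n) atTop atTop →
        (∀ t, max (((𝓜 t).m : ℝ) ^ (-1 + δ)) (((𝓜 t).n : ℝ) ^ (-(1 / 2 : ℝ) + δ)) ≤ (𝓜 t).p) →
        (∀ t, |(k t : ℝ) - (1 / 8) * (((𝓜 t).m : ℝ) * (𝓜 t).p) ^ (1 / 3 : ℝ)| < 1) →
        ((fun t => ((𝓜 t).d : ℝ)) =o[atTop] fun t => Real.log ((𝓜 t).m : ℝ)) →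
        (∀ t, Real.log ((𝓜 t).m : ℝ) < (((𝓜 t).n : ℝ) * (𝓜 t).p ^ 2) ^ (δ' / 3)) →
        Tendsto (fun t => (𝓜 t).mse (((𝓜 t).n : ℝ) * (𝓜 t).p ^ 2 / 2) (k t) (σ t))
          atTop (𝓝 0)) := by
  refine ⟨⟨1, one_pos, fun B₀ hB => ⟨1, one_pos, fun L D Be γ M hL hB₀ => ?_⟩⟩,
    fun L D Be γ M hL δ δ' 𝓜 k σ hδ _ hδ' hm hn hp hk hd hlog =>
      BlindRegression.LatentModel.tendsto_mse hL 𝓜 k σ hδ hδ' hm hn hp hk hd hlog⟩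
  subst hB₀
  exact BlindRegression.LatentModel.exists_mse_le_F₁_F₂ L D Be γ M hL hB
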